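/- Let $\mathbb K$ be $\mathbb R$ or $\mathbb C$, let $M$ be a smooth (second countable, Hausdorff) manifold of dimension $m$, and let $A\to M$ be a $\mathbb K$-Lie algebroid of rank $n$ with bracket $[\cdot,\cdot]$, anchor $a$ (with values in $TM$, resp. $TM\otimes\mathbb C$) and differential $d$. Let $\Lambda\in\Gamma(\wedge^2A)$ satisfy $[[\Lambda,\Lambda],X]=0$ for all $X\in\Gamma(A)$ (Schouten bracket), and let $(A,A^*)$ be the corresponding exact Lie bialgebroid; that is, $A^*$ carries the bracket $$[\xi,\theta]_\Lambda=\mathcal L_{\Lambda^\sharp\xi}\theta-\mathcal L_{\Lambda^\sharp\theta}\xi-d(\Lambda(\xi,\theta))$$ and the anchor $a_*=a\circ\Lambda^\sharp$, where $\langle\Lambda^\sharp\xi,\theta\rangle=\Lambda(\xi,\theta)$. Let $\mathscr L$ be a line bundle over $M$ with an isomorphism $\mathscr L\otimes\mathscr L\cong\wedge^nA^*\otimes\wedge^mT^*M$ (where $\wedge^mT^*M$ is complexified if $\mathbb K=\mathbb C$), and put $\mathscr L'=\wedge^nA\otimes\mathscr L$, so that $\mathscr L'\otimes\mathscr L'\cong\wedge^nA\otimes\wedge^mT^*M$.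 The natural map $\Phi:\Gamma(\wedge^kA\otimes\mathscr L)\to\Gamma(\wedge^{n-k}A^*\otimes\mathscr L')$, $\Phi(u)(X_1,\dots,X_{n-k})=X_1\wedge\cdots\wedge X_{n-k}\wedge u$, is an isomorphism. There is exactly one action of $A^*$ on $\mathscr L$ that induces on $\mathscr L\otimes\mathscr L$ the canonical action $\xi\cdot(s\otimes\mu)=[\xi,s]_\Lambda\otimes\mu+s\otimes\mathcal L_{a_*(\xi)}\mu$ of $A^*$ on $\wedge^nA^*\otimes\wedge^mT^*M$, and exactly one action of $A$ on $\mathscr L'$ that induces on $\mathscr L'\otimes\mathscr L'$ the canonical action $X\cdot(V\otimes\mu)=[X,V]\otimes\mu+V\otimes\mathcal L_{a(X)}\mu$ of $A$ on $\wedge^nA\otimes\wedge^mT^*M$. Let $\breve d_*:\Gamma(\wedge^kA\otimes\mathscr L)\to\Gamma(\wedge^{k+1}A\otimes\mathscr L)$ be the Chevalley--Eilenberg differential of $A^*$ with coefficients in $\mathscr L$, let $\breve d$ be the Chevalley--Eilenberg differential of $A$ with coefficients in $\mathscr L'$, and let $\breve\partial:\Gamma(\wedge^kA\otimes\mathscr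 L)\to\Gamma(\wedge^{k-1}A\otimes\mathscr L)$ be the operator with $$\Phi(\breve\partial u)=(-1)^{n-k}\,\breve d\,\Phi(u),\qquad u\in\Gamma(\wedge^kA\otimes\mathscr L).$$ Then the operator $\eth=\breve d_*+\breve\partial$ on $\Gamma(\wedge A\otimes\mathscr L)$ satisfies $\eth^2=0$. -/

import Mathlib

open scoped Manifold ContDiff TensorProduct

noncomputable section
namespace DiracGen

section Algebra
variable {R : Type*} [CommRing R] [Algebra ℝ R]

/-- An additive operator `δ` on an `R`-module `N` with `δ (f • x) = D f • x + f • δ x`, i.e. a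
derivation of the module `N` over the derivation `D` of `R`. -/
structure DerivOp (D : Derivation ℝ R R) (N : Type*) [AddCommGroup N] [Module R N] where
  toFun : N →+ N
  leibniz : ∀ (f : R) (x : N), toFun (f • x) = D f • x + f • toFun x

namespace DerivOp
variable {D : Derivation ℝ R R} {V N : Type*} [AddCommGroup V] [Module R V]
  [AddCommGroup N] [Module R N]

instance : CoeFun (DerivOp D N) (fun _ => N → N) := ⟨fun δ => δ.toFun⟩

/-- The derivation `D` itself, as an operator on `R`. -/
def fn (D : Derivation ℝ R R) : DerivOp D R where
  toFun := D.toLinearMap.toAddMonoidHom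
  leibniz f x := by simp [mul_comm, add_comm]

/-- The induced operator on `Hom(V, N)`: `(δφ)(v) = τ(φ v) - φ(δ v)`. -/
def hom (δ : DerivOp D V) (τ : DerivOp D N) : DerivOp D (V →ₗ[R] N) where
  toFun := AddMonoidHom.mk' (fun φ =>
    { toFun := fun v => τ (φ v) - φ (δ v)
      map_add' := fun v w => by simp only [map_add]; abel
      map_smul' := fun f v => by
        simp only [map_smul, leibniz, map_add, RingHom.id_apply, smul_sub]; abel })
    (fun φ ψ => by
      ext v
      simp only [LinearMap.add_apply, map_add, LinearMap.coe_mk, AddHom.coe_mk]; abel)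
  leibniz f φ := by
    ext v
    simp only [AddMonoidHom.mk'_apply, LinearMap.add_apply, LinearMap.smul_apply,
      LinearMap.coe_mk, AddHom.coe_mk, leibniz, smul_sub]
    abel

theorem alt_aux_add (δ : DerivOp D V) {k : ℕ} (θ : V [⋀^Fin k]→ₗ[R] N) (v : Fin k → V)
    (i : Fin k) (x y : V) :
    ∑ l, θ (Function.update (Function.update v i (x + y)) l
        (δ (Function.update v i (x + y) l))) =
      ∑ l, θ (Function.update (Function.update v i x) l (δ (Function.update v i x l))) +
      ∑ l, θ (Function.update (Function.update v i y) l (δ (Function.update v i y l))) := by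
  rw [← Finset.sum_add_distrib]
  refine Finset.sum_congr rfl fun l _ => ?_
  by_cases h : l = i
  · subst h; simp
  · simp only [Function.update_of_ne h, Function.update_comm (Ne.symm h)]
    simp

theorem alt_aux_smul (δ : DerivOp D V) {k : ℕ} (θ : V [⋀^Fin k]→ₗ[R] N) (v : Fin k → V)
    (i : Fin k) (f : R) (x : V) :
    ∑ l, θ (Function.update (Function.update v i (f • x)) l
        (δ (Function.update v i (f • x) l))) =
      D f • θ (Function.update v i x) +
      f • ∑ l, θ (Function.update (Function.update v i x) l (δ (Function.update v i x l))) := by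
  have h : ∀ l, θ (Function.update (Function.update v i (f • x)) l
        (δ (Function.update v i (f • x) l))) =
      (if l = i then D f • θ (Function.update v i x) else 0) +
      f • θ (Function.update (Function.update v i x) l (δ (Function.update v i x l))) := by
    intro l
    by_cases h : l = i
    · subst h; simp [leibniz]
    · simp only [Function.update_of_ne h, Function.update_comm (Ne.symm h), if_neg h, zero_add]
      simp
  simp only [h, Finset.sum_add_distrib, Finset.smul_sum]
  simp

theorem alt_aux_eq (δ : DerivOp D V) {k : ℕ} (θ : V [⋀^Fin k]→ₗ[R] N) (v : Fin k → V)
    (i j : Fin k) (hv : v i = v j) (hij : i ≠ j) :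
    ∑ l, θ (Function.update v l (δ (v l))) = 0 := by
  rw [Fintype.sum_eq_add i j hij]
  · have : Function.update v j (δ (v j)) = Function.update v i (δ (v i)) ∘ Equiv.swap i j := by
      ext l
      by_cases h1 : l = i
      · subst h1; simp [hij, hij.symm, hv]
      by_cases h2 : l = j
      · subst h2; simp [hv]
      · simp [Equiv.swap_apply_of_ne_of_ne h1 h2, h1, h2]
    rw [this, AlternatingMap.map_swap _ _ hij, add_neg_cancel]
  · rintro l ⟨h1, h2⟩
    exact θ.map_eq_zero_of_eq _ (by simpa [h1.symm, h2.symm] using hv) hij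

/-- The induced operator on alternating `k`-forms:
`(δθ)(v₁,…,v_k) = τ(θ(v₁,…,v_k)) - ∑ θ(v₁,…,δ v_l,…,v_k)`. -/
def alt (δ : DerivOp D V) (τ : DerivOp D N) (k : ℕ) : DerivOp D (V [⋀^Fin k]→ₗ[R] N) where
  toFun := AddMonoidHom.mk' (fun θ =>
    { toFun := fun v => τ (θ v) - ∑ l, θ (Function.update v l (δ (v l)))
      map_update_add' := fun {inst} v i x y => by
        rw [Subsingleton.elim inst (instDecidableEqFin k), alt_aux_add, θ.map_update_add, map_add]
        abel
      map_update_smul' := fun {inst} v i f x => by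
        rw [Subsingleton.elim inst (instDecidableEqFin k), alt_aux_smul, θ.map_update_smul,
          leibniz, smul_sub]
        abel
      map_eq_zero_of_eq' := fun v i j hv hij => by
        rw [alt_aux_eq δ θ v i j hv hij, θ.map_eq_zero_of_eq v hv hij, map_zero, sub_zero] })
    (fun θ η => by
      ext v
      simp only [AlternatingMap.add_apply, map_add, AlternatingMap.coe_mk, MultilinearMap.coe_mk,
        Finset.sum_add_distrib]
      abel)
  leibniz f θ := by
    ext v
    simp only [AddMonoidHom.mk'_apply, AlternatingMap.add_apply, AlternatingMap.smul_apply,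
      AlternatingMap.coe_mk, MultilinearMap.coe_mk, leibniz, smul_sub, Finset.smul_sum]
    abel

@[simp] theorem alt_apply (δ : DerivOp D V) (τ : DerivOp D N) {k : ℕ} (θ : V [⋀^Fin k]→ₗ[R] N)
    (v : Fin k → V) :
    δ.alt τ k θ v = τ (θ v) - ∑ l, θ (Function.update v l (δ (v l))) := rfl

end DerivOp

theorem update_vecCons_succ {Γ : Type*} {k : ℕ} (x : Γ) (Y : Fin k → Γ) (l : Fin k) (z : Γ) :
    Function.update (Matrix.vecCons x Y) l.succ z = Matrix.vecCons x (Function.update Y l z) := by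
  funext j
  refine Fin.cases ?_ (fun j => ?_) j
  · rw [Function.update_of_ne (Fin.succ_ne_zero l).symm]; rfl
  · by_cases h : j = l
    · subst h; simp
    · simp [Function.update_of_ne, h]

variable (R) in
/-- An anchor and a skew-symmetric bracket that satisfy the Leibniz rule. The algebra `R` is the
algebra of smooth functions and `Γ` the module of sections; derivations of `R` are vector fields.
The bracket is assumed additive; `ℝ`-bilinearity follows from the Leibniz rule. The Jacobi identity
is not required here, so that differentials can be written down before it is established. -/
structure SkewAlgebroid (Γ : Type*) [AddCommGroup Γ] [Module R Γ] where
  anchor : Γ →ₗ[R] Derivation ℝ R R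
  bracket : Γ →+ Γ →+ Γ
  bracket_self : ∀ X, bracket X X = 0
  bracket_smul : ∀ (X Y : Γ) (f : R), bracket X (f • Y) = anchor X f • Y + f • bracket X Y

variable (R) in
/-- A Lie algebroid: the bracket satisfies the Jacobi identity and the anchor is a morphism. -/
structure LieAlgebroid (Γ : Type*) [AddCommGroup Γ] [Module R Γ]
    extends SkewAlgebroid R Γ where
  jacobi : ∀ X Y Z, bracket X (bracket Y Z) = bracket (bracket X Y) Z + bracket Y (bracket X Z)
  anchor_bracket : ∀ X Y, anchor (bracket X Y) = ⁅anchor X, anchor Y⁆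

variable (R) in
/-- The tangent Lie algebroid: derivations of `R` with their commutator bracket. -/
def tangent : LieAlgebroid R (Derivation ℝ R R) where
  anchor := LinearMap.id
  bracket := AddMonoidHom.mk' (fun X => AddMonoidHom.mk' (fun Y => ⁅X, Y⁆) (lie_add X))
    (fun X Y => by ext1 Z; exact add_lie X Y Z)
  bracket_self X := lie_self X
  bracket_smul X Y f := by
    ext g
    simp [Derivation.commutator_apply]
    ring
  jacobi X Y Z := leibniz_lie X Y Z
  anchor_bracket _ _ := rfl

namespace SkewAlgebroid
variable {Γ : Type*} [AddCommGroup Γ] [Module R Γ] {N : Type*} [AddCommGroup N] [Module R N]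

/-- The operator `Y ↦ [X, Y]`. -/
def ad (S : SkewAlgebroid R Γ) (X : Γ) : DerivOp (S.anchor X) Γ where
  toFun := S.bracket X
  leibniz f Y := S.bracket_smul X Y f

/-- The Lie derivative on dual sections: `(L_X ξ)(Y) = a(X)(ξ(Y)) - ξ([X, Y])`. -/
def adDual (S : SkewAlgebroid R Γ) (X : Γ) : DerivOp (S.anchor X) (Module.Dual R Γ) :=
  (S.ad X).hom (DerivOp.fn _)

theorem bracket_skew (S : SkewAlgebroid R Γ) (X Y : Γ) : S.bracket X Y = - S.bracket Y X := by
  have h := S.bracket_self (X + Y)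
  simp only [map_add, AddMonoidHom.add_apply, S.bracket_self, zero_add, add_zero] at h
  exact eq_neg_of_add_eq_zero_right h

theorem bracket_smul_left (S : SkewAlgebroid R Γ) (X Y : Γ) (f : R) :
    S.bracket (f • X) Y = f • S.bracket X Y - S.anchor Y f • X := by
  rw [S.bracket_skew, S.bracket_smul, S.bracket_skew X Y, smul_neg]; abel

/-- The differential of a function: `(d f)(X) = a(X) f`. -/
def d₀ (S : SkewAlgebroid R Γ) (f : R) : Module.Dual R Γ where
  toFun X := S.anchor X f
  map_add' := by simp
  map_smul' := by simp

/-- An action (without the flatness condition) of `S` on the module `N`: an operator `act X` for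
each section `X`, with `act X (f • n) = (a(X) f) • n + f • act X n` and `act (f • X) = f • act X`. -/
@[ext]
structure Connection (S : SkewAlgebroid R Γ) (N : Type*) [AddCommGroup N] [Module R N] where
  act : (X : Γ) → DerivOp (S.anchor X) N
  add_left : ∀ X Y n, act (X + Y) n = act X n + act Y n
  smul_left : ∀ (f : R) X n, act (f • X) n = f • act X n

/-- The Chevalley--Eilenberg formula with coefficients in `N`:
`∑ᵢ (-1)ⁱ Xᵢ·θ(X₀,…,X̂ᵢ,…,X_k) + ∑_{i<j} (-1)^{i+j} θ([Xᵢ,Xⱼ],X₀,…,X̂ᵢ,…,X̂ⱼ,…,X_k)`. Here the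
bracket `[Xᵢ,Xⱼ]` is left in the place of `Xⱼ`; moving it to the front gives the usual sign.
The place `l` of the list without `Xᵢ` holds the section number `l + 1` exactly if `i ≤ l`. -/
def ceFun (S : SkewAlgebroid R Γ) (E : S.Connection N) {k : ℕ} (θ : Γ [⋀^Fin k]→ₗ[R] N)
    (X : Fin (k + 1) → Γ) : N :=
  ∑ i : Fin (k + 1), (-1 : ℤ) ^ (i : ℕ) • (E.act (X i) (θ (i.removeNth X)) -
    ∑ l : Fin k, if i ≤ l.castSucc then
      θ (Function.update (i.removeNth X) l (S.bracket (X i) (X l.succ))) else 0)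

theorem ceFun_succ (S : SkewAlgebroid R Γ) (E : S.Connection N) {k : ℕ}
    (θ : Γ [⋀^Fin (k + 1)]→ₗ[R] N) (x : Γ) (X : Fin (k + 1) → Γ) :
    S.ceFun E θ (Matrix.vecCons x X) = ((S.ad x).alt (E.act x) (k + 1) θ) X -
      S.ceFun E (θ.curryLeft x) X := by
  have key : ∀ (i : Fin (k + 1)),
      i.succ.removeNth (Matrix.vecCons x X : Fin (k + 2) → Γ) =
        Matrix.vecCons x (i.removeNth X) := by
    intro i; ext l
    refine Fin.cases ?_ (fun l => ?_) l
    · simp [Fin.removeNth]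
    · simp [Fin.removeNth]
  have key0 : (0 : Fin (k + 2)).removeNth (Matrix.vecCons x X : Fin (k + 2) → Γ) = X := by
    ext l; simp [Fin.removeNth]
  rw [ceFun, Fin.sum_univ_succ]
  refine (congrArg₂ (· + ·) ?_ ?_).trans (sub_eq_add_neg _ _).symm
  · simp [ad, key0]
  · rw [ceFun, ← Finset.sum_neg_distrib]
    refine Finset.sum_congr rfl fun i _ => ?_
    rw [key, Fin.val_succ, pow_succ, mul_neg_one, neg_smul, Fin.sum_univ_succ]
    congr 3
    simp only [Matrix.cons_val_succ]
    rw [if_neg (by simp), zero_add]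
    refine Finset.sum_congr rfl fun l _ => ?_
    have : (i.succ ≤ l.succ.castSucc) ↔ i ≤ l.castSucc := by simp
    simp only [this, AlternatingMap.curryLeft_apply_apply, update_vecCons_succ]

theorem ceFun_add (S : SkewAlgebroid R Γ) (E : S.Connection N) {k : ℕ}
    (θ η : Γ [⋀^Fin k]→ₗ[R] N) (X : Fin (k + 1) → Γ) :
    S.ceFun E (θ + η) X = S.ceFun E θ X + S.ceFun E η X := by
  simp only [ceFun, ← Finset.sum_add_distrib, ← smul_add]
  refine Finset.sum_congr rfl fun i _ => ?_
  congr 1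
  have h : ∀ (p : Prop) [Decidable p] (u v : N), (if p then u + v else 0) =
      (if p then u else 0) + (if p then v else 0) := by
    intro p _ u v; split_ifs <;> simp
  simp only [AlternatingMap.add_apply, map_add, h, Finset.sum_add_distrib]
  abel

theorem alt_ad_self (S : SkewAlgebroid R Γ) (E : S.Connection N) : ∀ {k : ℕ}
    (θ : Γ [⋀^Fin (k + 1)]→ₗ[R] N) (x : Γ) (Y : Fin k → Γ),
    (S.ad x).alt (E.act x) (k + 1) θ (Matrix.vecCons x Y) =
      S.ceFun E (θ.curryLeft x) (Matrix.vecCons x Y)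
  | 0, θ, x, Y => by
    have h1 : θ (Function.update (Matrix.vecCons x Y) 0 ((S.ad x) (Matrix.vecCons x Y 0))) = 0 :=
      θ.map_coord_zero 0 (by simp [ad, S.bracket_self])
    rw [DerivOp.alt_apply, Fin.sum_univ_succ, h1, ceFun, Fin.sum_univ_succ]
    have h2 : (0 : Fin (0 + 1)).removeNth (Matrix.vecCons x Y : Fin (0 + 1) → Γ) = Y :=
      Subsingleton.elim _ _
    rw [h2]
    simp
  | k + 1, θ, x, Y => by
    have h0 : S.ceFun E (0 : Γ [⋀^Fin k]→ₗ[R] N) Y = 0 := by simp [ceFun]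
    rw [ceFun_succ, AlternatingMap.curryLeft_same, h0, sub_zero]
    simp only [DerivOp.alt_apply, AlternatingMap.curryLeft_apply_apply]
    rw [Fin.sum_univ_succ]
    have h1 : θ (Function.update (Matrix.vecCons x Y) 0 ((S.ad x) (Matrix.vecCons x Y 0))) = 0 :=
      θ.map_coord_zero 0 (by simp [ad, S.bracket_self])
    rw [h1, zero_add]
    congr 1
    refine Finset.sum_congr rfl fun l _ => ?_
    rw [update_vecCons_succ, Matrix.cons_val_succ]

theorem exists_ce (S : SkewAlgebroid R Γ) (E : S.Connection N) : ∀ {k : ℕ}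
    (θ : Γ [⋀^Fin k]→ₗ[R] N), ∃ η : Γ [⋀^Fin (k + 1)]→ₗ[R] N, ∀ X, η X = S.ceFun E θ X
  | 0, θ => by
    refine ⟨AlternatingMap.ofSubsingleton R Γ N (0 : Fin 1)
      { toFun := fun x => E.act x (θ ![])
        map_add' := fun x y => E.add_left x y _
        map_smul' := fun f x => E.smul_left f x _ }, fun X => ?_⟩
    simp [ceFun]
    congr 2
    exact Subsingleton.elim _ _
  | k + 1, θ => by
    choose d hd using fun x => exists_ce S E (θ.curryLeft x)
    set T : Γ → Γ [⋀^Fin (k + 1)]→ₗ[R] N := fun x => (S.ad x).alt (E.act x) (k + 1) θ - d x with hT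
    have T_apply : ∀ x X, T x X = S.ceFun E θ (Matrix.vecCons x X) := by
      intro x X
      rw [ceFun_succ, hT, AlternatingMap.sub_apply, hd]
    have T_add : ∀ x y, T (x + y) = T x + T y := by
      intro x y
      ext X
      simp only [hT, AlternatingMap.sub_apply, AlternatingMap.add_apply, hd, map_add, ceFun_add]
      simp only [DerivOp.alt_apply, E.add_left, ad, map_add, AddMonoidHom.add_apply,
        AlternatingMap.map_update_add, Finset.sum_add_distrib]
      abel
    have T_self : ∀ x (Y : Fin k → Γ), T x (Matrix.vecCons x Y) = 0 := by
      intro x Y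
      simp only [hT, AlternatingMap.sub_apply, hd, alt_ad_self, sub_self]
    have T_swap : ∀ x y (Y : Fin k → Γ), T x (Matrix.vecCons y Y) = - T y (Matrix.vecCons x Y) := by
      intro x y Y
      have h := T_self (x + y) Y
      rw [T_add, AlternatingMap.add_apply, AlternatingMap.map_vecCons_add,
        AlternatingMap.map_vecCons_add, T_self, T_self, zero_add, add_zero] at h
      exact eq_neg_of_add_eq_zero_left h
    have cons_eta : ∀ X : Fin (k + 1) → Γ, X = Matrix.vecCons (X 0) (Fin.tail X) :=
      fun X => (Fin.cons_self_tail X).symm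
    have T_smul : ∀ (f : R) x, T (f • x) = f • T x := by
      intro f x
      ext X
      rw [cons_eta X, AlternatingMap.smul_apply, T_swap, AlternatingMap.map_vecCons_smul,
        T_swap x, smul_neg]
    let T' : Γ →ₗ[R] Γ [⋀^Fin (k + 1)]→ₗ[R] N :=
      { toFun := T, map_add' := T_add, map_smul' := T_smul }
    let m : MultilinearMap R (fun _ : Fin (k + 2) => Γ) N :=
      LinearMap.uncurryLeft (M := fun _ : Fin (k + 2) => Γ) (AlternatingMap.toMultilinearMapLM (S := R) ∘ₗ T')
    have m_apply : ∀ X, m X = T (X 0) (Fin.tail X) := fun X => rfl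
    have T_tail : ∀ x (X : Fin (k + 1) → Γ) j, X j = x → T x X = 0 := by
      intro x X j hj
      by_cases h : j = 0
      · subst h
        rw [cons_eta X, hj, T_self]
      · have := (T x).map_swap X (i := 0) (j := j) (Ne.symm h)
        rw [cons_eta (X ∘ _)] at this
        simp only [Function.comp_apply, Equiv.swap_apply_left, hj, T_self] at this
        exact neg_eq_zero.mp this.symm
    refine ⟨{ m with map_eq_zero_of_eq' := fun X i j hX hij => ?_ }, fun X => ?_⟩
    · change m X = 0
      rw [m_apply]
      revert hX hij
      refine Fin.cases ?_ (fun i => ?_) i <;> refine Fin.cases ?_ (fun j => ?_) j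
      · intro _ h; exact absurd rfl h
      · intro h _; exact T_tail _ _ j h.symm
      · intro h _; exact T_tail _ _ i h
      · intro h hij
        exact (T (X 0)).map_eq_zero_of_eq _ h (fun e => hij (by rw [e]))
    · change m X = _
      rw [m_apply, T_apply]
      congr 1
      exact Fin.cons_self_tail X

/-- The Chevalley--Eilenberg differential as a map from `k`-forms to `(k + 1)`-forms. -/
def ce (S : SkewAlgebroid R Γ) (E : S.Connection N) {k : ℕ} (θ : Γ [⋀^Fin k]→ₗ[R] N) :
    Γ [⋀^Fin (k + 1)]→ₗ[R] N where
  toFun := S.ceFun E θ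
  map_update_add' X i x y := by
    obtain ⟨η, h⟩ := S.exists_ce E θ
    simp only [← h]; exact η.toMultilinearMap.map_update_add' X i x y
  map_update_smul' X i f x := by
    obtain ⟨η, h⟩ := S.exists_ce E θ
    simp only [← h]; exact η.toMultilinearMap.map_update_smul' X i f x
  map_eq_zero_of_eq' X i j hX hij := by
    obtain ⟨η, h⟩ := S.exists_ce E θ
    rw [← h]; exact η.map_eq_zero_of_eq X hX hij

end SkewAlgebroid

end Algebra

section Total
variable (R : Type*) [CommRing R]

/-- Inhomogeneous alternating forms on `V` with values in `N`. With `V = Γ(A)` these are the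
sections of `∧A* ⊗ L` for `N = Γ(L)`; with `V = Γ(A*)` those of `∧A ⊗ L`. For a bundle of finite
rank the components above the rank vanish, so the product over `k` is the direct sum. -/
abbrev Forms (V N : Type*) [AddCommGroup V] [Module R V] [AddCommGroup N] [Module R N] :=
  ∀ k : ℕ, V [⋀^Fin k]→ₗ[R] N

variable {R}
variable {Γ : Type*} [AddCommGroup Γ] [Module R Γ] {N : Type*} [AddCommGroup N] [Module R N]

/-- Exterior multiplication `a ↦ X ∧ a` from degree `k` to degree `k + 1`, where a section of
`∧ᵏA ⊗ L` is an alternating form on `Γ(A*)`. -/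
def wedgeAux (X : Γ) {k : ℕ} :
    (Module.Dual R Γ [⋀^Fin k]→ₗ[R] N) →ₗ[R] Module.Dual R Γ [⋀^Fin (k + 1)]→ₗ[R] N :=
  AlternatingMap.alternatizeUncurryFinLM ∘ₗ LinearMap.smulRightₗ (Module.Dual.eval R Γ X)

theorem wedgeAux_apply (X : Γ) {k : ℕ} (a : Module.Dual R Γ [⋀^Fin k]→ₗ[R] N)
    (ξ : Fin (k + 1) → Module.Dual R Γ) :
    wedgeAux X a ξ = ∑ i : Fin (k + 1), (-1 : ℤ) ^ (i : ℕ) • (ξ i X • a (i.removeNth ξ)) := by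
  simp [wedgeAux, AlternatingMap.alternatizeUncurryFin_apply]

theorem wedgeAux_wedgeAux (X : Γ) {k : ℕ} (a : Module.Dual R Γ [⋀^Fin k]→ₗ[R] N) :
    wedgeAux X (wedgeAux X a) = 0 := by
  have h := AlternatingMap.alternatizeUncurryFin_alternatizeUncurryFinLM_comp_of_symmetric
    (f := (Module.Dual.eval R Γ X).smulRight ((Module.Dual.eval R Γ X).smulRight a))
    (fun ξ η => by
      ext v
      simp only [LinearMap.smulRight_apply, LinearMap.smul_apply, AlternatingMap.smul_apply,
        smul_smul, mul_comm])
  rw [← h]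
  simp only [wedgeAux, LinearMap.comp_apply, AlternatingMap.alternatizeUncurryFinLM_apply]
  congr 1
  ext ξ : 1
  simp

/-- Exterior multiplication by `X` on the total space. -/
def wedge : Γ →ₗ[R] Module.End R (Forms R (Module.Dual R Γ) N) where
  toFun X := LinearMap.pi fun k => match k with
    | 0 => 0
    | k + 1 => wedgeAux X ∘ₗ LinearMap.proj k
  map_add' X Y := by
    refine LinearMap.ext fun a => funext fun k => ?_
    cases k with
    | zero => simp
    | succ k =>
      ext ξ
      simp [wedgeAux_apply, add_smul, Finset.sum_add_distrib]
  map_smul' f X := by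
    refine LinearMap.ext fun a => funext fun k => ?_
    cases k with
    | zero => simp
    | succ k =>
      ext ξ
      simp only [LinearMap.pi_apply, LinearMap.comp_apply, LinearMap.proj_apply, wedgeAux_apply,
        RingHom.id_apply, LinearMap.smul_apply, Pi.smul_apply, AlternatingMap.smul_apply,
        Finset.smul_sum, map_smul, smul_eq_mul, mul_smul]
      refine Finset.sum_congr rfl fun i _ => ?_
      rw [smul_comm ((-1 : ℤ) ^ (i : ℕ)) f]

theorem wedge_wedge (X : Γ) :
    (wedge X * wedge X : Module.End R (Forms R (Module.Dual R Γ) N)) = 0 := by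
  refine LinearMap.ext fun a => funext fun k => ?_
  rcases k with _ | _ | k
  · rfl
  · change wedgeAux X 0 = 0
    simp
  · exact wedgeAux_wedgeAux X (a k)

/-- Exterior multiplication by elements of the exterior algebra. -/
def wedgeAction : ExteriorAlgebra R Γ →ₐ[R] Module.End R (Forms R (Module.Dual R Γ) N) :=
  ExteriorAlgebra.lift R ⟨wedge, wedge_wedge⟩

/-- The isomorphism `∧A ⊗ L → ∧A* ⊗ (∧ⁿA ⊗ L)` with `n` the rank of `A`, given by
`(starMap n a)(X₁,…,X_j) = X₁ ∧ … ∧ X_j ∧ a` (the component of degree `n`); it sends `∧ᵏA ⊗ L` to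
`∧ⁿ⁻ᵏA* ⊗ (∧ⁿA ⊗ L)`. -/
def starMap (n : ℕ) (a : Forms R (Module.Dual R Γ) N) :
    Forms R Γ (Module.Dual R Γ [⋀^Fin n]→ₗ[R] N) := fun j =>
  (LinearMap.proj n ∘ₗ LinearMap.applyₗ a ∘ₗ (wedgeAction (N := N)).toLinearMap).compAlternatingMap
    (ExteriorAlgebra.ιMulti R j)

end Total

section Dirac
variable {R : Type*} [CommRing R] [Algebra ℝ R]
variable {Γ : Type*} [AddCommGroup Γ] [Module R Γ] {N : Type*} [AddCommGroup N] [Module R N]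

/-- The Chevalley--Eilenberg differential on the total space. -/
def SkewAlgebroid.d (S : SkewAlgebroid R Γ) (E : S.Connection N) (θ : Forms R Γ N) : Forms R Γ N
  | 0 => 0
  | k + 1 => S.ce E (θ k)

/-- The Chevalley--Eilenberg differential multiplied by `(-1)ʲ` on forms of degree `j`. -/
def SkewAlgebroid.dSigned (S : SkewAlgebroid R Γ) (E : S.Connection N) (θ : Forms R Γ N) :
    Forms R Γ N
  | 0 => 0
  | k + 1 => (-1 : ℤ) ^ k • S.ce E (θ k)

variable (R Γ) in
/-- A section `Λ` of `∧²A`, given by the skew-symmetric map `Λ♯ : Γ(A*) → Γ(A)`. -/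
structure Bivector where
  sharp : Module.Dual R Γ →ₗ[R] Γ
  sharp_self : ∀ ξ : Module.Dual R Γ, ξ (sharp ξ) = 0

/-- The value `Λ(ξ, θ) = ⟨θ, Λ♯ ξ⟩`. -/
def Bivector.toFun (Λ : Bivector R Γ) (ξ θ : Module.Dual R Γ) : R := θ (Λ.sharp ξ)

theorem Bivector.toFun_skew (Λ : Bivector R Γ) (ξ θ : Module.Dual R Γ) :
    Λ.toFun ξ θ = - Λ.toFun θ ξ := by
  have h := Λ.sharp_self (ξ + θ)
  simp only [map_add, LinearMap.add_apply, Λ.sharp_self, zero_add, add_zero] at h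
  exact eq_neg_of_add_eq_zero_left h

/-- The decomposable bivector `X ∧ Y`. -/
def Bivector.wedge (X Y : Γ) : Bivector R Γ where
  sharp := (Module.Dual.eval R Γ X).smulRight Y - (Module.Dual.eval R Γ Y).smulRight X
  sharp_self ξ := by simp [mul_comm]

/-- The bracket `[ξ, θ] = L_{Λ♯ξ} θ - L_{Λ♯θ} ξ - d(Λ(ξ, θ))` of dual sections. -/
def Bivector.bracketAux (S : SkewAlgebroid R Γ) (Λ : Bivector R Γ) (ξ θ : Module.Dual R Γ) :
    Module.Dual R Γ :=
  S.adDual (Λ.sharp ξ) θ - S.adDual (Λ.sharp θ) ξ - S.d₀ (Λ.toFun ξ θ)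

theorem adDual_apply (S : SkewAlgebroid R Γ) (X Y : Γ) (ξ : Module.Dual R Γ) :
    S.adDual X ξ Y = S.anchor X (ξ Y) - ξ (S.bracket X Y) := rfl

theorem Bivector.bracketAux_apply (S : SkewAlgebroid R Γ) (Λ : Bivector R Γ)
    (ξ θ : Module.Dual R Γ) (Y : Γ) :
    Λ.bracketAux S ξ θ Y = (S.anchor (Λ.sharp ξ) (θ Y) - θ (S.bracket (Λ.sharp ξ) Y)) -
      (S.anchor (Λ.sharp θ) (ξ Y) - ξ (S.bracket (Λ.sharp θ) Y)) -
      S.anchor Y (θ (Λ.sharp ξ)) := rfl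

/-- The structure on `A*` induced by `Λ`: the above bracket, with anchor `a ∘ Λ♯`. -/
def SkewAlgebroid.dualOf (S : SkewAlgebroid R Γ) (Λ : Bivector R Γ) :
    SkewAlgebroid R (Module.Dual R Γ) where
  anchor := S.anchor ∘ₗ Λ.sharp
  bracket := AddMonoidHom.mk' (fun ξ => AddMonoidHom.mk' (Λ.bracketAux S ξ)
      (fun θ η => by
        ext Y
        simp only [LinearMap.add_apply, Bivector.bracketAux_apply, map_add, AddMonoidHom.add_apply,
          Derivation.add_apply]
        ring))
    (fun θ η => by
      ext ξ Y
      simp only [LinearMap.add_apply, Bivector.bracketAux_apply, map_add, AddMonoidHom.add_apply,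
          Derivation.add_apply, AddMonoidHom.mk'_apply]
      ring)
  bracket_self ξ := by
    ext Y
    simp [Bivector.bracketAux_apply, Λ.sharp_self]
  bracket_smul ξ θ f := by
    have h := Λ.toFun_skew ξ θ
    ext Y
    simp only [Bivector.toFun] at h
    simp only [LinearMap.add_apply, Bivector.bracketAux_apply, map_smul, AddMonoidHom.mk'_apply,
      LinearMap.smul_apply, smul_eq_mul, Derivation.leibniz, Derivation.smul_apply,
      S.bracket_smul_left, map_sub, LinearMap.comp_apply, h]
    simp only [map_neg]
    ring

/-- The Schouten bracket of two bivectors as a trilinear form on dual sections: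
`[P, Q](α, β, γ) = ∑_cyc ⟨L_{P♯α} β, Q♯γ⟩ + ⟨L_{Q♯α} β, P♯γ⟩`. The next fact shows that this is the
biderivation extending the bracket of sections. -/
def schouten (S : SkewAlgebroid R Γ) (P Q : Bivector R Γ) (α β γ : Module.Dual R Γ) : R :=
  (S.adDual (P.sharp α) β (Q.sharp γ) + S.adDual (Q.sharp α) β (P.sharp γ))
  + (S.adDual (P.sharp β) γ (Q.sharp α) + S.adDual (Q.sharp β) γ (P.sharp α))
  + (S.adDual (P.sharp γ) α (Q.sharp β) + S.adDual (Q.sharp γ) α (P.sharp β))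

/-- On decomposable bivectors, `[X₁∧X₂, Y₁∧Y₂] = ∑ (-1)^{i+j} [Xᵢ,Yⱼ] ∧ X_{i'} ∧ Y_{j'}`,
with `i'` and `j'` the complementary indices. -/
theorem schouten_wedge (S : SkewAlgebroid R Γ) (X₁ X₂ Y₁ Y₂ : Γ) (α β γ : Module.Dual R Γ) :
    let w (X Y Z : Γ) : R := Matrix.det !![α X, α Y, α Z; β X, β Y, β Z; γ X, γ Y, γ Z]
    schouten S (.wedge X₁ X₂) (.wedge Y₁ Y₂) α β γ =
    w (S.bracket X₁ Y₁) X₂ Y₂ - w (S.bracket X₁ Y₂) X₂ Y₁ - w (S.bracket X₂ Y₁) X₁ Y₂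
      + w (S.bracket X₂ Y₂) X₁ Y₁ := by
  intro w
  have e1 := S.bracket_skew Y₁ X₁
  have e2 := S.bracket_skew Y₁ X₂
  have e3 := S.bracket_skew Y₂ X₁
  have e4 := S.bracket_skew Y₂ X₂
  simp only [w, Matrix.det_fin_three, schouten, Bivector.wedge, adDual_apply,
    LinearMap.sub_apply, LinearMap.smulRight_apply, Module.Dual.eval_apply, map_sub, map_smul,
    S.bracket_smul_left, smul_eq_mul, Derivation.sub_apply, Derivation.smul_apply,
    AddMonoidHom.sub_apply, e1, e2, e3, e4, map_neg,
    Matrix.of_apply, Matrix.cons_val]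
  ring

/-- The Schouten bracket `[T, X] = -L_X T` of a trivector with a section. -/
def bracketSection (S : SkewAlgebroid R Γ)
    (T : Module.Dual R Γ → Module.Dual R Γ → Module.Dual R Γ → R) (X : Γ)
    (α β γ : Module.Dual R Γ) : R :=
  T (S.adDual X α) β γ + T α (S.adDual X β) γ + T α β (S.adDual X γ) - S.anchor X (T α β γ)

variable (R Γ) in
/-- Sections of `∧ⁿA`. -/
abbrev TopMultivector (n : ℕ) := Module.Dual R Γ [⋀^Fin n]→ₗ[R] R

variable (R) in
/-- Differential forms of degree `m` on the base, with values in the scalars. -/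
abbrev TopForm (m : ℕ) := Derivation ℝ R R [⋀^Fin m]→ₗ[R] R

/-- The Lie derivative of differential forms. -/
def lieTopForm (m : ℕ) (D : Derivation ℝ R R) : DerivOp D (TopForm R m) :=
  DerivOp.alt ((tangent R).ad D) (DerivOp.fn D) m

variable (R Γ) in
/-- Sections of `∧ⁿA* ⊗ ∧ᵐT*M = Hom(∧ⁿA, ∧ᵐT*M)`. -/
abbrev CanonicalLine (n m : ℕ) := TopMultivector R Γ n →ₗ[R] TopForm R m

/-- The canonical action of `A*` on `∧ⁿA* ⊗ ∧ᵐT*M`: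
`ξ·(s ⊗ μ) = L_ξ s ⊗ μ + s ⊗ L_{a_*(ξ)} μ`. -/
def lieCanonicalLine (S : SkewAlgebroid R (Module.Dual R Γ)) (n m : ℕ) (ξ : Module.Dual R Γ) :
    DerivOp (S.anchor ξ) (CanonicalLine R Γ n m) :=
  ((S.ad ξ).alt (DerivOp.fn _) n).hom (lieTopForm m (S.anchor ξ))

/-- The canonical action of `A` on `∧ⁿA ⊗ ∧ᵐT*M`. -/
def lieDualLine (S : SkewAlgebroid R Γ) (n m : ℕ) (X : Γ) :
    DerivOp (S.anchor X) (Module.Dual R Γ [⋀^Fin n]→ₗ[R] TopForm R m) :=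
  (S.adDual X).alt (lieTopForm m (S.anchor X)) n

variable {n m : ℕ}

/-- `E` is the action of `A*` on `L` that induces the canonical action on
`L ⊗ L ≅ ∧ⁿA* ⊗ ∧ᵐT*M`. -/
def IsRootAction (S : SkewAlgebroid R (Module.Dual R Γ))
    (q : (N ⊗[R] N) ≃ₗ[R] CanonicalLine R Γ n m) (E : S.Connection N) : Prop :=
  ∀ (ξ : Module.Dual R Γ) (l l' : N),
    q (E.act ξ l ⊗ₜ l') + q (l ⊗ₜ E.act ξ l') = lieCanonicalLine S n m ξ (q (l ⊗ₜ l'))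

/-- The section `P ⊗ l` of `∧ⁿA ⊗ L`. -/
def tensorTop (P : TopMultivector R Γ n) (l : N) : Module.Dual R Γ [⋀^Fin n]→ₗ[R] N :=
  (LinearMap.toSpanSingleton R N l).compAlternatingMap P

/-- The isomorphism `(∧ⁿA ⊗ L) ⊗ (∧ⁿA ⊗ L) ≅ ∧ⁿA ⊗ ∧ᵐT*M` coming from `L ⊗ L ≅ ∧ⁿA* ⊗ ∧ᵐT*M`:
`(B, P ⊗ l) ↦ (η ↦ ⟨B(η) ⊗ l, P⟩)`. It makes `∧ⁿA ⊗ L` the square root of `∧ⁿA ⊗ ∧ᵐT*M`. -/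
def dualSquare (q : (N ⊗[R] N) ≃ₗ[R] CanonicalLine R Γ n m)
    (B : Module.Dual R Γ [⋀^Fin n]→ₗ[R] N) (P : TopMultivector R Γ n) (l : N) :
    Module.Dual R Γ [⋀^Fin n]→ₗ[R] TopForm R m :=
  (LinearMap.applyₗ P ∘ₗ q.toLinearMap ∘ₗ (TensorProduct.mk R N N).flip l).compAlternatingMap B

theorem dualSquare_apply (q : (N ⊗[R] N) ≃ₗ[R] CanonicalLine R Γ n m)
    (B : Module.Dual R Γ [⋀^Fin n]→ₗ[R] N) (P : TopMultivector R Γ n) (l : N)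
    (η : Fin n → Module.Dual R Γ) : dualSquare q B P l η = q (B η ⊗ₜ l) P := rfl

/-- `E` is the action of `A` on the square root `∧ⁿA ⊗ L` of `∧ⁿA ⊗ ∧ᵐT*M` that induces the
canonical action.
It suffices to say so on sections of the form `P ⊗ l`, as these span. -/
def IsDualRootAction (S : SkewAlgebroid R Γ)
    (q : (N ⊗[R] N) ≃ₗ[R] CanonicalLine R Γ n m)
    (E : S.Connection (Module.Dual R Γ [⋀^Fin n]→ₗ[R] N)) : Prop :=
  ∀ (X : Γ) (P P' : TopMultivector R Γ n) (l l' : N),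
    dualSquare q (E.act X (tensorTop P l)) P' l' + dualSquare q (E.act X (tensorTop P' l')) P l =
      lieDualLine S n m X (dualSquare q (tensorTop P l) P' l')

/-- The operator `Ð = d_* + ∂` on sections of `∧A ⊗ L`: `d_*` is the differential of `A*` with
coefficients in `L`, and `∂` is the differential of `A` with coefficients in `∧ⁿA ⊗ L`, carried over
by `∧ᵏA ⊗ L ≅ ∧ⁿ⁻ᵏA* ⊗ (∧ⁿA ⊗ L)`, with the sign for which
`∂(w ⊗ l) = (-∂_Ω w + ½ ι_{ξ₀} w) ⊗ l` in a local trivialization. -/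
def dirac (S : SkewAlgebroid R Γ) (S' : SkewAlgebroid R (Module.Dual R Γ))
    (hs : Function.Bijective (starMap (R := R) (Γ := Γ) (N := N) n))
    (E : S.Connection (Module.Dual R Γ [⋀^Fin n]→ₗ[R] N)) (E' : S'.Connection N)
    (a : Forms R (Module.Dual R Γ) N) : Forms R (Module.Dual R Γ) N :=
  S'.d E' a + (Equiv.ofBijective _ hs).symm (S.dSigned E (starMap n a))

end Dirac

section Geometry

variable {𝕂 : Type*} [RCLike 𝕂] {m : ℕ}
  {M : Type*} [TopologicalSpace M] [ChartedSpace (EuclideanSpace ℝ (Fin m)) M]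

/-- The scalars form a smooth ring over `ℝ`. -/
instance : ContMDiffRing 𝓘(ℝ, 𝕂) ∞ 𝕂 where
  contMDiff_add := by
    rw [← modelWithCornersSelf_prod, chartedSpaceSelf_prod]
    exact contDiff_add.contMDiff
  contMDiff_mul := by
    rw [← modelWithCornersSelf_prod, chartedSpaceSelf_prod]
    exact contDiff_mul.contMDiff

variable (𝕂 m M) in
/-- Smooth real or complex functions on the real manifold `M`. -/
abbrev SmoothFunctions := C^∞⟮𝓡 m, M; 𝓘(ℝ, 𝕂), 𝕂⟯

variable {F : Type*} [NormedAddCommGroup F] [NormedSpace ℝ F] [NormedSpace 𝕂 F]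
  [IsScalarTower ℝ 𝕂 F]
  {A : M → Type*} [TopologicalSpace (Bundle.TotalSpace F A)]
  [∀ x, TopologicalSpace (A x)] [∀ x, AddCommGroup (A x)] [∀ x, Module ℝ (A x)]
  [∀ x, Module 𝕂 (A x)] [FiberBundle F A] [VectorBundle ℝ F A] [VectorBundle 𝕂 F A]

theorem contMDiff_smul_section (f : SmoothFunctions 𝕂 m M) (s : Cₛ^∞⟮𝓡 m; F, A⟯) :
    ContMDiff (𝓡 m) ((𝓡 m).prod 𝓘(ℝ, F)) ∞
      (fun x => Bundle.TotalSpace.mk' F x ((f x • s x : A x))) := by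
  intro x₀
  have hs := s.contMDiff x₀
  have hf : ContMDiffAt (𝓡 m) 𝓘(ℝ, 𝕂) ∞ f x₀ := f.contMDiff x₀
  rw [Bundle.contMDiffAt_section] at hs ⊢
  have hsm : ContMDiff (𝓘(ℝ, 𝕂).prod 𝓘(ℝ, F)) 𝓘(ℝ, F) ∞ (fun p : 𝕂 × F => p.1 • p.2) := by
    rw [← modelWithCornersSelf_prod, chartedSpaceSelf_prod]
    exact (contDiff_fst.smul contDiff_snd).contMDiff
  refine (hsm.contMDiffAt.comp x₀ (hf.prodMk hs)).congr_of_eventuallyEq ?_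
  set e := trivializationAt F A x₀
  filter_upwards [e.open_baseSet.mem_nhds (FiberBundle.mem_baseSet_trivializationAt' x₀)] with x hx
  exact (e.linear 𝕂 hx).2 _ _

/-- Smooth sections form a module over the smooth functions, pointwise. -/
instance : Module (SmoothFunctions 𝕂 m M) Cₛ^∞⟮𝓡 m; F, A⟯ where
  smul f s := ⟨fun x => f x • s x, contMDiff_smul_section f s⟩
  one_smul s := by ext x; exact one_smul 𝕂 (s x)
  mul_smul f g s := by ext x; exact mul_smul (f x) (g x) (s x)
  smul_zero f := by ext x; exact smul_zero (f x)
  smul_add f s t := by ext x; exact smul_add (f x) (s x) (t x)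
  add_smul f g s := by ext x; exact add_smul (f x) (g x) (s x)
  zero_smul s := by ext x; exact zero_smul 𝕂 (s x)

theorem smul_section_apply (f : SmoothFunctions 𝕂 m M) (s : Cₛ^∞⟮𝓡 m; F, A⟯) (x : M) :
    (f • s) x = f x • s x := rfl

end Geometry
end DiracGen
end

open DiracGen

set_option linter.unusedSectionVars false
set_option linter.unusedSimpArgs false

/-! The key point is that for an exact Lie bialgebroid `d_*` is the commutator of exterior
multiplication by `Λ` with `∂`: `d_* = Λ∂ - ∂Λ` (`dOp_dualOf`). Once `∂² = 0` and `d_*² = 0` are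
known, the square of `d_* + ∂` is `(Λ∂ - ∂Λ)∂ + ∂(Λ∂ - ∂Λ) = Λ∂² - ∂²Λ = 0` (`dirac_dirac`).

Identities of operators rest on a rigidity principle: an operator on forms that vanishes in degree
zero and commutes or anticommutes with all contractions is zero (`op_eq_zero_of_comm`,
`op_eq_zero_of_anticomm`). Through the star isomorphism the same holds with exterior multiplications
and the top degree (`op_eq_zero_of_wedge_anticomm`). So Cartan formulas suffice. Contraction of `Λ∂
- ∂Λ` with `ξ` produces `L_{Λ♯ξ} + [Λ, ι_{dξ}]`, which has the same commutators with contractions as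
the Lie derivative of `A*` along `ξ`. What remains is degree zero: `ξ` has to act on `L` by the Lie
derivative along `Λ♯ξ` minus `ι_{dξ}Λ` (`rootConnection_dualOf_act`). On `∧ⁿA* ⊗ ∧ᵐT*M` the two
actions differ by the trace of `dξ ∘ Λ♯`; the square root halves it, and `ι_{dξ}Λ` is half of this
trace.

The equations `∂² = 0` and `d_*² = 0` follow from flatness of the two root actions and from the
Jacobi identities on `A` and `A*`. On `A*` this identity needs the invariance of `[Λ,Λ]` and
`ι_{df}[Λ,Λ] = 0`; the latter follows from the former by inserting `fX` and taking a trace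
(`schouten_d₀`).

All this is algebra over a ring of functions. The manifold enters through functions off whose zeros
there are frames of `A`, `L` and the tangent bundle, and through separation and gluing of sections.
-/

noncomputable section
namespace DiracGen

/-! ### Cartan calculus on alternating forms. -/

section Operators
variable {R : Type*} [CommRing R] [Algebra ℝ R]
variable {V N : Type*} [AddCommGroup V] [Module R V] [AddCommGroup N] [Module R N]

/-- Contraction with a vector on the total space of alternating forms. -/
def contract (v : V) : AddMonoid.End (Forms R V N) :=
  AddMonoidHom.mk' (fun a k => (a (k + 1)).curryLeft v) (fun a b => by
    funext k; ext x; simp)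

theorem contract_apply (v : V) (a : Forms R V N) (k : ℕ) :
    contract v a k = (a (k + 1)).curryLeft v := rfl

/-- Multiplication by a scalar on the total space. -/
def scale (f : R) : AddMonoid.End (Forms R V N) := Module.toAddMonoidEnd R _ f

theorem scale_apply (f : R) (a : Forms R V N) : scale f a = f • a := rfl

theorem scale_sub (f g : R) :
    (scale (f - g) : AddMonoid.End (Forms R V N)) = scale f - scale g := map_sub _ _ _

theorem contract_add (v w : V) :
    (contract (v + w) : AddMonoid.End (Forms R V N)) = contract v + contract w := by
  ext a k x; simp [contract_apply]; rfl

theorem contract_sub (v w : V) :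
    (contract (v - w) : AddMonoid.End (Forms R V N)) = contract v - contract w := by
  ext a k x; simp [contract_apply]; rfl

theorem contract_scale (f : R) (v : V) :
    (contract v * scale f : AddMonoid.End (Forms R V N)) = scale f * contract v := by
  ext a k x; simp [contract_apply, scale_apply]

theorem contract_self (v : V) : (contract v * contract v : AddMonoid.End (Forms R V N)) = 0 := by
  ext a k x; simp [contract_apply]

theorem contract_contract (v w : V) :
    (contract v * contract w : AddMonoid.End (Forms R V N)) = - (contract w * contract v) := by
  have h := contract_self (R := R) (N := N) (v + w)
  rw [contract_add, add_mul, mul_add, mul_add, contract_self, contract_self] at h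
  rw [eq_neg_iff_add_eq_zero, ← h]; abel

/-- A family of forms that is stable under contractions up to vanishing and has no component of
degree zero vanishes. -/
theorem eq_zero_of_contract {G : Type*} (T : G → Forms R V N) (h0 : ∀ w, T w 0 = 0)
    (hs : ∀ w v, ∃ w', ∀ k, T w' k = 0 → contract v (T w) k = 0) (w : G) : T w = 0 := by
  funext k
  induction k generalizing w with
  | zero => exact h0 w
  | succ k ih =>
    ext x
    obtain ⟨w', h⟩ := hs w (x 0)
    have := DFunLike.congr_fun (h k (ih w')) (Fin.tail x)
    simp only [contract_apply, AlternatingMap.curryLeft_apply_apply] at this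
    rw [show Matrix.vecCons (x 0) (Fin.tail x) = x from Fin.cons_self_tail x] at this
    exact this

/-- Rigidity: a form of positive degree is determined by its contractions, so an induction on the
degree reduces everything to degree zero. -/
theorem op_eq_zero_of_anticomm (T : AddMonoid.End (Forms R V N)) (h0 : ∀ w, T w 0 = 0)
    (h : ∀ v, contract v * T + T * contract v = 0) : T = 0 := by
  refine AddMonoidHom.ext fun w => eq_zero_of_contract T h0 (fun w v => ⟨contract v w, fun k hk => ?_⟩) w
  have := congrFun (DFunLike.congr_fun (h v) w) k
  change contract v (T w) k + T (contract v w) k = 0 at this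
  rwa [hk, add_zero] at this

theorem op_eq_zero_of_comm (T : AddMonoid.End (Forms R V N)) (h0 : ∀ w, T w 0 = 0)
    (h : ∀ v, contract v * T = T * contract v) : T = 0 := by
  refine AddMonoidHom.ext fun w => eq_zero_of_contract T h0 (fun w v => ⟨contract v w, fun k hk => ?_⟩) w
  have := congrFun (DFunLike.congr_fun (h v) w) k
  exact this.trans hk

namespace DerivOp
variable {D D₁ D₂ : Derivation ℝ R R}

@[ext] theorem ext {δ δ' : DerivOp D N} (h : ∀ x, δ x = δ' x) : δ = δ' := by
  cases δ; cases δ'; congr; exact AddMonoidHom.ext h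

/-- The commutator of two operators. -/
def comm (δ₁ : DerivOp D₁ N) (δ₂ : DerivOp D₂ N) : DerivOp ⁅D₁, D₂⁆ N where
  toFun := δ₁.toFun.comp δ₂.toFun - δ₂.toFun.comp δ₁.toFun
  leibniz f x := by
    simp only [AddMonoidHom.sub_apply, AddMonoidHom.comp_apply, leibniz, map_add,
      Derivation.commutator_apply, sub_smul, smul_sub]
    abel

@[simp] theorem comm_apply (δ₁ : DerivOp D₁ N) (δ₂ : DerivOp D₂ N) (x : N) :
    δ₁.comm δ₂ x = δ₁ (δ₂ x) - δ₂ (δ₁ x) := rfl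

@[simp] theorem hom_apply {W : Type*} [AddCommGroup W] [Module R W] (δ : DerivOp D V)
    (τ : DerivOp D W) (φ : V →ₗ[R] W) (v : V) : δ.hom τ φ v = τ (φ v) - φ (δ v) := rfl

@[simp] theorem fn_apply (D : Derivation ℝ R R) (f : R) : fn D f = D f := rfl

end DerivOp

variable {D D₁ D₂ : Derivation ℝ R R}

/-- The operator `DerivOp.alt` on the total space. -/
def lieOp (δ : DerivOp D V) (τ : DerivOp D N) : AddMonoid.End (Forms R V N) :=
  AddMonoidHom.mk' (fun a k => δ.alt τ k (a k)) (fun a b => by funext k; simp)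

theorem lieOp_apply (δ : DerivOp D V) (τ : DerivOp D N) (a : Forms R V N) (k : ℕ) :
    lieOp δ τ a k = δ.alt τ k (a k) := rfl

/-- The correction is the summand in which `δ` hits the contracted slot. -/
theorem lieOp_contract (δ : DerivOp D V) (τ : DerivOp D N) (v : V) :
    contract v * lieOp δ τ = lieOp δ τ * contract v - contract (δ v) := by
  ext a k x
  change δ.alt τ (k + 1) (a (k + 1)) (Matrix.vecCons v x) =
    δ.alt τ k ((a (k + 1)).curryLeft v) x - (a (k + 1)) (Matrix.vecCons (δ v) x)
  rw [DerivOp.alt_apply, DerivOp.alt_apply, Fin.sum_univ_succ]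
  simp only [update_vecCons_succ, Matrix.cons_val_succ, AlternatingMap.curryLeft_apply_apply,
    Matrix.cons_val_zero]
  rw [show Function.update (Matrix.vecCons v x) 0 (δ v) = Matrix.vecCons (δ v) x from
    Fin.update_cons_zero _ _ _]
  abel

theorem lieOp_zero_apply (δ : DerivOp D V) (τ : DerivOp D N) (a : Forms R V N) (x : Fin 0 → V) :
    lieOp δ τ a 0 x = τ (a 0 x) := by
  rw [lieOp_apply, DerivOp.alt_apply]; simp

theorem lieOp_scale (δ : DerivOp D V) (τ : DerivOp D N) (f : R) :
    lieOp δ τ * scale f = scale f * lieOp δ τ + scale (D f) := by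
  ext a k x
  change δ.alt τ k (f • a k) x = f • δ.alt τ k (a k) x + D f • a k x
  rw [DerivOp.leibniz, add_comm]; rfl

/-- By rigidity: both sides have the same commutators with contractions, and in degree zero only the
operators on `N` act. -/
theorem lieOp_comm (δ₁ : DerivOp D₁ V) (τ₁ : DerivOp D₁ N) (δ₂ : DerivOp D₂ V)
    (τ₂ : DerivOp D₂ N) :
    lieOp δ₁ τ₁ * lieOp δ₂ τ₂ - lieOp δ₂ τ₂ * lieOp δ₁ τ₁ =
      lieOp (δ₁.comm δ₂) (τ₁.comm τ₂) := by
  rw [← sub_eq_zero]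
  refine op_eq_zero_of_comm _ (fun w => ?_) (fun v => ?_)
  · ext x
    change lieOp δ₁ τ₁ (lieOp δ₂ τ₂ w) 0 x - lieOp δ₂ τ₂ (lieOp δ₁ τ₁ w) 0 x -
      lieOp (δ₁.comm δ₂) (τ₁.comm τ₂) w 0 x = 0
    simp [lieOp_zero_apply]
  · have h1 := lieOp_contract (N := N) δ₁ τ₁
    have h2 := lieOp_contract (N := N) δ₂ τ₂
    simp only [mul_sub, sub_mul, ← mul_assoc, h1, h2, lieOp_contract]
    simp only [mul_sub, sub_mul, mul_assoc, h1, h2, DerivOp.comm_apply, contract_sub]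
    abel

end Operators

/-! ### Contraction of an antisymmetrized form. -/

section Exterior
variable {R : Type*} [CommRing R] [Algebra ℝ R]
variable {V N : Type*} [AddCommGroup V] [Module R V] [AddCommGroup N] [Module R N]

/-- The summand `i = 0` gives `f v`. In the other summands `v` stays inside as the first argument
and the index is shifted by one, whence the minus sign. -/
theorem curryLeft_alternatizeUncurryFin {k : ℕ} (f : V →ₗ[R] V [⋀^Fin (k + 1)]→ₗ[R] N) (v : V) :
    (AlternatingMap.alternatizeUncurryFin f).curryLeft v = f v -
      AlternatingMap.alternatizeUncurryFin (AlternatingMap.curryLeftLinearMap.flip v ∘ₗ f) := by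
  ext x
  simp only [AlternatingMap.curryLeft_apply_apply, AlternatingMap.alternatizeUncurryFin_apply,
    AlternatingMap.sub_apply]
  rw [Fin.sum_univ_succ, sub_eq_add_neg, ← Finset.sum_neg_distrib]
  congr 1
  · simp
  · refine Finset.sum_congr rfl fun i _ => ?_
    rw [Fin.val_succ, pow_succ, mul_neg_one, neg_smul]
    congr 2
    simp only [Matrix.cons_val_succ]
    change (f (x i)) _ = (f (x i)) _
    congr 1
    funext l
    refine Fin.cases ?_ (fun l => ?_) l <;> simp [Fin.removeNth]

/-- Separate from the general case because a form of degree zero has no argument left for `v`. -/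
theorem curryLeft_alternatizeUncurryFin_zero (f : V →ₗ[R] V [⋀^Fin 0]→ₗ[R] N) (v : V) :
    (AlternatingMap.alternatizeUncurryFin f).curryLeft v = f v := by
  ext x
  simp only [AlternatingMap.curryLeft_apply_apply, AlternatingMap.alternatizeUncurryFin_apply]
  simp

end Exterior

/-! ### Exterior multiplication by sections and by the bivector. -/

section Wedge
variable {R : Type*} [CommRing R] [Algebra ℝ R]
variable {Γ N : Type*} [AddCommGroup Γ] [Module R Γ] [AddCommGroup N] [Module R N]

/-- Exterior multiplication by a section, as an additive operator. -/
def wedgeOp (X : Γ) : AddMonoid.End (Forms R (Module.Dual R Γ) N) := (wedge X).toAddMonoidHom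

theorem wedgeOp_zero_apply (X : Γ) (a : Forms R (Module.Dual R Γ) N) : wedgeOp X a 0 = 0 := rfl

theorem wedgeOp_succ_apply (X : Γ) (a : Forms R (Module.Dual R Γ) N) (k : ℕ) :
    wedgeOp X a (k + 1) = wedgeAux X (a k) := rfl

theorem wedgeOp_add (X Y : Γ) :
    (wedgeOp (X + Y) : AddMonoid.End (Forms R (Module.Dual R Γ) N)) = wedgeOp X + wedgeOp Y := by
  refine AddMonoidHom.ext fun a => ?_
  change wedge (X + Y) a = wedge X a + wedge Y a
  rw [map_add]; rfl

theorem wedgeOp_smul (f : R) (X : Γ) :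
    (wedgeOp (f • X) : AddMonoid.End (Forms R (Module.Dual R Γ) N)) = scale f * wedgeOp X := by
  refine AddMonoidHom.ext fun a => ?_
  change wedge (f • X) a = f • wedge X a
  rw [map_smul]; rfl

theorem wedgeOp_scale (f : R) (X : Γ) :
    (wedgeOp X * scale f : AddMonoid.End (Forms R (Module.Dual R Γ) N)) = scale f * wedgeOp X :=
  AddMonoidHom.ext fun a => (wedge X).map_smul f a

/-- The canonical anticommutation relation, obtained by splitting off the first summand of the
antisymmetrization. -/
theorem contract_wedgeOp (ξ : Module.Dual R Γ) (X : Γ) :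
    (contract ξ * wedgeOp X : AddMonoid.End (Forms R (Module.Dual R Γ) N)) =
      scale (ξ X) - wedgeOp X * contract ξ := by
  refine AddMonoidHom.ext fun a => funext fun k => ?_
  cases k with
  | zero =>
    refine (curryLeft_alternatizeUncurryFin_zero _ ξ).trans ?_
    change ξ X • a 0 = ξ X • a 0 - 0
    rw [sub_zero]
  | succ k =>
    refine (curryLeft_alternatizeUncurryFin _ ξ).trans ?_
    change ξ X • a (k + 1) - _ = ξ X • a (k + 1) - wedgeAux X ((a (k + 1)).curryLeft ξ)
    congr 1

/-- By rigidity; the anticommutators with contractions match because `(L_X ξ)(Y) = a(X)(ξ(Y)) -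
ξ([X, Y])`. -/
theorem lieOp_wedgeOp (S : SkewAlgebroid R Γ) (X Y : Γ) (τ : DerivOp (S.anchor X) N) :
    lieOp (S.adDual X) τ * wedgeOp Y =
      wedgeOp Y * lieOp (S.adDual X) τ + wedgeOp (S.bracket X Y) := by
  rw [← sub_eq_zero]
  refine op_eq_zero_of_anticomm _ (fun w => ?_) (fun ξ => ?_)
  · change lieOp (S.adDual X) τ (wedgeOp Y w) 0 - (wedgeOp Y (lieOp (S.adDual X) τ w) 0 +
      wedgeOp (S.bracket X Y) w 0) = 0
    ext x
    rw [wedgeOp_zero_apply, wedgeOp_zero_apply]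
    simp only [AlternatingMap.sub_apply, lieOp_zero_apply, wedgeOp_zero_apply]
    simp
  · have h1 := lieOp_contract (N := N) (S.adDual X) τ
    have h2 := contract_wedgeOp (R := R) (Γ := Γ) (N := N)
    have h3 := lieOp_scale (S.adDual X) τ
    have h4 : S.adDual X ξ Y = S.anchor X (ξ Y) - ξ (S.bracket X Y) := rfl
    simp only [mul_sub, mul_add, sub_mul, add_mul, ← mul_assoc, h1, h2]
    simp only [mul_sub, mul_add, sub_mul, add_mul, mul_assoc, h1, h2, h3, h4, scale_sub]
    abel

/-- Exterior multiplication as a bilinear map. -/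
def wedgeLin (k : ℕ) : Γ →ₗ[R] (Module.Dual R Γ [⋀^Fin k]→ₗ[R] N) →ₗ[R]
    Module.Dual R Γ [⋀^Fin (k + 1)]→ₗ[R] N :=
  LinearMap.mk₂ R (fun X a => wedgeAux X a)
    (fun X Y a => by
      ext ξ; simp [wedgeAux_apply, add_smul, Finset.sum_add_distrib])
    (fun c X a => by
      ext ξ
      simp only [wedgeAux_apply, map_smul, smul_eq_mul, mul_smul, AlternatingMap.smul_apply,
        Finset.smul_sum]
      exact Finset.sum_congr rfl fun i _ => smul_comm _ _ _)
    (fun X a b => map_add _ _ _) (fun c X a => map_smul _ _ _)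

/-- Exterior multiplication by the bivector `Λ`. -/
def Bivector.wedgeOp (Λ : Bivector R Γ) : AddMonoid.End (Forms R (Module.Dual R Γ) N) :=
  AddMonoidHom.mk' (fun a k => match k with
    | 0 => 0
    | 1 => 0
    -- Antisymmetrizing `η ↦ Λ♯η ∧ a` counts `Λ` twice, once through each of its slots; hence the
    -- factor `½`.
    | k + 2 => algebraMap ℝ R 2⁻¹ • AlternatingMap.alternatizeUncurryFinLM
        ((wedgeLin k).flip (a k) ∘ₗ Λ.sharp))
    (fun a b => by
      funext k
      rcases k with _ | _ | k
      · exact (add_zero _).symm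
      · exact (add_zero _).symm
      · simp only [Pi.add_apply, map_add, smul_add, LinearMap.add_comp])

theorem Bivector.wedgeOp_zero_apply (Λ : Bivector R Γ) (a : Forms R (Module.Dual R Γ) N) :
    Λ.wedgeOp a 0 = 0 := rfl

theorem Bivector.wedgeOp_one_apply (Λ : Bivector R Γ) (a : Forms R (Module.Dual R Γ) N) :
    Λ.wedgeOp a 1 = 0 := rfl

theorem Bivector.wedgeOp_two_apply (Λ : Bivector R Γ) (a : Forms R (Module.Dual R Γ) N) (k : ℕ) :
    Λ.wedgeOp a (k + 2) = algebraMap ℝ R 2⁻¹ • AlternatingMap.alternatizeUncurryFin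
        ((wedgeLin k).flip (a k) ∘ₗ Λ.sharp) := rfl

theorem wedgeAux_eq_alternatizeUncurryFin (X : Γ) {k : ℕ}
    (a : Module.Dual R Γ [⋀^Fin k]→ₗ[R] N) :
    AlternatingMap.alternatizeUncurryFin ((Module.Dual.eval R Γ X).smulRight a) = wedgeAux X a :=
  rfl

theorem half_smul_add_self {P : Type*} [AddCommGroup P] [Module R P] (x : P) :
    algebraMap ℝ R 2⁻¹ • (x + x) = x := by
  rw [← two_smul R x, smul_smul, ← map_ofNat (algebraMap ℝ R) 2, ← map_mul]
  norm_num

theorem half_smul_add_add {P : Type*} [AddCommGroup P] [Module R P] (x y : P) :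
    algebraMap ℝ R 2⁻¹ • (x + y + x) = x + algebraMap ℝ R 2⁻¹ • y := by
  rw [add_right_comm, smul_add, half_smul_add_self]

/-- The term `Λ♯ξ ∧ a` appears twice, once with `ξ` in the slot of `Λ♯` and once from `ξ(Λ♯η) =
-η(Λ♯ξ)`; the factor `½` leaves one copy. -/
theorem Bivector.contract_wedgeOp (Λ : Bivector R Γ) (ξ : Module.Dual R Γ) :
    (contract ξ * Λ.wedgeOp : AddMonoid.End (Forms R (Module.Dual R Γ) N)) =
      Λ.wedgeOp * contract ξ + DiracGen.wedgeOp (Λ.sharp ξ) := by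
  refine AddMonoidHom.ext fun a => funext fun k => ?_
  have hskew : ∀ η : Module.Dual R Γ, ξ (Λ.sharp η) = - η (Λ.sharp ξ) :=
    fun η => Λ.toFun_skew η ξ
  have key : ∀ k, (∀ η : Module.Dual R Γ, (wedgeAux (Λ.sharp η) (a k)).curryLeft ξ =
      ξ (Λ.sharp η) • a k - DiracGen.wedgeOp (Λ.sharp η) (contract ξ a) k) := fun k η =>
    congrFun (DFunLike.congr_fun (DiracGen.contract_wedgeOp (N := N) ξ (Λ.sharp η)) a) k
  rcases k with _ | k
  · change (0 : Module.Dual R Γ [⋀^Fin 1]→ₗ[R] N).curryLeft ξ = 0 + 0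
    simp
  · change (Λ.wedgeOp a (k + 2)).curryLeft ξ = Λ.wedgeOp (contract ξ a) (k + 1) +
      wedgeAux (Λ.sharp ξ) (a k)
    rw [wedgeOp_two_apply, AlternatingMap.curryLeft_smul, LinearMap.smul_apply,
      curryLeft_alternatizeUncurryFin]
    have e1 : ((wedgeLin k).flip (a k) ∘ₗ Λ.sharp) ξ = wedgeAux (Λ.sharp ξ) (a k) := rfl
    rcases k with _ | k
    · have e2 : (AlternatingMap.curryLeftLinearMap.flip ξ ∘ₗ ((wedgeLin 0).flip (a 0) ∘ₗ Λ.sharp)) =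
          - (Module.Dual.eval R Γ (Λ.sharp ξ)).smulRight (a 0) := by
        refine LinearMap.ext fun η => (key 0 η).trans ?_
        rw [DiracGen.wedgeOp_zero_apply, hskew]
        simp
      rw [e1, e2, ← AlternatingMap.alternatizeUncurryFinLM_apply, map_neg,
        AlternatingMap.alternatizeUncurryFinLM_apply, wedgeAux_eq_alternatizeUncurryFin,
        sub_neg_eq_add]
      exact (half_smul_add_self _).trans (zero_add _).symm
    · have e2 : (AlternatingMap.curryLeftLinearMap.flip ξ ∘ₗ
            ((wedgeLin (k + 1)).flip (a (k + 1)) ∘ₗ Λ.sharp)) =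
          - (Module.Dual.eval R Γ (Λ.sharp ξ)).smulRight (a (k + 1)) -
            (wedgeLin k).flip (contract ξ a k) ∘ₗ Λ.sharp := by
        refine LinearMap.ext fun η => (key (k + 1) η).trans ?_
        rw [DiracGen.wedgeOp_succ_apply, hskew]
        simp [wedgeLin]
      rw [e1, e2, ← AlternatingMap.alternatizeUncurryFinLM_apply, map_sub, map_neg,
        AlternatingMap.alternatizeUncurryFinLM_apply, wedgeAux_eq_alternatizeUncurryFin,
        sub_sub_eq_add_sub, sub_neg_eq_add]
      exact (half_smul_add_add _ _).trans (add_comm _ _)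

end Wedge

/-! ### The Chevalley–Eilenberg differential and `d² = 0`. -/

section Differential
variable {R : Type*} [CommRing R] [Algebra ℝ R]
variable {Γ N : Type*} [AddCommGroup Γ] [Module R Γ] [AddCommGroup N] [Module R N]

/-- The Chevalley--Eilenberg differential on the total space, as an additive operator. -/
def SkewAlgebroid.dOp (S : SkewAlgebroid R Γ) (E : S.Connection N) :
    AddMonoid.End (Forms R Γ N) :=
  AddMonoidHom.mk' (S.d E) (fun a b => by
    funext k
    cases k with
    | zero => exact (add_zero _).symm
    | succ k => ext x; exact S.ceFun_add E _ _ x)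

theorem SkewAlgebroid.dOp_zero_apply (S : SkewAlgebroid R Γ) (E : S.Connection N)
    (a : Forms R Γ N) : S.dOp E a 0 = 0 := rfl

/-- Cartan's formula. It is the recursion `ceFun_succ` in operator form, and by rigidity it
determines `d`. -/
theorem SkewAlgebroid.contract_dOp (S : SkewAlgebroid R Γ) (E : S.Connection N) (X : Γ) :
    contract X * S.dOp E = lieOp (S.ad X) (E.act X) - S.dOp E * contract X := by
  refine AddMonoidHom.ext fun a => funext fun k => ?_
  cases k with
  | zero =>
    ext x
    change S.ceFun E (a 0) (Matrix.vecCons X x) = lieOp (S.ad X) (E.act X) a 0 x - 0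
    rw [lieOp_zero_apply, sub_zero, ceFun]
    simp
  | succ k =>
    ext x
    exact S.ceFun_succ E (a (k + 1)) X x

/-- The flatness condition for a connection. -/
def SkewAlgebroid.Connection.IsFlat {S : SkewAlgebroid R Γ} (E : S.Connection N) : Prop :=
  ∀ X Y n, E.act (S.bracket X Y) n = E.act X (E.act Y n) - E.act Y (E.act X n)

/-- The two base derivations may differ as terms. This identifies operators over `⁅a(X), a(Y)⁆` and
over `a([X, Y])` without transport. -/
theorem lieOp_congr {V : Type*} [AddCommGroup V] [Module R V] {D D' : Derivation ℝ R R}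
    {δ : DerivOp D V} {δ' : DerivOp D' V}
    {τ : DerivOp D N} {τ' : DerivOp D' N} (h : ∀ v, δ v = δ' v) (h' : ∀ n, τ n = τ' n) :
    lieOp δ τ = lieOp δ' τ' := by
  ext a k x
  simp only [lieOp_apply, DerivOp.alt_apply, h, h']

/-- By Cartan's formula the anticommutator of `[L_X, d]` with `ι_Y` is `[L_X, L_Y] - L_{[X,Y]}`,
which vanishes by Jacobi and flatness. -/
theorem LieAlgebroid.lieOp_comm_dOp (S : LieAlgebroid R Γ) (E : S.Connection N) (hE : E.IsFlat)
    (X : Γ) : lieOp (S.ad X) (E.act X) * S.dOp E = S.dOp E * lieOp (S.ad X) (E.act X) := by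
  rw [← sub_eq_zero]
  refine op_eq_zero_of_anticomm _ (fun w => ?_) (fun Y => ?_)
  · change lieOp (S.ad X) (E.act X) (S.dOp E w) 0 - S.dOp E (lieOp (S.ad X) (E.act X) w) 0 = 0
    ext x
    rw [S.dOp_zero_apply]
    simp only [AlternatingMap.sub_apply, lieOp_zero_apply, S.dOp_zero_apply]
    simp
  · have h1 : ∀ Y, contract Y * lieOp (S.ad X) (E.act X) =
        lieOp (S.ad X) (E.act X) * contract Y - contract (S.bracket X Y) :=
      lieOp_contract (N := N) (S.ad X) (E.act X)
    have h2 := S.contract_dOp E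
    have h3 := lieOp_comm (S.ad X) (E.act X) (S.ad Y) (E.act Y)
    have h4 : lieOp ((S.ad X).comm (S.ad Y)) ((E.act X).comm (E.act Y)) =
        lieOp (S.ad (S.bracket X Y)) (E.act (S.bracket X Y)) := by
      refine lieOp_congr (fun v => ?_) (fun n => ?_)
      · have := S.jacobi X Y v
        change S.bracket X (S.bracket Y v) - S.bracket Y (S.bracket X v) = S.bracket (S.bracket X Y) v
        rw [this]; abel
      · exact (hE X Y n).symm
    rw [h4] at h3
    have h6 : lieOp (S.ad X) (E.act X) * lieOp (S.ad Y) (E.act Y) =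
      lieOp (S.ad Y) (E.act Y) * lieOp (S.ad X) (E.act X) +
        lieOp (S.ad (S.bracket X Y)) (E.act (S.bracket X Y)) := by rw [← h3]; abel
    simp only [mul_sub, mul_add, sub_mul, add_mul, ← mul_assoc, h1, h2]
    simp only [mul_sub, mul_add, sub_mul, add_mul, mul_assoc, h1, h2, h6]
    abel

/-- `ι_Y d² = L_Y d - d ι_Y d = L_Y d - d L_Y + d² ι_Y = d² ι_Y`, and rigidity applies. -/
theorem LieAlgebroid.dOp_dOp (S : LieAlgebroid R Γ) (E : S.Connection N) (hE : E.IsFlat) :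
    S.dOp E * S.dOp E = 0 := by
  refine op_eq_zero_of_comm _ (fun w => S.dOp_zero_apply E (S.dOp E w)) (fun Y => ?_)
  have h2 := S.contract_dOp E
  have h3 := S.lieOp_comm_dOp E hE
  simp only [sub_mul, ← mul_assoc, h2]
  simp only [mul_sub, mul_assoc, h2, h3]
  abel

end Differential

/-! ### The star map exchanges exterior multiplication and contraction. -/

section Star
variable {R : Type*} [CommRing R] [Algebra ℝ R]
variable {Γ N : Type*} [AddCommGroup Γ] [Module R Γ] [AddCommGroup N] [Module R N]

theorem ι_mul_ιMulti (X : Γ) : ∀ {j : ℕ} (Y : Fin j → Γ),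
    ExteriorAlgebra.ι R X * ExteriorAlgebra.ιMulti R j Y =
      (-1 : ℤ) ^ j • (ExteriorAlgebra.ιMulti R j Y * ExteriorAlgebra.ι R X)
  | 0, Y => by simp
  | j + 1, Y => by
    have h : ExteriorAlgebra.ι R X * ExteriorAlgebra.ι R (Y 0) =
        - (ExteriorAlgebra.ι R (Y 0) * ExteriorAlgebra.ι R X) :=
      eq_neg_of_add_eq_zero_left (ExteriorAlgebra.ι_add_mul_swap X (Y 0))
    rw [ExteriorAlgebra.ιMulti_succ_apply, ← mul_assoc, h, neg_mul, mul_assoc,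
      ι_mul_ιMulti X, mul_smul_comm, pow_succ, mul_neg_one, neg_smul, mul_assoc]

theorem starMap_apply (n : ℕ) (a : Forms R (Module.Dual R Γ) N) (j : ℕ) (X : Fin j → Γ) :
    starMap n a j X = (wedgeAction (N := N)) (ExteriorAlgebra.ιMulti R j X) a n := rfl

theorem wedgeAction_ι (X : Γ) (a : Forms R (Module.Dual R Γ) N) :
    (wedgeAction (N := N)) (ExteriorAlgebra.ι R X) a = wedgeOp X a := by
  rw [wedgeAction, ExteriorAlgebra.lift_ι_apply]; rfl

theorem starMap_zero_apply (n : ℕ) (a : Forms R (Module.Dual R Γ) N) (X : Fin 0 → Γ) :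
    starMap n a 0 X = a n := by
  rw [starMap_apply]; simp

theorem starMap_add (n : ℕ) (a b : Forms R (Module.Dual R Γ) N) :
    starMap (Γ := Γ) n (a + b) = starMap n a + starMap n b := by
  funext j; ext1 X
  simp [starMap_apply]

theorem starMap_smul (n : ℕ) (f : R) (a : Forms R (Module.Dual R Γ) N) :
    starMap (Γ := Γ) n (f • a) = f • starMap n a := by
  funext j; ext1 X
  simp [starMap_apply]

/-- `starMap` as a linear map. -/
def starLin (n : ℕ) : Forms R (Module.Dual R Γ) N →ₗ[R]
    Forms R Γ (Module.Dual R Γ [⋀^Fin n]→ₗ[R] N) where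
  toFun := starMap n
  map_add' := starMap_add n
  map_smul' := starMap_smul n

/-- The sign comes from moving `X` past `j` vectors until it stands next to `a`. -/
theorem contract_starMap (n : ℕ) (X : Γ) (a : Forms R (Module.Dual R Γ) N) (j : ℕ) :
    contract X (starMap n a) j = (-1 : ℤ) ^ j • starMap n (wedgeOp X a) j := by
  ext1 Y
  change starMap n a (j + 1) (Matrix.vecCons X Y) = _
  rw [AlternatingMap.smul_apply, starMap_apply, starMap_apply, ExteriorAlgebra.ιMulti_succ_apply]
  change (wedgeAction (N := N)) (ExteriorAlgebra.ι R X * ExteriorAlgebra.ιMulti R j Y) a n = _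
  rw [ι_mul_ιMulti, map_zsmul, map_mul]
  change (-1 : ℤ) ^ j • ((wedgeAction (N := N)) (ExteriorAlgebra.ιMulti R j Y))
    ((wedgeAction (N := N)) (ExteriorAlgebra.ι R X) a) n = _
  rw [wedgeAction_ι]

/-- The star map is homogeneous: its component of degree `j` sees only the component of
complementary degree, and nothing if `j > n`. -/
theorem starMap_eq_zero (n : ℕ) {j : ℕ} (a : Forms R (Module.Dual R Γ) N)
    (h : ∀ k, k + j = n → a k = 0) : starMap (Γ := Γ) n a j = 0 := by
  induction j generalizing a with
  | zero => ext1 X; rw [starMap_zero_apply, h n rfl]; rfl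
  | succ j ih =>
    ext1 Y
    have := DFunLike.congr_fun (contract_starMap n (Y 0) a j) (Fin.tail Y)
    rw [ih, smul_zero] at this
    · change starMap n a (j + 1) (Matrix.vecCons (Y 0) (Fin.tail Y)) = 0 at this
      rw [show Matrix.vecCons (Y 0) (Fin.tail Y) = Y from Fin.cons_self_tail Y] at this
      exact this
    · rintro (_ | k) hk
      · rfl
      · rw [wedgeOp_succ_apply, h k (by omega), map_zero]

theorem starMap_congr (n : ℕ) {j : ℕ} (a b : Forms R (Module.Dual R Γ) N)
    (h : ∀ k, k + j = n → a k = b k) : starMap (Γ := Γ) n a j = starMap n b j := by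
  have := starMap_eq_zero (j := j) n (a - b) (fun k hk => by simp [h k hk])
  have e : starMap (Γ := Γ) n (a - b) = starMap n a - starMap n b := map_sub (starLin n) a b
  rw [e] at this
  exact sub_eq_zero.mp this

/-- Both sides are compared after contraction: the commutator of `L_X` with `Y ∧` on one side and
with `ι_Y` on the other both involve `[X, Y]`. -/
theorem starMap_lieOp (S : SkewAlgebroid R Γ) (n : ℕ) (X : Γ) (τ : DerivOp (S.anchor X) N)
    (a : Forms R (Module.Dual R Γ) N) :
    starMap n (lieOp (S.adDual X) τ a) =
      lieOp (S.ad X) ((S.adDual X).alt τ n) (starMap n a) := by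
  set L := lieOp (S.ad X) ((S.adDual X).alt τ n) with hL
  rw [← sub_eq_zero]
  refine eq_zero_of_contract (fun a => starMap n (lieOp (S.adDual X) τ a) - L (starMap n a))
    (fun w => ?_) (fun w Y => ⟨wedgeOp Y w, fun k hk => ?_⟩) a
  · ext1 x
    change starMap n (lieOp (S.adDual X) τ w) 0 x - L (starMap n w) 0 x = 0
    rw [starMap_zero_apply, hL, lieOp_zero_apply, starMap_zero_apply, sub_eq_zero]
    rfl
  · rw [map_sub]
    have h1 : contract Y (L (starMap n w)) = L (contract Y (starMap n w)) -
        contract (S.bracket X Y) (starMap n w) :=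
      DFunLike.congr_fun (lieOp_contract (S.ad X) ((S.adDual X).alt τ n) Y) (starMap n w)
    have h2 : wedgeOp Y (lieOp (S.adDual X) τ w) =
        lieOp (S.adDual X) τ (wedgeOp Y w) - wedgeOp (S.bracket X Y) w := by
      rw [eq_sub_iff_add_eq]
      exact (DFunLike.congr_fun (lieOp_wedgeOp S X Y τ) w).symm
    have h3 : L (contract Y (starMap n w)) k = (-1 : ℤ) ^ k • L (starMap n (wedgeOp Y w)) k := by
      rw [hL, lieOp_apply, contract_starMap, map_zsmul]; rfl
    have h4 : starMap (Γ := Γ) n (wedgeOp Y (lieOp (S.adDual X) τ w)) =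
        starMap n (lieOp (S.adDual X) τ (wedgeOp Y w)) -
          starMap n (wedgeOp (S.bracket X Y) w) := by
      rw [h2]; exact map_sub (starLin n) _ _
    rw [h1]
    simp only [Pi.sub_apply] at hk ⊢
    rw [contract_starMap, contract_starMap, h3, h4]
    simp only [Pi.sub_apply]
    rw [← smul_zero ((-1 : ℤ) ^ k), ← hk]
    simp only [smul_sub]
    abel

/-- Rigidity carried over by the star map: exterior multiplications play the part of contractions,
the top degree that of degree zero. -/
theorem op_eq_zero_of_wedge_anticomm {n : ℕ}
    (hs : Function.Injective (starMap (R := R) (Γ := Γ) (N := N) n))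
    (T : AddMonoid.End (Forms R (Module.Dual R Γ) N)) (h0 : ∀ w, T w n = 0)
    (h : ∀ X, wedgeOp X * T + T * wedgeOp X = 0) : T = 0 := by
  refine AddMonoidHom.ext fun w => hs ?_
  have h0' : starMap (Γ := Γ) n (0 : Forms R (Module.Dual R Γ) N) = 0 := map_zero (starLin n)
  refine Eq.trans ?_ h0'.symm
  refine eq_zero_of_contract (fun a => starMap n (T a))
    (fun w => ?_) (fun w Y => ⟨wedgeOp Y w, fun k hk => ?_⟩) w
  · ext1 x; rw [starMap_zero_apply, h0]; rfl
  · have := DFunLike.congr_fun (h Y) w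
    change wedgeOp Y (T w) + T (wedgeOp Y w) = 0 at this
    have e : starMap (Γ := Γ) n (wedgeOp Y (T w)) = - starMap n (T (wedgeOp Y w)) := by
      rw [eq_neg_of_add_eq_zero_left this]; exact map_neg (starLin n) _
    rw [contract_starMap, e, Pi.neg_apply, hk, neg_zero, smul_zero]

end Star

/-! ### The operator `∂` and its Cartan formula. -/

section Boundary
variable {R : Type*} [CommRing R] [Algebra ℝ R]
variable {Γ N : Type*} [AddCommGroup Γ] [Module R Γ] [AddCommGroup N] [Module R N]
variable {n : ℕ} (hs : Function.Bijective (starMap (R := R) (Γ := Γ) (N := N) n))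
  (S : SkewAlgebroid R Γ) (E : S.Connection (Module.Dual R Γ [⋀^Fin n]→ₗ[R] N))

theorem SkewAlgebroid.dSigned_succ {B : Type*} [AddCommGroup B] [Module R B]
    (E : S.Connection B) (θ : Forms R Γ B) (k : ℕ) :
    S.dSigned E θ (k + 1) = (-1 : ℤ) ^ k • S.dOp E θ (k + 1) := rfl

theorem SkewAlgebroid.dSigned_add {B : Type*} [AddCommGroup B] [Module R B]
    (E : S.Connection B) (θ η : Forms R Γ B) :
    S.dSigned E (θ + η) = S.dSigned E θ + S.dSigned E η := by
  funext k
  cases k with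
  | zero => exact (add_zero _).symm
  | succ k =>
    rw [Pi.add_apply, dSigned_succ, dSigned_succ, dSigned_succ, map_add, Pi.add_apply, smul_add]

/-- The operator `∂` on sections of `∧A ⊗ L`. -/
def boundary : AddMonoid.End (Forms R (Module.Dual R Γ) N) :=
  AddMonoidHom.mk' (fun a => (Equiv.ofBijective _ hs).symm (S.dSigned E (starMap n a)))
    (fun a b => by
      apply hs.1
      rw [starMap_add]
      simp only [Equiv.ofBijective_apply_symm_apply, starMap_add, S.dSigned_add])

theorem starMap_boundary (a : Forms R (Module.Dual R Γ) N) :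
    starMap n (boundary hs S E a) = S.dSigned E (starMap n a) :=
  Equiv.ofBijective_apply_symm_apply _ hs _

theorem dirac_apply (S' : SkewAlgebroid R (Module.Dual R Γ)) (E' : S'.Connection N)
    (a : Forms R (Module.Dual R Γ) N) :
    dirac S S' hs E E' a = (S'.dOp E' + boundary hs S E) a := rfl

theorem boundary_top (a : Forms R (Module.Dual R Γ) N) : boundary hs S E a n = 0 := by
  rw [← starMap_zero_apply (Γ := Γ) n (boundary hs S E a) ![], starMap_boundary]
  rfl

theorem dOp_congr {B : Type*} [AddCommGroup B] [Module R B]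
    (E : S.Connection B) {θ η : Forms R Γ B} {k : ℕ} (h : θ k = η k) :
    S.dOp E θ (k + 1) = S.dOp E η (k + 1) := by
  change S.ce E (θ k) = S.ce E (η k)
  rw [h]

/-- Since `∂` lowers the degree by one, only `a 1` matters. The component of degree zero is
isolated, and its star image, which sits in degree `n`, is a differential of the star image of `a
1`. -/
theorem boundary_zero_apply (a : Forms R (Module.Dual R Γ) N) (h : a 1 = 0) :
    boundary hs S E a 0 = 0 := by
  have h1 : starMap (Γ := Γ) n (Pi.single 0 (boundary hs S E a 0) :
      Forms R (Module.Dual R Γ) N) = 0 := by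
    funext j
    rcases eq_or_ne j n with rfl | hj
    · have : starMap (Γ := Γ) j (Pi.single 0 (boundary hs S E a 0) :
          Forms R (Module.Dual R Γ) N) j = starMap j (boundary hs S E a) j :=
        starMap_congr j _ _ (fun k hk => by
          obtain rfl : k = 0 := by omega
          simp)
      rw [this, starMap_boundary]
      cases j with
      | zero => rfl
      | succ j =>
        rw [S.dSigned_succ, dOp_congr S E (η := 0), map_zero]
        · simp
        · exact starMap_eq_zero _ _ (fun k hk => by obtain rfl : k = 1 := by omega
                                                    exact h)
    · exact starMap_eq_zero _ _ (fun k hk => by rw [Pi.single_eq_of_ne (by omega)])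
  have h0' : starMap (Γ := Γ) n (0 : Forms R (Module.Dual R Γ) N) = 0 := map_zero (starLin n)
  have := congrFun (hs.1 (h1.trans h0'.symm)) 0
  simpa using this

/-- The signs of `dSigned` are constant in each degree, so they come out and `d² = 0` remains. -/
theorem boundary_boundary (h : S.dOp E * S.dOp E = 0) :
    boundary hs S E * boundary hs S E = 0 := by
  refine AddMonoidHom.ext fun a => hs.1 ?_
  have h0' : starMap (Γ := Γ) n (0 : Forms R (Module.Dual R Γ) N) = 0 := map_zero (starLin n)
  refine Eq.trans ?_ h0'.symm
  change starMap n (boundary hs S E (boundary hs S E a)) = 0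
  rw [starMap_boundary, starMap_boundary]
  funext k
  rcases k with _ | _ | k
  · rfl
  · have h1 : S.ce E (0 : Γ [⋀^Fin 0]→ₗ[R] _) = 0 := congrFun (map_zero (S.dOp E)) 1
    change (-1 : ℤ) ^ 0 • S.ce E 0 = 0
    rw [h1, smul_zero]
  · have h1 := congrFun (DFunLike.congr_fun h (starMap n a)) (k + 2)
    change S.dOp E (S.dOp E (starMap n a)) (k + 2) = 0 at h1
    have h2 : S.dOp E (S.dSigned E (starMap n a)) (k + 2) =
        S.dOp E ((-1 : ℤ) ^ k • S.dOp E (starMap n a)) (k + 2) :=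
      dOp_congr S E (S.dSigned_succ E _ k)
    rw [S.dSigned_succ, h2, map_zsmul, Pi.smul_apply, h1, smul_zero, smul_zero]
    rfl

/-- Cartan's formula for `d` read through the star map. The sign in `dSigned` compensates the one in
`contract_starMap`, so that an anticommutator results. -/
theorem boundary_wedgeOp (X : Γ) (τ : DerivOp (S.anchor X) N)
    (hτ : ∀ b, E.act X b = (S.adDual X).alt τ n b) :
    boundary hs S E * wedgeOp X = lieOp (S.adDual X) τ - wedgeOp X * boundary hs S E := by
  rw [eq_sub_iff_add_eq]
  refine AddMonoidHom.ext fun a => hs.1 ?_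
  change starMap n (boundary hs S E (wedgeOp X a) + wedgeOp X (boundary hs S E a)) =
    starMap n (lieOp (S.adDual X) τ a)
  rw [starMap_lieOp, starMap_add, starMap_boundary]
  set θ := starMap n a with hθ
  have hL : lieOp (S.ad X) ((S.adDual X).alt τ n) θ = lieOp (S.ad X) (E.act X) θ := by
    rw [lieOp_congr (fun _ => rfl) hτ]
  have h1 := DFunLike.congr_fun (S.contract_dOp E X) θ
  change contract X (S.dOp E θ) = lieOp (S.ad X) (E.act X) θ - S.dOp E (contract X θ) at h1
  have hsq : ∀ k {l : ℕ} (b : Γ [⋀^Fin l]→ₗ[R] (Module.Dual R Γ [⋀^Fin n]→ₗ[R] N)),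
      (-1 : ℤ) ^ k • (-1 : ℤ) ^ k • b = b := fun k l b => by
    rw [smul_smul, ← mul_pow]; simp
  have h2 : ∀ c : Forms R (Module.Dual R Γ) N, ∀ k, starMap (Γ := Γ) n (wedgeOp X c) k =
      (-1 : ℤ) ^ k • contract X (starMap n c) k := fun c k => by
    rw [contract_starMap, hsq]
  have h3 : ∀ k, starMap (Γ := Γ) n (wedgeOp X (boundary hs S E a)) k =
      contract X (S.dOp E θ) k := fun k => by
    rw [h2, starMap_boundary]
    change (-1 : ℤ) ^ k • (S.dSigned E θ (k + 1)).curryLeft X = _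
    rw [S.dSigned_succ]
    change (-1 : ℤ) ^ k • ((-1 : ℤ) ^ k • S.dOp E θ (k + 1)).curryLeft X = _
    have : ((-1 : ℤ) ^ k • S.dOp E θ (k + 1)).curryLeft X =
      (-1 : ℤ) ^ k • (S.dOp E θ (k + 1)).curryLeft X := by ext; rfl
    rw [this, hsq]; rfl
  have h4 : ∀ k, S.dSigned E (starMap n (wedgeOp X a)) k = S.dOp E (contract X θ) k := fun k => by
    cases k with
    | zero => rfl
    | succ k =>
      rw [S.dSigned_succ, dOp_congr S E (η := (-1 : ℤ) ^ k • contract X θ) (h2 a k), map_zsmul,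
        Pi.smul_apply, hsq]
  rw [hL]
  funext k
  rw [Pi.add_apply, h3, h4, h1]
  simp
end Boundary

/-! ### The derived bracket `Λ∂ - ∂Λ` equals `d_*`. -/

section DerivedBracket
variable {R : Type*} [CommRing R] [Algebra ℝ R]
variable {Γ N : Type*} [AddCommGroup Γ] [Module R Γ] [AddCommGroup N] [Module R N]
variable {n : ℕ} (hs : Function.Bijective (starMap (R := R) (Γ := Γ) (N := N) n))
  (S : SkewAlgebroid R Γ) (E : S.Connection (Module.Dual R Γ [⋀^Fin n]→ₗ[R] N))
  (δ : ∀ X, DerivOp (S.anchor X) N) (hδ : ∀ X b, E.act X b = (S.adDual X).alt (δ X) n b)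

include hδ in
theorem wedgeOp_boundary (X : Γ) :
    wedgeOp X * boundary hs S E = lieOp (S.adDual X) (δ X) - boundary hs S E * wedgeOp X := by
  rw [boundary_wedgeOp hs S E X (δ X) (hδ X)]; abel

-- The operator `∂` is of first order with symbol `ι_{df}`. By dual rigidity this reduces to the
-- symbol `a(X)f` of the Lie derivative `L_X = X∧∂ + ∂X∧`; the top degree is settled because there
-- are no forms of degree `n + 1`.
include hδ in
theorem boundary_scale (hvan : ∀ b : Module.Dual R Γ [⋀^Fin (n + 1)]→ₗ[R] N, b = 0) (f : R) :
    boundary hs S E * scale f = scale f * boundary hs S E + contract (S.d₀ f) := by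
  rw [← sub_eq_zero]
  refine op_eq_zero_of_wedge_anticomm hs.1 _ (fun w => ?_) (fun X => ?_)
  · change boundary hs S E (scale f w) n - (f • boundary hs S E w n +
      (w (n + 1)).curryLeft (S.d₀ f)) = 0
    rw [boundary_top, boundary_top, hvan (w (n + 1))]
    simp
  · have h1 := wedgeOp_boundary hs S E δ hδ X
    have h2 := wedgeOp_scale (R := R) (N := N) f X
    have h3 : (wedgeOp X * contract (S.d₀ f) : AddMonoid.End (Forms R (Module.Dual R Γ) N)) =
        scale (S.anchor X f) - contract (S.d₀ f) * wedgeOp X := by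
      rw [contract_wedgeOp]; simp [SkewAlgebroid.d₀]
    have h4 := lieOp_scale (S.adDual X) (δ X) f
    simp only [mul_sub, mul_add, sub_mul, add_mul, ← mul_assoc, h1, h2, h3]
    simp only [mul_sub, mul_add, sub_mul, add_mul, mul_assoc, h1, h2, h3, h4]
    abel

/-- The anticommutator of a contraction with `∂`; it is contraction with the two-form `dξ`. -/
def contractD (ξ : Module.Dual R Γ) : AddMonoid.End (Forms R (Module.Dual R Γ) N) :=
  contract ξ * boundary hs S E + boundary hs S E * contract ξ

-- The section `L_X ξ - d(ξ(X))` is `ι_X dξ`, so `contractD` has the commutators with `X ∧` that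
-- contraction with `dξ` must have.
include hδ in
theorem wedgeOp_contractD (hvan : ∀ b : Module.Dual R Γ [⋀^Fin (n + 1)]→ₗ[R] N, b = 0)
    (ξ : Module.Dual R Γ) (X : Γ) :
    wedgeOp X * contractD hs S E ξ = contractD hs S E ξ * wedgeOp X +
      contract (S.adDual X ξ - S.d₀ (ξ X)) := by
  have h1 := wedgeOp_boundary hs S E δ hδ X
  have h3 : (wedgeOp X * contract ξ : AddMonoid.End (Forms R (Module.Dual R Γ) N)) =
      scale (ξ X) - contract ξ * wedgeOp X := by
    rw [contract_wedgeOp]; abel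
  have h4 := boundary_scale hs S E δ hδ hvan (ξ X)
  have h5 := lieOp_contract (S.adDual X) (δ X) ξ
  simp only [contractD, mul_sub, mul_add, sub_mul, add_mul, ← mul_assoc, h1, h3, contract_sub]
  simp only [mul_sub, mul_add, sub_mul, add_mul, mul_assoc, h1, h3, h4, h5]
  abel

-- The two symbols of `∂` cancel because `ι_ξ` and `ι_{df}` anticommute. Thus `contractD` is
-- tensorial although `∂` is not.
include hδ in
theorem contractD_scale (hvan : ∀ b : Module.Dual R Γ [⋀^Fin (n + 1)]→ₗ[R] N, b = 0)
    (ξ : Module.Dual R Γ) (f : R) :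
    contractD hs S E ξ * scale f = scale f * contractD hs S E ξ := by
  have h4 := boundary_scale hs S E δ hδ hvan f
  have h1 := contract_scale (R := R) (N := N) f ξ
  have h2 := contract_contract (R := R) (N := N) ξ (S.d₀ f)
  have h1' : ∀ T : AddMonoid.End (Forms R (Module.Dual R Γ) N),
      contract ξ * (scale f * T) = scale f * (contract ξ * T) := fun T => by
    rw [← mul_assoc, h1, mul_assoc]
  have h4' : ∀ T : AddMonoid.End (Forms R (Module.Dual R Γ) N),
      boundary hs S E * (scale f * T) = scale f * (boundary hs S E * T) +
        contract (S.d₀ f) * T := fun T => by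
    rw [← mul_assoc, h4, add_mul, mul_assoc]
  simp only [contractD, mul_sub, mul_add, sub_mul, add_mul, mul_assoc, h1, h1', h4, h4', h2]
  abel

-- By dual rigidity: both products vanish in the top degree, and the commutators with `X ∧` reduce
-- to `contractD_scale` and to anticommuting contractions.
include hδ in
theorem contractD_contract (hvan : ∀ b : Module.Dual R Γ [⋀^Fin (n + 1)]→ₗ[R] N, b = 0)
    (ξ η : Module.Dual R Γ) :
    contract η * contractD hs S E ξ = contractD hs S E ξ * contract η := by
  rw [← sub_eq_zero]
  have hc : ∀ (ζ : Module.Dual R Γ) (w : Forms R (Module.Dual R Γ) N), contract ζ w n = 0 :=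
    fun ζ w => by rw [contract_apply, hvan (w (n + 1))]; ext1 x; rfl
  have hM : ∀ w, contractD hs S E ξ w n = 0 := fun w => by
    change contract ξ (boundary hs S E w) n + boundary hs S E (contract ξ w) n = 0
    rw [hc, boundary_top, add_zero]
  refine op_eq_zero_of_wedge_anticomm hs.1 _ (fun w => ?_) (fun X => ?_)
  · change contract η (contractD hs S E ξ w) n - contractD hs S E ξ (contract η w) n = 0
    rw [hc, hM, sub_zero]
  · have h1 := wedgeOp_contractD hs S E δ hδ hvan ξ X
    have h3 : (wedgeOp X * contract η : AddMonoid.End (Forms R (Module.Dual R Γ) N)) =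
        scale (η X) - contract η * wedgeOp X := by
      rw [contract_wedgeOp]; abel
    have h4 := contractD_scale hs S E δ hδ hvan ξ (η X)
    have h5 := contract_contract (R := R) (N := N) η (S.adDual X ξ - S.d₀ (ξ X))
    simp only [mul_sub, sub_mul, ← mul_assoc, h1, h3, add_mul]
    simp only [mul_sub, mul_add, sub_mul, add_mul, mul_assoc, h1, h3, h4, h5]
    abel

theorem SkewAlgebroid.d₀_neg (f : R) : S.d₀ (-f) = - S.d₀ f := by
  ext X; simp [SkewAlgebroid.d₀]

variable (Λ : Bivector R Γ) (E' : (S.dualOf Λ).Connection N)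

-- The Cartan formula of the derived bracket; it combines `[ι_ξ, Λ] = Λ♯ξ ∧` with `Λ♯ξ∧∂ + ∂Λ♯ξ∧ =
-- L_{Λ♯ξ}`.
include hδ in
theorem contract_derivedBracket (ξ : Module.Dual R Γ) :
    contract ξ * (Λ.wedgeOp * boundary hs S E - boundary hs S E * Λ.wedgeOp) =
      lieOp (S.adDual (Λ.sharp ξ)) (δ (Λ.sharp ξ)) +
        (Λ.wedgeOp * contractD hs S E ξ - contractD hs S E ξ * Λ.wedgeOp) -
      (Λ.wedgeOp * boundary hs S E - boundary hs S E * Λ.wedgeOp) * contract ξ := by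
  have h1 := Λ.contract_wedgeOp (N := N) ξ
  have h2 := wedgeOp_boundary hs S E δ hδ (Λ.sharp ξ)
  have h1' : ∀ T : AddMonoid.End (Forms R (Module.Dual R Γ) N),
      contract ξ * (Λ.wedgeOp * T) = Λ.wedgeOp * (contract ξ * T) +
        wedgeOp (Λ.sharp ξ) * T := fun T => by
    rw [← mul_assoc, h1, add_mul, mul_assoc]
  simp only [contractD, mul_sub, mul_add, sub_mul, add_mul, mul_assoc, h1, h1', h2]
  abel

-- The commutators with `ι_η` agree: `L_{Λ♯ξ} η = [ξ, η]_Λ + ι_{Λ♯η} dξ`, and the last term is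
-- cancelled by the commutator of `Λ` with `contractD`. Degree zero is the hypothesis `h0`.
include hδ in
theorem lieOp_dualOf (hvan : ∀ b : Module.Dual R Γ [⋀^Fin (n + 1)]→ₗ[R] N, b = 0)
    (h0 : ∀ ξ (w : Forms R (Module.Dual R Γ) N) x, E'.act ξ (w 0 x) =
      δ (Λ.sharp ξ) (w 0 x) - contractD hs S E ξ (Λ.wedgeOp w) 0 x) (ξ : Module.Dual R Γ) :
    lieOp ((S.dualOf Λ).ad ξ) (E'.act ξ) = lieOp (S.adDual (Λ.sharp ξ)) (δ (Λ.sharp ξ)) +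
        (Λ.wedgeOp * contractD hs S E ξ - contractD hs S E ξ * Λ.wedgeOp) := by
  rw [← sub_eq_zero]
  refine op_eq_zero_of_comm _ (fun w => ?_) (fun η => ?_)
  · ext x
    change lieOp ((S.dualOf Λ).ad ξ) (E'.act ξ) w 0 x -
      (lieOp (S.adDual (Λ.sharp ξ)) (δ (Λ.sharp ξ)) w 0 x +
        ((0 : N) - contractD hs S E ξ (Λ.wedgeOp w) 0 x)) = 0
    rw [lieOp_zero_apply, lieOp_zero_apply, h0]
    abel
  · have h1 : contract η * lieOp ((S.dualOf Λ).ad ξ) (E'.act ξ) =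
        lieOp ((S.dualOf Λ).ad ξ) (E'.act ξ) * contract η - contract (Λ.bracketAux S ξ η) :=
      lieOp_contract _ _ _
    have h2 := lieOp_contract (S.adDual (Λ.sharp ξ)) (δ (Λ.sharp ξ)) η
    have h3 := contractD_contract hs S E δ hδ hvan ξ η
    have h4 := Λ.contract_wedgeOp (N := N) η
    have h5 := wedgeOp_contractD hs S E δ hδ hvan ξ (Λ.sharp η)
    have h6 : S.adDual (Λ.sharp ξ) η = Λ.bracketAux S ξ η +
        (S.adDual (Λ.sharp η) ξ - S.d₀ (ξ (Λ.sharp η))) := by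
      have : ξ (Λ.sharp η) = - Λ.toFun ξ η := Λ.toFun_skew η ξ
      rw [this, S.d₀_neg, Bivector.bracketAux]; abel
    rw [h6, contract_add] at h2
    simp only [mul_sub, mul_add, sub_mul, add_mul, ← mul_assoc, h1, h2, h3, h4]
    simp only [mul_sub, mul_add, sub_mul, add_mul, mul_assoc, h1, h2, h3, h4, h5]
    abel

include hδ in
/-- The differential of `A*` is the commutator of `Λ` with `∂`. -/
theorem dOp_dualOf (hvan : ∀ b : Module.Dual R Γ [⋀^Fin (n + 1)]→ₗ[R] N, b = 0)
    (h0 : ∀ ξ (w : Forms R (Module.Dual R Γ) N) x, E'.act ξ (w 0 x) =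
      δ (Λ.sharp ξ) (w 0 x) - contractD hs S E ξ (Λ.wedgeOp w) 0 x) :
    (S.dualOf Λ).dOp E' = Λ.wedgeOp * boundary hs S E - boundary hs S E * Λ.wedgeOp := by
  rw [← sub_eq_zero]
  refine op_eq_zero_of_anticomm _ (fun w => ?_) (fun ξ => ?_)
  · change (S.dualOf Λ).dOp E' w 0 - (Λ.wedgeOp (boundary hs S E w) 0 -
      boundary hs S E (Λ.wedgeOp w) 0) = 0
    rw [boundary_zero_apply hs S E _ (Λ.wedgeOp_one_apply w)]
    simp [SkewAlgebroid.dOp_zero_apply, Bivector.wedgeOp_zero_apply]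
  · rw [mul_sub, sub_mul, contract_derivedBracket hs S E δ hδ Λ, SkewAlgebroid.contract_dOp,
      lieOp_dualOf hs S E δ hδ Λ E' hvan h0]
    abel

include hδ in
theorem dirac_dirac (hvan : ∀ b : Module.Dual R Γ [⋀^Fin (n + 1)]→ₗ[R] N, b = 0)
    (h0 : ∀ ξ (w : Forms R (Module.Dual R Γ) N) x, E'.act ξ (w 0 x) =
      δ (Λ.sharp ξ) (w 0 x) - contractD hs S E ξ (Λ.wedgeOp w) 0 x)
    (hE : S.dOp E * S.dOp E = 0) (hE' : (S.dualOf Λ).dOp E' * (S.dualOf Λ).dOp E' = 0)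
    (a : Forms R (Module.Dual R Γ) N) :
    dirac S (S.dualOf Λ) hs E E' (dirac S (S.dualOf Λ) hs E E' a) = 0 := by
  have hb := boundary_boundary hs S E hE
  have hd := dOp_dualOf hs S E δ hδ Λ E' hvan h0
  have key : ((S.dualOf Λ).dOp E' + boundary hs S E) * ((S.dualOf Λ).dOp E' + boundary hs S E) =
      0 := by
    rw [mul_add, add_mul, add_mul, hE', hb, hd, mul_sub, sub_mul, mul_assoc Λ.wedgeOp, hb,
      ← mul_assoc (boundary hs S E) (boundary hs S E), hb, mul_assoc]
    simp
  rw [dirac_apply, dirac_apply]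
  exact DFunLike.congr_fun key a

end DerivedBracket

/-! ### The Jacobi identity on `A*`. -/

section Jacobi
variable {R : Type*} [CommRing R] [Algebra ℝ R] {Γ : Type*} [AddCommGroup Γ] [Module R Γ]

/-- The failure of `Λ♯` to preserve brackets. -/
def sharpDefect (S : SkewAlgebroid R Γ) (Λ : Bivector R Γ) (ξ η : Module.Dual R Γ) : Γ :=
  S.bracket (Λ.sharp ξ) (Λ.sharp η) - Λ.sharp (Λ.bracketAux S ξ η)

/-- Thus `½[Λ,Λ]` is the obstruction to `Λ♯` preserving brackets, and the cyclic symmetry of the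
left side becomes a symmetry of the defect. -/
theorem schouten_self (S : SkewAlgebroid R Γ) (Λ : Bivector R Γ) (α β γ : Module.Dual R Γ) :
    schouten S Λ Λ α β γ = 2 * γ (sharpDefect S Λ α β) := by
  have h1 : γ (Λ.sharp (Λ.bracketAux S α β)) = - Λ.bracketAux S α β (Λ.sharp γ) :=
    Λ.toFun_skew _ γ
  have h2 : γ (Λ.sharp α) = - α (Λ.sharp γ) := Λ.toFun_skew α γ
  have h3 : β (Λ.sharp α) = - α (Λ.sharp β) := Λ.toFun_skew α β
  have h4 := congrArg γ (S.bracket_skew (Λ.sharp β) (Λ.sharp α))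
  have h5 := congrArg α (S.bracket_skew (Λ.sharp γ) (Λ.sharp β))
  rw [map_neg] at h4 h5
  simp only [schouten, sharpDefect, map_sub, h1, Bivector.bracketAux_apply, adDual_apply, h2, h3,
    h4, h5, map_neg]
  ring

theorem two_mul_cancel {a b : R} (h : 2 * a = 2 * b) : a = b := by
  have h2 : algebraMap ℝ R 2⁻¹ * 2 = 1 := by
    rw [← map_ofNat (algebraMap ℝ R) 2, ← map_mul]; norm_num
  calc a = algebraMap ℝ R 2⁻¹ * (2 * a) := by rw [← mul_assoc, h2, one_mul]
    _ = b := by rw [h, ← mul_assoc, h2, one_mul]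

theorem schouten_cyclic (S : SkewAlgebroid R Γ) (Λ : Bivector R Γ) (α β γ : Module.Dual R Γ) :
    schouten S Λ Λ α β γ = schouten S Λ Λ β γ α := by
  simp only [schouten]; ring

theorem sharpDefect_cyclic (S : SkewAlgebroid R Γ) (Λ : Bivector R Γ) (α β γ : Module.Dual R Γ) :
    γ (sharpDefect S Λ α β) = α (sharpDefect S Λ β γ) :=
  two_mul_cancel (by rw [← schouten_self, ← schouten_self, schouten_cyclic])

theorem sharpDefect_skew (S : SkewAlgebroid R Γ) (Λ : Bivector R Γ) (α β : Module.Dual R Γ) :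
    sharpDefect S Λ α β = - sharpDefect S Λ β α := by
  have h : Λ.bracketAux S α β = - Λ.bracketAux S β α := (S.dualOf Λ).bracket_skew α β
  rw [sharpDefect, sharpDefect, h, S.bracket_skew, map_neg]; abel

/-- Let `N` be the defect and `T = ½[Λ,Λ]`. Then `T(L_Xα, β, γ) = a(X)(T(α, β, γ)) - α([X, N(β,
γ)])`, and cyclically. Invariance subtracts one `a(X)(T(α, β, γ))` from three, which leaves two. -/
theorem sharpDefect_invariant (S : SkewAlgebroid R Γ) (Λ : Bivector R Γ)
    (hΛ : ∀ X, bracketSection S (schouten S Λ Λ) X = 0) (α β γ : Module.Dual R Γ) (X : Γ) :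
    2 * S.anchor X (γ (sharpDefect S Λ α β)) = α (S.bracket X (sharpDefect S Λ β γ)) +
      β (S.bracket X (sharpDefect S Λ γ α)) + γ (S.bracket X (sharpDefect S Λ α β)) := by
  have h := congrFun (congrFun (congrFun (hΛ X) α) β) γ
  simp only [bracketSection, Pi.zero_apply] at h
  rw [schouten_cyclic S Λ (S.adDual X α) β γ, schouten_cyclic S Λ α (S.adDual X β) γ,
    schouten_cyclic S Λ (S.adDual X β) γ α] at h
  have c1 := congrArg (S.anchor X) (sharpDefect_cyclic S Λ α β γ)
  have c2 := congrArg (S.anchor X) (sharpDefect_cyclic S Λ β γ α)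
  have e : S.anchor X (2 * γ (sharpDefect S Λ α β)) = 2 * S.anchor X (γ (sharpDefect S Λ α β)) := by
    rw [two_mul, map_add, two_mul]
  simp only [schouten_self, adDual_apply, e] at h
  refine two_mul_cancel ?_
  -- Here `c1` and `c2` bring the three anchor terms into the same cyclic order.
  linear_combination h + 4 * c1 + 2 * c2

/-- Paired with `X`, the Jacobiator reduces by the Jacobi identity of `A` to terms in the defect of
`Λ♯`. These combine into the invariance of `[Λ,Λ]`, up to anchors of the defect, which vanish by
`hN`. -/
theorem bracketAux_jacobi (S : LieAlgebroid R Γ) (Λ : Bivector R Γ)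
    (hΛ : ∀ X, bracketSection S.toSkewAlgebroid (schouten S.toSkewAlgebroid Λ Λ) X = 0)
    (hN : ∀ ξ η, S.anchor (sharpDefect S.toSkewAlgebroid Λ ξ η) = 0)
    (ξ η ζ : Module.Dual R Γ) :
    Λ.bracketAux S.toSkewAlgebroid ξ (Λ.bracketAux S.toSkewAlgebroid η ζ) =
      Λ.bracketAux S.toSkewAlgebroid (Λ.bracketAux S.toSkewAlgebroid ξ η) ζ +
      Λ.bracketAux S.toSkewAlgebroid η (Λ.bracketAux S.toSkewAlgebroid ξ ζ) := by
  set T := S.toSkewAlgebroid with hT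
  ext X
  have hs : ∀ ξ η, Λ.sharp (Λ.bracketAux T ξ η) = T.bracket (Λ.sharp ξ) (Λ.sharp η) -
    sharpDefect T Λ ξ η := fun ξ η => by rw [sharpDefect]; abel
  have h12 : ξ (Λ.sharp η) = - η (Λ.sharp ξ) := Λ.toFun_skew η ξ
  have h13 : ξ (Λ.sharp ζ) = - ζ (Λ.sharp ξ) := Λ.toFun_skew ζ ξ
  have h23 : η (Λ.sharp ζ) = - ζ (Λ.sharp η) := Λ.toFun_skew ζ η
  have hinv := sharpDefect_invariant T Λ hΛ ξ η ζ X
  have ha : ∀ U W : Γ, T.anchor (T.bracket U W) = ⁅T.anchor U, T.anchor W⁆ := S.anchor_bracket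
  have c1 := sharpDefect_cyclic T Λ ξ η ζ
  have c2 := sharpDefect_cyclic T Λ η ζ ξ
  have j1 := congrArg ξ (S.jacobi (Λ.sharp η) (Λ.sharp ζ) X)
  have j2 := congrArg η (S.jacobi (Λ.sharp ξ) (Λ.sharp ζ) X)
  have j3 := congrArg ζ (S.jacobi (Λ.sharp ξ) (Λ.sharp η) X)
  have k1 := T.bracket_skew (Λ.sharp η) (Λ.sharp ξ)
  have k2 := T.bracket_skew (Λ.sharp ζ) (Λ.sharp ξ)
  have k3 := T.bracket_skew (Λ.sharp ζ) (Λ.sharp η)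
  have n1 := T.bracket_skew (sharpDefect T Λ η ζ) X
  have n2 := T.bracket_skew (sharpDefect T Λ ξ ζ) X
  have n3 := T.bracket_skew (sharpDefect T Λ ξ η) X
  have n4 := sharpDefect_skew T Λ ζ ξ
  rw [← hT] at j1 j2 j3
  rw [map_add] at j1 j2 j3
  simp only [n4, map_neg] at hinv c1 c2
  have hX := congrArg (T.anchor X) c1
  have hX2 := congrArg (T.anchor X) c2
  have o1 : Λ.bracketAux T η ζ (Λ.sharp ξ) = - ξ (Λ.sharp (Λ.bracketAux T η ζ)) :=
    Λ.toFun_skew ξ _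
  simp only [LinearMap.add_apply, Bivector.bracketAux_apply, hs, map_sub, hN, ha,
    AddMonoidHom.sub_apply, Derivation.sub_apply, Derivation.zero_apply,
    Derivation.commutator_apply, h12, h13, h23, k1, k2, k3, n1, n2, n3, map_neg, map_add,
    AddMonoidHom.neg_apply] at *
  have o2 := congrArg (T.anchor X) o1
  simp only [map_sub, map_neg] at o2
  linear_combination -j1 + j2 - j3 - hinv - o2 + hX

/-- Since `a(N)f = ⟨df, N⟩`, cyclic symmetry turns the claim into `ι_{df}[Λ,Λ] = 0`. -/
theorem anchor_sharpDefect (S : SkewAlgebroid R Γ) (Λ : Bivector R Γ)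
    (hT : ∀ f β γ, schouten S Λ Λ (S.d₀ f) β γ = 0) (ξ η : Module.Dual R Γ) :
    S.anchor (sharpDefect S Λ ξ η) = 0 := by
  ext f
  have h : S.d₀ f (sharpDefect S Λ ξ η) = 0 := by
    refine two_mul_cancel ?_
    rw [← schouten_self, ← schouten_cyclic, hT, mul_zero]
  exact h

/-- The Lie algebroid structure on `A*` of an exact Lie bialgebroid. -/
def LieAlgebroid.exactDual (S : LieAlgebroid R Γ) (Λ : Bivector R Γ)
    (hΛ : ∀ X, bracketSection S.toSkewAlgebroid (schouten S.toSkewAlgebroid Λ Λ) X = 0)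
    (hT : ∀ f β γ, schouten S.toSkewAlgebroid Λ Λ (S.d₀ f) β γ = 0) :
    LieAlgebroid R (Module.Dual R Γ) where
  toSkewAlgebroid := S.toSkewAlgebroid.dualOf Λ
  jacobi := bracketAux_jacobi S Λ hΛ (anchor_sharpDefect _ Λ hT)
  anchor_bracket ξ η := by
    have h : S.anchor (sharpDefect S.toSkewAlgebroid Λ ξ η) = 0 := anchor_sharpDefect _ Λ hT ξ η
    rw [sharpDefect, map_sub, S.anchor_bracket, sub_eq_zero] at h
    exact h.symm

end Jacobi

/-! ### Frames over the set where a function does not vanish. -/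

section Frames
variable {R : Type*} [CommRing R] {V : Type*} [AddCommGroup V] [Module R V]
  {Q : Type*} [AddCommGroup Q] [Module R Q]

/-- `e` and `ε` are dual frames of `V` where `r` does not vanish. -/
structure IsFrame (r : R) {n : ℕ} (e : Fin n → V) (ε : Fin n → Module.Dual R V) : Prop where
  span : ∀ X, r • X = r • ∑ i, ε i X • e i
  dual : ∀ i j, r * ε i (e j) = if i = j then r else 0

theorem IsFrame.mul {r : R} {n : ℕ} {e : Fin n → V} {ε : Fin n → Module.Dual R V}
    (h : IsFrame r e ε) (s : R) : IsFrame (s * r) e ε where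
  span X := by rw [mul_smul, h.span, mul_smul]
  dual i j := by rw [mul_assoc, h.dual]; simp

theorem IsFrame.span_dual {r : R} {n : ℕ} {e : Fin n → V} {ε : Fin n → Module.Dual R V}
    (h : IsFrame r e ε) (ξ : Module.Dual R V) : r • ξ = r • ∑ i, ξ (e i) • ε i := by
  ext X
  have := congrArg ξ (h.span X)
  simp only [map_smul, map_sum] at this
  rw [LinearMap.smul_apply, LinearMap.smul_apply, this]
  simp [mul_comm]

theorem IsFrame.toDual {r : R} {n : ℕ} {e : Fin n → V} {ε : Fin n → Module.Dual R V}
    (h : IsFrame r e ε) : IsFrame r ε (fun i => Module.Dual.eval R V (e i)) where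
  span := h.span_dual
  dual i j := by
    rw [Module.Dual.eval_apply, h.dual]; simp [eq_comm]

/-- A single factor `r` serves all arguments: it is moved into one slot, used there, and moved out
again before the next. -/
theorem smul_map_congr {k : ℕ} (f : V [⋀^Fin k]→ₗ[R] Q) (r : R) {v w : Fin k → V}
    (h : ∀ l, r • v l = r • w l) : r • f v = r • f w := by
  classical
  have key : ∀ s : Finset (Fin k), r • f (s.piecewise w v) = r • f v := by
    intro s
    induction s using Finset.induction_on with
    | empty => simp
    | insert l s hl ih =>
      rw [Finset.piecewise_insert, ← f.map_update_smul, ← h l, f.map_update_smul, ← ih]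
      congr 2
      have : s.piecewise w v l = v l := Finset.piecewise_eq_of_notMem _ _ _ hl
      rw [← this, Function.update_eq_self]
  simpa using (key Finset.univ).symm

/-- The linear map `Rⁿ → V` given by a frame. -/
def frameMap {n : ℕ} (e : Fin n → V) : (Fin n → R) →ₗ[R] V := Fintype.linearCombination R e

theorem frameMap_single {n : ℕ} (e : Fin n → V) (i : Fin n) :
    frameMap e (Pi.basisFun R (Fin n) i) = e i := by
  simp [frameMap]

theorem IsFrame.smul_map {r : R} {n k : ℕ} {e : Fin n → V} {ε : Fin n → Module.Dual R V}
    (h : IsFrame r e ε) (f : V [⋀^Fin k]→ₗ[R] Q) (v : Fin k → V) :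
    r • f v = r • f.compLinearMap (frameMap e) (fun l i => ε i (v l)) := by
  rw [AlternatingMap.compLinearMap_apply]
  refine smul_map_congr f r fun l => ?_
  rw [h.span]
  simp [frameMap, Fintype.linearCombination_apply]

theorem IsFrame.smul_eq_zero {r : R} {n k : ℕ} {e : Fin n → V} {ε : Fin n → Module.Dual R V}
    (h : IsFrame r e ε) (hk : n < k) (f : V [⋀^Fin k]→ₗ[R] Q) : r • f = 0 := by
  ext v
  rw [AlternatingMap.smul_apply, h.smul_map]
  have : f.compLinearMap (frameMap e) = 0 :=
    (Pi.basisFun R (Fin n)).ext_alternating fun w hw => by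
      have := Fintype.card_le_of_injective w hw
      simp at this
      omega
  rw [this]; simp

/-- After pulling back to `Rⁿ`, a form of degree `n` is fixed by its value on the basis, because
injective self-maps of the index set are permutations. -/
theorem IsFrame.smul_congr {r : R} {n : ℕ} {e : Fin n → V} {ε : Fin n → Module.Dual R V}
    (h : IsFrame r e ε) {f g : V [⋀^Fin n]→ₗ[R] Q} (hfg : r • f e = r • g e) : r • f = r • g := by
  have : (r • f).compLinearMap (frameMap e) = (r • g).compLinearMap (frameMap e) :=
    (Pi.basisFun R (Fin n)).ext_alternating fun w hw => by
      let σ : Equiv.Perm (Fin n) := Equiv.ofBijective w (Finite.injective_iff_bijective.mp hw)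
      have e1 : ∀ f : V [⋀^Fin n]→ₗ[R] Q,
          (r • f).compLinearMap (frameMap e) (fun i => Pi.basisFun R (Fin n) (w i)) =
          Equiv.Perm.sign σ • (r • f e) := fun f => by
        rw [AlternatingMap.compLinearMap_apply, ← AlternatingMap.smul_apply,
          ← (r • f).map_perm]
        simp only [frameMap_single]
        rfl
      rw [e1, e1, hfg]
  ext v
  have h1 := h.smul_map f v
  have h2 := h.smul_map g v
  have h3 := DFunLike.congr_fun this (fun l i => ε i (v l))
  rw [AlternatingMap.smul_apply, AlternatingMap.smul_apply, h1, h2]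
  simpa using h3

/-- Top-degree forms make up a line: each side is a top-degree form in `v` and in `w` separately, so
it is enough to compare on the frame. -/
theorem IsFrame.top_smul_comm {r : R} {n : ℕ} {e : Fin n → V} {ε : Fin n → Module.Dual R V}
    (h : IsFrame r e ε) (P : V [⋀^Fin n]→ₗ[R] R) (P' : V [⋀^Fin n]→ₗ[R] Q) (v w : Fin n → V) :
    r • P v • P' w = r • P w • P' v := by
  have key : ∀ v, r • P v • P' e = r • P e • P' v := fun v => by
    have := h.smul_congr (f := (LinearMap.toSpanSingleton R Q (P' e)).compAlternatingMap P)
      (g := P e • P') (by simp)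
    simpa using DFunLike.congr_fun this v
  have := h.smul_congr (f := P v • P')
      (g := (LinearMap.toSpanSingleton R Q (P' v)).compAlternatingMap P) (by simpa using key v)
  simpa using DFunLike.congr_fun this w

/-- The top multivector `e₁ ∧ … ∧ eₙ`, as a form on the dual module. -/
def topForm {n : ℕ} (ε : Fin n → Module.Dual R V) : V [⋀^Fin n]→ₗ[R] R :=
  Matrix.detRowAlternating.compLinearMap (LinearMap.pi ε)

theorem IsFrame.topForm_apply {r : R} {n : ℕ} {e : Fin n → V} {ε : Fin n → Module.Dual R V}
    (h : IsFrame r e ε) : r * topForm ε e = r := by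
  have := smul_map_congr (Matrix.detRowAlternating (R := R) (n := Fin n)) r
    (v := fun j i => ε i (e j)) (w := (1 : Matrix (Fin n) (Fin n) R)) (fun l => by
      ext i
      simp only [Pi.smul_apply, smul_eq_mul, h.dual, Matrix.one_apply]
      by_cases hil : i = l
      · simp [hil]
      · simp [hil, Ne.symm hil])
  refine (this : r * topForm ε e = _).trans ?_
  change r * Matrix.det 1 = r
  simp

end Frames

/-! ### Traces on top-degree forms. -/

section Trace
variable {R : Type*} [CommRing R] [Algebra ℝ R] {V : Type*} [AddCommGroup V] [Module R V]
  {Q : Type*} [AddCommGroup Q] [Module R Q]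

/-- A linear map as an operator over the zero derivation. -/
def DerivOp.ofLinear (K : V →ₗ[R] V) : DerivOp (0 : Derivation ℝ R R) V where
  toFun := K.toAddMonoidHom
  leibniz f x := by simp

/-- On the frame only the diagonal coefficient of `K` survives in each slot, because repeated
vectors give zero. -/
theorem IsFrame.smul_trace {r : R} {n : ℕ} {e : Fin n → V} {ε : Fin n → Module.Dual R V}
    (h : IsFrame r e ε) (K : V →ₗ[R] V) (f : V [⋀^Fin n]→ₗ[R] Q) (v : Fin n → V) :
    r • ∑ l, f (Function.update v l (K (v l))) = r • (∑ i, ε i (K (e i))) • f v := by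
  -- Over the zero derivation `alt` is minus the sum over the slots, which makes that sum an
  -- alternating form at no cost.
  have key := h.smul_congr (f := - (DerivOp.ofLinear K).alt (DerivOp.ofLinear (0 : Q →ₗ[R] Q)) n f)
    (g := (∑ i, ε i (K (e i))) • f) (by
      have e1 : (-(DerivOp.ofLinear K).alt (DerivOp.ofLinear (0 : Q →ₗ[R] Q)) n f) e =
          ∑ l, f (Function.update e l (K (e l))) := by
        rw [AlternatingMap.neg_apply, DerivOp.alt_apply]
        simp [DerivOp.ofLinear]
      rw [e1, AlternatingMap.smul_apply, Finset.sum_smul, Finset.smul_sum, Finset.smul_sum]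
      refine Finset.sum_congr rfl fun l _ => ?_
      rw [← f.map_update_smul, h.span, f.map_update_smul, f.map_update_sum]
      congr 1
      rw [Finset.sum_eq_single l]
      · rw [f.map_update_smul, Function.update_eq_self]
      · intro i _ hi
        rw [f.map_update_smul, f.map_update_self _ hi.symm, smul_zero]
      · simp)
  have := DFunLike.congr_fun key v
  rw [AlternatingMap.smul_apply, AlternatingMap.smul_apply, AlternatingMap.neg_apply,
    DerivOp.alt_apply] at this
  simpa [DerivOp.ofLinear] using this

/-- The trace of the rank one map `φ ⊗ x` is `φ(x)`. -/
theorem IsFrame.smul_sum_update {r : R} {n : ℕ} {e : Fin n → V} {ε : Fin n → Module.Dual R V}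
    (h : IsFrame r e ε) (φ : Module.Dual R V) (x : V) (f : V [⋀^Fin n]→ₗ[R] Q) (v : Fin n → V) :
    r • ∑ l, φ (v l) • f (Function.update v l x) = r • φ x • f v := by
  have := h.smul_trace (φ.smulRight x) f v
  have e1 : r * ∑ i, ε i (φ.smulRight x (e i)) = r * φ x := by
    have := congrArg φ (h.span x)
    simp only [map_smul, map_sum, smul_eq_mul] at this
    rw [this]
    simp [mul_comm]
  simp only [LinearMap.smulRight_apply, f.map_update_smul] at this
  rw [this, smul_smul, smul_smul]
  simp only [LinearMap.smulRight_apply] at e1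
  rw [e1]

end Trace

/-! ### Separation and gluing. -/

section Gluing
variable {R : Type*} [CommRing R] {I : Type*} (r : I → R)

/-- Elements of `P` are determined by their multiples with the `r i`. -/
def Separates (P : Type*) [AddCommGroup P] [Module R P] : Prop :=
  ∀ x : P, (∀ i, r i • x = 0) → x = 0

/-- Compatible families of multiples with the `r i` come from elements of `P`. -/
def Glues (P : Type*) [AddCommGroup P] [Module R P] : Prop :=
  ∀ a : I → P, (∀ i j, r i • a j = r j • a i) → ∃ b, ∀ i, r i • b = a i

variable {r} {P : Type*} [AddCommGroup P] [Module R P] {V : Type*} [AddCommGroup V] [Module R V]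

theorem Separates.eq (h : Separates r P) {x y : P} (hxy : ∀ i, r i • x = r i • y) : x = y :=
  sub_eq_zero.mp (h _ fun i => by rw [smul_sub, hxy, sub_self])

theorem Separates.linearMap (h : Separates r P) : Separates r (V →ₗ[R] P) := fun f hf => by
  ext v; exact h _ fun i => DFunLike.congr_fun (hf i) v

theorem Separates.alternating (h : Separates r P) {k : ℕ} : Separates r (V [⋀^Fin k]→ₗ[R] P) :=
  fun f hf => by
    ext v; exact h _ fun i => DFunLike.congr_fun (hf i) v

/-- Values are glued one by one; multilinearity and alternation then hold by separation. -/
theorem Glues.alternating (h : Glues r P) (hs : Separates r P) {k : ℕ} :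
    Glues r (V [⋀^Fin k]→ₗ[R] P) := fun a ha => by
  choose b hb using fun v => h (fun i => a i v) fun i j => DFunLike.congr_fun (ha i j) v
  refine ⟨{ toFun := b, map_update_add' := ?_, map_update_smul' := ?_, map_eq_zero_of_eq' := ?_ },
    fun i => by ext v; exact hb v i⟩
  · intro _ v l x y
    refine hs.eq fun i => ?_
    rw [smul_add, hb, hb, hb, (a i).map_update_add]
  · intro _ v l c x
    refine hs.eq fun i => ?_
    rw [smul_comm, hb, hb, (a i).map_update_smul]
  · intro v l l' hv hl
    refine hs _ fun i => ?_
    rw [hb, (a i).map_eq_zero_of_eq v hv hl]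

end Gluing

/-! ### Bijectivity of the star map. -/

section StarBijective
variable {R : Type*} [CommRing R] [Algebra ℝ R]
variable {Γ N : Type*} [AddCommGroup Γ] [Module R Γ] [AddCommGroup N] [Module R N]

theorem IsFrame.sum_wedgeAux_curryLeft {r : R} {n k : ℕ} {e : Fin n → Γ}
    {ε : Fin n → Module.Dual R Γ} (h : IsFrame r e ε)
    (u : Module.Dual R Γ [⋀^Fin (k + 1)]→ₗ[R] N) :
    r • ∑ i, wedgeAux (e i) (u.curryLeft (ε i)) = r • (k + 1) • u := by
  rw [← AlternatingMap.alternatizeUncurryFin_curryLeft,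
    ← AlternatingMap.alternatizeUncurryFinLM_apply]
  simp only [← wedgeAux_eq_alternatizeUncurryFin, ← AlternatingMap.alternatizeUncurryFinLM_apply]
  rw [← map_sum, ← map_smul, ← map_smul]
  congr 1
  ext1 ξ
  have := congrArg u.curryLeft (h.span_dual ξ)
  simp only [map_smul, map_sum] at this
  rw [LinearMap.smul_apply, LinearMap.smul_apply, this]
  simp

/-- As `∑ eᵢ ∧ ι_{εᵢ}` counts the degree `k`, the anticommutation relation makes `∑ ι_{εᵢ}(eᵢ ∧ ·)`
multiplication by `n - k`. Below the top degree a form is thereby recovered from its products with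
sections. -/
theorem IsFrame.sum_contract_wedgeOp {r : R} {n : ℕ} {e : Fin n → Γ}
    {ε : Fin n → Module.Dual R Γ} (h : IsFrame r e ε) (u : Forms R (Module.Dual R Γ) N) (k : ℕ) :
    r • ∑ i, contract (ε i) (wedgeOp (e i) u) k + r • k • u k = r • n • u k := by
  have h1 : ∀ i, contract (ε i) (wedgeOp (e i) u) k =
      ε i (e i) • u k - wedgeOp (e i) (contract (ε i) u) k := fun i =>
    congrFun (DFunLike.congr_fun (contract_wedgeOp (N := N) (ε i) (e i)) u) k
  have h2 : r • ∑ i, wedgeOp (e i) (contract (ε i) u) k = r • k • u k := by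
    cases k with
    | zero => simp [wedgeOp_zero_apply]
    | succ k => exact h.sum_wedgeAux_curryLeft (u (k + 1))
  simp only [h1, Finset.sum_sub_distrib, smul_sub, h2, sub_add_cancel]
  rw [← Finset.sum_smul, smul_smul, Finset.mul_sum]
  simp only [h.dual, if_true, Finset.sum_const, Finset.card_univ, Fintype.card_fin]
  rw [smul_assoc, smul_comm]

theorem nsmul_cancel {P : Type*} [AddCommGroup P] [Module R P] {k : ℕ} (hk : k ≠ 0) {x : P}
    (h : k • x = 0) : x = 0 := by
  have : (algebraMap ℝ R (k : ℝ)⁻¹ * (k : R)) • x = 0 := by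
    rw [mul_smul, Nat.cast_smul_eq_nsmul, h, smul_zero]
  rwa [← map_natCast (algebraMap ℝ R), ← map_mul, inv_mul_cancel₀ (Nat.cast_ne_zero.mpr hk),
    map_one, one_smul] at this

variable {I : Type*} {r : I → R} {n : ℕ} {e : I → Fin n → Γ} {ε : I → Fin n → Module.Dual R Γ}
  (hf : ∀ i, IsFrame (r i) (e i) (ε i)) (hN : Separates r N)

theorem alternating_eq_zero {V : Type*} [AddCommGroup V] [Module R V]
    {e : I → Fin n → V} {ε : I → Fin n → Module.Dual R V}
    (hf : ∀ i, IsFrame (r i) (e i) (ε i)) (hN : Separates r N) {k : ℕ} (hk : n < k)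
    (a : V [⋀^Fin k]→ₗ[R] N) : a = 0 :=
  hN.alternating _ fun i => (hf i).smul_eq_zero hk a

-- Induction from the top degree downwards: all products `X ∧ a` vanish one degree higher, and the
-- counting formula gives `(j + 1) a k = 0`.
include hf hN in
theorem eq_zero_of_starMap_eq_zero {j : ℕ} : ∀ (k : ℕ), k + j = n →
    ∀ a : Forms R (Module.Dual R Γ) N, starMap (Γ := Γ) n a j = 0 → a k = 0 := by
  induction j with
  | zero =>
    rintro k rfl a ha
    have := DFunLike.congr_fun ha ![]
    rwa [starMap_zero_apply] at this
  | succ j ih =>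
    intro k hk a ha
    refine hN.alternating _ fun i => ?_
    have h1 : ∀ X, wedgeOp X a (k + 1) = 0 := fun X => by
      refine ih (k + 1) (by omega) _ ?_
      have := contract_starMap n X a j
      rw [contract_apply, ha] at this
      have h2 : (-1 : ℤ) ^ j • (-1 : ℤ) ^ j • starMap n (wedgeOp X a) j =
          starMap n (wedgeOp X a) j := by
        rw [smul_smul, ← mul_pow]; simp
      rw [← h2, ← this]
      simp
    have h3 := (hf i).sum_contract_wedgeOp a k
    simp only [contract_apply, h1] at h3
    simp only [AlternatingMap.curryLeft_zero, LinearMap.zero_apply, Finset.sum_const_zero,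
      smul_zero, zero_add] at h3
    refine nsmul_cancel (R := R) (k := j + 1) (by omega) ?_
    have : n = k + (j + 1) := hk.symm
    rw [this, add_smul, smul_add] at h3
    rw [smul_comm]
    exact left_eq_add.mp h3

/-- The component of `starMap` from degree `k` to degree `j`. -/
def starComp (n k j : ℕ) : (Module.Dual R Γ [⋀^Fin k]→ₗ[R] N) →ₗ[R]
    Γ [⋀^Fin j]→ₗ[R] (Module.Dual R Γ [⋀^Fin n]→ₗ[R] N) :=
  LinearMap.proj j ∘ₗ starLin n ∘ₗ 
    LinearMap.single R (fun k => Module.Dual R Γ [⋀^Fin k]→ₗ[R] N) k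

theorem starComp_apply (n k j : ℕ) (a : Module.Dual R Γ [⋀^Fin k]→ₗ[R] N) :
    starComp n k j a = starMap (Γ := Γ) n (Pi.single k a : Forms R (Module.Dual R Γ) N) j := rfl

theorem starMap_eq_starComp {n k j : ℕ} (h : k + j = n) (a : Forms R (Module.Dual R Γ) N) :
    starMap (Γ := Γ) n a j = starComp n k j (a k) :=
  starMap_congr n _ _ fun k' hk' => by
    obtain rfl : k' = k := by omega
    simp

theorem starComp_curryLeft {n k j : ℕ} (h : k + (j + 1) = n)
    (a : Module.Dual R Γ [⋀^Fin k]→ₗ[R] N) (X : Γ) :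
    (starComp n k (j + 1) a).curryLeft X = (-1 : ℤ) ^ j • starComp n (k + 1) j (wedgeAux X a) := by
  refine (contract_starMap n X (Pi.single k a : Forms R (Module.Dual R Γ) N) j).trans ?_
  rw [starMap_eq_starComp (k := k + 1) (by omega), wedgeOp_succ_apply, Pi.single_eq_same]

include hf hN in
theorem starComp_injective {k j : ℕ} (h : k + j = n) :
    Function.Injective (starComp (R := R) (Γ := Γ) (N := N) n k j) := by
  refine (injective_iff_map_eq_zero _).mpr fun a ha => ?_
  have := eq_zero_of_starMap_eq_zero hf hN k h (Pi.single k a) ha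
  simpa using this

-- The preimage `a` has to satisfy `X ∧ a = b(X)`, where `b(X)` is, up to sign, the preimage of `ι_X
-- θ` known by induction. Contracting with a frame suggests `(j + 1) a = ∑ ι_{ε_p} b(e_p)`, and the
-- relation `X ∧ b(Y) = -Y ∧ b(X)`, inherited from `θ`, shows that this works. The local solutions
-- agree by injectivity and are glued.
include hf hN in
theorem starComp_surjective (hG : Glues r N) {j : ℕ} : ∀ (k : ℕ), k + j = n →
    Function.Surjective (starComp (R := R) (Γ := Γ) (N := N) n k j) := by
  induction j with
  | zero =>
    rintro k rfl θ
    refine ⟨θ ![], ?_⟩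
    ext1 x
    rw [starComp_apply, starMap_zero_apply, Subsingleton.elim x ![]]
    simp
  | succ j ih =>
    intro k hk θ
    let σ := LinearEquiv.ofBijective (starComp (R := R) (Γ := Γ) (N := N) n (k + 1) j)
      ⟨starComp_injective hf hN (by omega), ih (k + 1) (by omega)⟩
    let b : Γ →ₗ[R] Module.Dual R Γ [⋀^Fin (k + 1)]→ₗ[R] N :=
      σ.symm.toLinearMap ∘ₗ ((-1 : ℤ) ^ j • θ.curryLeft)
    have hb : ∀ X, starComp n (k + 1) j (b X) = (-1 : ℤ) ^ j • θ.curryLeft X := fun X =>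
      σ.apply_symm_apply _
    have hb' : ∀ X, (-1 : ℤ) ^ j • starComp n (k + 1) j (b X) = θ.curryLeft X := fun X => by
      rw [hb, smul_smul, ← mul_pow]; simp
    have hswap : ∀ X Y, wedgeAux X (b Y) = - wedgeAux Y (b X) := fun X Y => by
      rw [eq_neg_iff_add_eq_zero]
      cases j with
      -- Here the product has degree `n + 1`.
      | zero => exact alternating_eq_zero (fun i => (hf i).toDual) hN (by omega) _
      | succ j =>
        refine starComp_injective hf hN (k := k + 2) (j := j) (by omega) ?_
        have h1 : ∀ X Y, starComp n (k + 2) j (wedgeAux X (b Y)) =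
            - (θ.curryLeft Y).curryLeft X := fun X Y => by
          have e1 := starComp_curryLeft (show k + 1 + (j + 1) = n by omega) (b Y) X
          rw [hb, pow_succ, mul_neg_one, neg_smul] at e1
          have e2 : (-((-1 : ℤ) ^ j • θ.curryLeft Y)).curryLeft X =
            (-1 : ℤ) ^ j • (- (θ.curryLeft Y).curryLeft X) := by
            ext; simp
          rw [e2] at e1
          have e3 : ∀ z : Γ [⋀^Fin j]→ₗ[R] (Module.Dual R Γ [⋀^Fin n]→ₗ[R] N),
              (-1 : ℤ) ^ j • (-1 : ℤ) ^ j • z = z := fun z => by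
            rw [smul_smul, ← mul_pow]; simp
          rw [← e3 (starComp n (k + 2) j (wedgeAux X (b Y))), ← e1, e3]
        rw [map_add, h1, h1, map_zero]
        have h2 := θ.curryLeft_same
        have h3 := h2 (X + Y)
        simp only [map_add, AlternatingMap.curryLeft_add, LinearMap.add_apply, h2,
          zero_add, add_zero] at h3
        rw [← neg_add, h3, neg_zero]
    choose a ha using fun i => (show ∃ a : Module.Dual R Γ [⋀^Fin k]→ₗ[R] N,
        r i • starComp n k (j + 1) a = r i • θ from by
      refine ⟨algebraMap ℝ R ((j + 1 : ℕ) : ℝ)⁻¹ • ∑ p, (b (e i p)).curryLeft (ε i p), ?_⟩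
      set a₀ := ∑ p, (b (e i p)).curryLeft (ε i p) with ha₀
      -- Since `X ∧ ι_ε b(e) = ε(X) b(e) + ι_ε(e ∧ b(X))`, the sum over the frame is `b(X) + (n - k
      -- - 1) b(X)`, with `n - k - 1 = j`.
      have key : ∀ X, r i • wedgeAux X a₀ = r i • (j + 1) • b X := fun X => by
        have h1 : ∀ p, wedgeAux X ((b (e i p)).curryLeft (ε i p)) =
            ε i p X • b (e i p) + (wedgeAux (e i p) (b X)).curryLeft (ε i p) := fun p => by
          have := congrFun (DFunLike.congr_fun (contract_wedgeOp (N := N) (ε i p) X)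
            (Pi.single (k + 1) (b (e i p)))) (k + 1)
          change (wedgeAux X ((Pi.single (k + 1) (b (e i p)) : Forms R (Module.Dual R Γ) N)
            (k + 1))).curryLeft (ε i p) = ε i p X • (Pi.single (k + 1) (b (e i p)) :
            Forms R (Module.Dual R Γ) N) (k + 1) - wedgeAux X (((Pi.single (k + 1) (b (e i p)) :
            Forms R (Module.Dual R Γ) N) (k + 1)).curryLeft (ε i p)) at this
          rw [Pi.single_eq_same, hswap] at this
          have e4 : (-wedgeAux (e i p) (b X)).curryLeft (ε i p) =
            - (wedgeAux (e i p) (b X)).curryLeft (ε i p) := by ext; simp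
          rw [e4] at this
          rw [eq_sub_iff_add_eq] at this
          rw [← this]; abel
        have h2 := (hf i).sum_contract_wedgeOp (Pi.single (k + 1) (b X) :
          Forms R (Module.Dual R Γ) N) (k + 1)
        simp only [contract_apply, wedgeOp_succ_apply, Pi.single_eq_same] at h2
        have h3 := congrArg b ((hf i).span X)
        simp only [map_smul, map_sum] at h3
        rw [ha₀, map_sum]
        simp only [h1, Finset.sum_add_distrib, smul_add]
        rw [← h3]
        have e5 : n = (k + 1) + j := by omega
        have e6 : r i • n • b X = r i • (k + 1) • b X + r i • j • b X := by
          rw [← smul_add, ← add_smul, ← e5]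
        rw [e6, add_comm (r i • (k + 1) • b X)] at h2
        rw [add_right_cancel h2, ← smul_add, add_smul, one_smul, add_comm (b X)]
      have key2 : ∀ X, r i • wedgeAux X (algebraMap ℝ R ((j + 1 : ℕ) : ℝ)⁻¹ • a₀) =
          r i • b X := fun X => by
        have e7 : algebraMap ℝ R ((j + 1 : ℕ) : ℝ)⁻¹ • (j + 1) • b X = b X := by
          rw [← Nat.cast_smul_eq_nsmul R, smul_smul,
            ← map_natCast (algebraMap ℝ R), ← map_mul,
            inv_mul_cancel₀ (Nat.cast_ne_zero.mpr (by omega)), map_one, one_smul]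
        rw [map_smul, smul_comm, key, smul_comm, e7]
      set a₁ := algebraMap ℝ R ((j + 1 : ℕ) : ℝ)⁻¹ • a₀
      ext1 x
      have h4 : r i • starComp n (k + 1) j (wedgeAux (x 0) a₁) =
          r i • starComp n (k + 1) j (b (x 0)) := by
        rw [← map_smul (starComp n (k + 1) j), ← map_smul (starComp n (k + 1) j), key2]
      have h5 := congrArg ((-1 : ℤ) ^ j • ·) h4
      simp only [smul_comm _ (r i), hb'] at h5
      rw [← starComp_curryLeft (by omega)] at h5
      have h6 := DFunLike.congr_fun h5 (Fin.tail x)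
      simp only [AlternatingMap.smul_apply, AlternatingMap.curryLeft_apply_apply] at h6
      rw [show Matrix.vecCons (x 0) (Fin.tail x) = x from Fin.cons_self_tail x] at h6
      exact h6)
    obtain ⟨c, hc⟩ := hG.alternating hN (fun i => r i • a i) fun i l =>
      starComp_injective hf hN hk (by
        simp only [map_smul]
        rw [ha, ha, smul_comm])
    refine ⟨c, hN.alternating.alternating.eq fun i => ?_⟩
    rw [← map_smul, hc, map_smul, ha]

include hf hN in
theorem starMap_bijective (hG : Glues r N) :
    Function.Bijective (starMap (R := R) (Γ := Γ) (N := N) n) := by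
  constructor
  · have : Function.Injective (starLin (R := R) (Γ := Γ) (N := N) n) := by
      refine (injective_iff_map_eq_zero _).mpr fun a ha => ?_
      funext k
      rcases le_or_gt k n with hk | hk
      · exact eq_zero_of_starMap_eq_zero hf hN (j := n - k) k (by omega) a (congrFun ha _)
      · exact alternating_eq_zero (fun i => (hf i).toDual) hN hk _
    exact this
  · intro θ
    choose σ hσ using fun k : Fin (n + 1) => starComp_surjective hf hN hG (j := n - k) k
      (by omega) (θ (n - k))
    -- There are no nonzero forms above degree `n`, so `0` is the only choice there.
    refine ⟨fun k => if hk : k < n + 1 then σ ⟨k, hk⟩ else 0, ?_⟩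
    funext j
    rcases le_or_gt j n with hj | hj
    · rw [starMap_eq_starComp (k := n - j) (by omega), dif_pos (by omega)]
      have := hσ ⟨n - j, by omega⟩
      have e1 : n - (n - j) = j := by omega
      simp only at this
      rw [e1] at this
      exact this
    · rw [alternating_eq_zero hf hN.alternating hj (θ j),
        alternating_eq_zero hf hN.alternating hj (starMap n _ j)]

end StarBijective

/-! ### Square roots of derivations on a line bundle. -/

section Root
variable {R : Type*} [CommRing R] [Algebra ℝ R] {N : Type*} [AddCommGroup N] [Module R N]
  {C : Type*} [AddCommGroup C] [Module R C]

/-- `l` generates `N` where `r` does not vanish, with coordinate `c`. -/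
structure IsLineFrame (r : R) (l : N) (c : Module.Dual R N) : Prop where
  span : ∀ x, r • x = r • c x • l
  dual : r * c l = r

theorem IsLineFrame.mul {r : R} {l : N} {c : Module.Dual R N} (h : IsLineFrame r l c) (s : R) :
    IsLineFrame (s * r) l c where
  span x := by rw [mul_smul, h.span, mul_smul]
  dual := by rw [mul_assoc, h.dual]

theorem IsLineFrame.tmul {r : R} {l : N} {c : Module.Dual R N} (h : IsLineFrame r l c) (x y : N) :
    r • (x ⊗ₜ[R] y) = r • (c x * c y) • (l ⊗ₜ[R] l) := by
  rw [TensorProduct.smul_tmul', h.span, TensorProduct.smul_tmul, TensorProduct.smul_tmul,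
    smul_comm, h.span]
  simp only [TensorProduct.tmul_smul, map_smul, smul_eq_mul, mul_smul]

theorem IsLineFrame.tmul_comm {r : R} {l : N} {c : Module.Dual R N} (h : IsLineFrame r l c)
    (x y : N) : r • (x ⊗ₜ[R] y) = r • (y ⊗ₜ[R] x) := by
  rw [h.tmul, h.tmul, mul_comm]

/-- Contraction of the second factor with a functional. -/
def contractSnd (c : Module.Dual R N) : N ⊗[R] N →ₗ[R] N :=
  TensorProduct.lift ((LinearMap.lsmul R N).flip.compl₂ c)

@[simp] theorem contractSnd_tmul (c : Module.Dual R N) (x y : N) :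
    contractSnd c (x ⊗ₜ y) = c y • x := rfl

theorem IsLineFrame.tensor {r : R} {l : N} {c : Module.Dual R N} (h : IsLineFrame r l c)
    (t : N ⊗[R] N) : r • t = r • c (contractSnd c t) • (l ⊗ₜ[R] l) := by
  induction t using TensorProduct.induction_on with
  | zero => simp
  | tmul x y => rw [h.tmul]; simp [mul_comm]
  | add x y hx hy => rw [smul_add, hx, hy, map_add, map_add, add_smul, smul_add]

theorem two_smul_cancel {P : Type*} [AddCommGroup P] [Module R P] {x : P} (h : x + x = 0) :
    x = 0 := by
  rw [← half_smul_add_self (R := R) x, h, smul_zero]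

theorem IsLineFrame.smul_eq_zero_of_tmul {r : R} {l : N} {c : Module.Dual R N}
    (h : IsLineFrame r l c) {z : N} (hz : r • (z ⊗ₜ[R] l) = 0) : r • z = 0 := by
  have := congrArg (contractSnd c) hz
  rw [map_smul, contractSnd_tmul, smul_smul, h.dual, map_zero] at this
  exact this

/-- On the generator, `2 ε(l) ⊗ l = 0` forces `ε(l) = 0` locally, and then `x ⊗ ε(l)` drops out for
every `x`. Additivity of `ε` is not needed, so differences of arbitrary roots qualify. -/
theorem IsLineFrame.smul_eq_zero_of_root {r : R} {l : N} {c : Module.Dual R N}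
    (h : IsLineFrame r l c) {ε : N → N}
    (hε : ∀ x y, r • (ε x ⊗ₜ[R] y + x ⊗ₜ[R] ε y) = 0) (x : N) : r • ε x = 0 := by
  have h1 : r • ε l = 0 := by
    refine two_smul_cancel (R := R) ?_
    rw [← smul_add]
    have := hε l l
    rw [smul_add, h.tmul_comm l, ← smul_add, ← TensorProduct.add_tmul] at this
    exact h.smul_eq_zero_of_tmul this
  have := hε x l
  rw [smul_add, TensorProduct.smul_tmul' r x, TensorProduct.smul_tmul, h1, TensorProduct.tmul_zero,
    add_zero] at this
  exact h.smul_eq_zero_of_tmul this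

variable {D : Derivation ℝ R R}

/-- Differentiating `τx = τy` brings in `(Dτ)x` and `(Dτ)y`, which agree after one more factor `τ`.
This is why `τ²` is used for localization. -/
theorem DerivOp.sq_smul_congr {P : Type*} [AddCommGroup P] [Module R P] (δ : DerivOp D P) {τ : R}
    {x y : P} (h : τ • x = τ • y) : τ ^ 2 • δ x = τ ^ 2 • δ y := by
  have h1 := congrArg δ.toFun h
  rw [δ.leibniz, δ.leibniz] at h1
  have h2 := congrArg (τ • ·) h1
  simp only [smul_add, smul_smul, mul_comm τ (D τ)] at h2
  rw [mul_smul, h, ← mul_smul] at h2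
  rw [_root_.sq]
  exact add_left_cancel h2

/-- `δ` is a square root of the operator `Q` on `C ≅ N ⊗ N`. -/
def IsRoot (q : (N ⊗[R] N) ≃ₗ[R] C) (Q : DerivOp D C) (δ : N → N) : Prop :=
  ∀ x y, q (δ x ⊗ₜ y) + q (x ⊗ₜ δ y) = Q (q (x ⊗ₜ y))

/-- Transport of an operator along an isomorphism. -/
def DerivOp.pullback {P : Type*} [AddCommGroup P] [Module R P] (q : P ≃ₗ[R] C) (Q : DerivOp D C) :
    DerivOp D P where
  toFun := (q.symm.toLinearMap.toAddMonoidHom.comp Q.toFun).comp q.toLinearMap.toAddMonoidHom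
  leibniz f x := by
    simp only [AddMonoidHom.comp_apply]
    change q.symm (Q (q (f • x))) = D f • x + f • q.symm (Q (q x))
    rw [map_smul, Q.leibniz, map_add, map_smul, map_smul, q.symm_apply_apply]

theorem DerivOp.pullback_apply {P : Type*} [AddCommGroup P] [Module R P] (q : P ≃ₗ[R] C)
    (Q : DerivOp D C) (x : P) : Q.pullback q x = q.symm (Q (q x)) := rfl

theorem isRoot_iff (q : (N ⊗[R] N) ≃ₗ[R] C) (Q : DerivOp D C) (δ : N → N) :
    IsRoot q Q δ ↔ ∀ x y, δ x ⊗ₜ[R] y + x ⊗ₜ[R] δ y = Q.pullback q (x ⊗ₜ[R] y) := by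
  refine forall₂_congr fun x y => ?_
  rw [DerivOp.pullback_apply, LinearEquiv.eq_symm_apply, map_add]

/-- If `Q(l ⊗ l) = g l ⊗ l` in the frame, a root is `x ↦ (D(c(x)) + ½ g c(x)) l`. -/
theorem IsLineFrame.exists_root {τ : R} {l : N} {c : Module.Dual R N}
    (h : IsLineFrame τ l c) (Q : DerivOp D (N ⊗[R] N)) :
    ∃ δ : N → N, ∀ x y, τ ^ 2 • (δ x ⊗ₜ[R] y + x ⊗ₜ[R] δ y) = τ ^ 2 • Q (x ⊗ₜ[R] y) := by
  set u := Q (l ⊗ₜ l)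
  set g := c (contractSnd c u)
  set g' := algebraMap ℝ R 2⁻¹ * g
  have hg : g' + g' = g := by
    have := half_smul_add_self (R := R) g
    rwa [smul_add] at this
  have h2 : IsLineFrame (τ ^ 2) l c := by rw [sq]; exact h.mul τ
  have hu : τ ^ 2 • u = τ ^ 2 • g • (l ⊗ₜ[R] l) := h2.tensor u
  have hQ : ∀ x y, τ ^ 2 • Q (x ⊗ₜ[R] y) = τ ^ 2 • (D (c x * c y) + c x * c y * g) • (l ⊗ₜ[R] l) :=
    fun x y => by
      rw [Q.sq_smul_congr (h.tmul x y), Q.leibniz, smul_add, smul_comm _ (c x * c y) (Q.toFun _),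
        hu, add_smul, smul_add, mul_smul _ g, smul_comm (τ ^ 2) (c x * c y)]
  refine ⟨fun x => (D (c x) + g' * c x) • l, fun x y => ?_⟩
  have e1 : ∀ x, c ((D (c x) + g' * c x) • l) * τ ^ 2 = (D (c x) + g' * c x) * τ ^ 2 := fun x => by
    rw [map_smul, smul_eq_mul, mul_assoc, mul_comm _ (τ ^ 2), h2.dual]
  rw [hQ, smul_add, h2.tmul, h2.tmul x, smul_smul, smul_smul, smul_smul, ← add_smul]
  congr 1
  rw [D.leibniz, smul_eq_mul, smul_eq_mul, ← hg]
  linear_combination c y * e1 x + c x * e1 y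

variable {I : Type*} {τ : I → R} {l : I → N} {c : I → Module.Dual R N}
  (hL : ∀ i, IsLineFrame (τ i) (l i) (c i)) (hN : Separates (fun i => τ i ^ 2) N)
  (q : (N ⊗[R] N) ≃ₗ[R] C)

theorem IsLineFrame.sq {r : R} {l : N} {c : Module.Dual R N} (h : IsLineFrame r l c) :
    IsLineFrame (r ^ 2) l c := by rw [pow_two]; exact h.mul r

include hL hN in
theorem IsRoot.unique {q : (N ⊗[R] N) ≃ₗ[R] C} {Q : DerivOp D C} {δ δ' : N → N}
    (h : IsRoot q Q δ) (h' : IsRoot q Q δ') : δ = δ' := by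
  funext x
  rw [← sub_eq_zero]
  refine hN _ fun i => (hL i).sq.smul_eq_zero_of_root (ε := fun x => δ x - δ' x) (fun x y => ?_) x
  have := ((isRoot_iff q Q δ).mp h x y).trans ((isRoot_iff q Q δ').mp h' x y).symm
  rw [TensorProduct.sub_tmul, TensorProduct.tmul_sub, sub_add_sub_comm, this, sub_self, smul_zero]

-- Local roots agree on overlaps by uniqueness and glue to a map `f`. Its additivity and its Leibniz
-- rule are read off the root equation by cancelling the factors `l i`.
include hL hN in
theorem exists_root (hG : Glues (fun i => τ i ^ 2) N)
    (hT : Separates (fun i => τ i ^ 2) C) (Q : DerivOp D C) :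
    ∃ δ : DerivOp D N, IsRoot q Q δ := by
  choose δ hδ using fun i => (hL i).exists_root (Q.pullback q)
  -- Separation does not pass formally from `N` to `N ⊗ N`; it is carried over from `C`.
  have hT' : Separates (fun i => τ i ^ 2) (N ⊗[R] N) := fun t ht => by
    have := hT (q t) fun i => by rw [← map_smul, ht, map_zero]
    rwa [q.map_eq_zero_iff] at this
  choose f hf using fun x => hG (fun i => τ i ^ 2 • δ i x) fun i j => by
    rw [smul_smul, smul_smul, mul_comm (τ j ^ 2), ← sub_eq_zero, ← smul_sub]
    refine ((hL j).sq.mul (τ i ^ 2)).smul_eq_zero_of_root (ε := fun x => δ j x - δ i x)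
      (fun x y => ?_) x
    rw [TensorProduct.sub_tmul, TensorProduct.tmul_sub, sub_add_sub_comm, smul_sub, mul_smul,
      hδ j, mul_comm, mul_smul, hδ i, smul_comm, sub_self]
  replace hf : ∀ x i, τ i ^ 2 • f x = τ i ^ 2 • δ i x := hf
  have hroot : ∀ x y, f x ⊗ₜ[R] y + x ⊗ₜ[R] f y = Q.pullback q (x ⊗ₜ[R] y) := fun x y => by
    refine hT'.eq fun i => ?_
    rw [← hδ, smul_add, smul_add, TensorProduct.smul_tmul', hf, ← TensorProduct.tmul_smul, hf,
      TensorProduct.tmul_smul, ← TensorProduct.smul_tmul']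
  have hz : ∀ z : N, (∀ i, z ⊗ₜ[R] l i = 0) → z = 0 := fun z hz =>
    hN _ fun i => (hL i).sq.smul_eq_zero_of_tmul (by rw [hz, smul_zero])
  refine ⟨⟨AddMonoidHom.mk' f fun x y => ?_, fun a x => ?_⟩, (isRoot_iff q Q _).mpr hroot⟩
  · rw [← sub_eq_zero]
    refine hz _ fun i => ?_
    rw [TensorProduct.sub_tmul, TensorProduct.add_tmul, eq_sub_of_add_eq (hroot (x + y) (l i)),
      eq_sub_of_add_eq (hroot x (l i)), eq_sub_of_add_eq (hroot y (l i)), TensorProduct.add_tmul,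
      TensorProduct.add_tmul, map_add]
    abel
  · change f (a • x) = D a • x + a • f x
    rw [← sub_eq_zero]
    refine hz _ fun i => ?_
    rw [TensorProduct.sub_tmul, TensorProduct.add_tmul, eq_sub_of_add_eq (hroot (a • x) (l i)),
      ← TensorProduct.smul_tmul', ← TensorProduct.smul_tmul', ← TensorProduct.smul_tmul',
      ← TensorProduct.smul_tmul', eq_sub_of_add_eq (hroot x (l i)), DerivOp.leibniz, smul_sub]
    abel

/-- The mixed terms `δx ⊗ δ'y` cancel in the commutator. Together with uniqueness this yields
flatness of the root actions. -/
theorem IsRoot.comm {D' : Derivation ℝ R R} {Q : DerivOp D C} {Q' : DerivOp D' C}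
    {δ : DerivOp D N} {δ' : DerivOp D' N} (h : IsRoot q Q δ) (h' : IsRoot q Q' δ') :
    IsRoot q (Q.comm Q') (δ.comm δ') := fun x y => by
  simp only [DerivOp.comm_apply]
  rw [← h', ← h]
  simp only [map_add]
  rw [← h, ← h, ← h', ← h', TensorProduct.sub_tmul, TensorProduct.tmul_sub, map_sub, map_sub]
  abel

end Root

/-! ### Functoriality of the induced operators. -/

section Operators
variable {R : Type*} [CommRing R] [Algebra ℝ R]
variable {V N : Type*} [AddCommGroup V] [Module R V] [AddCommGroup N] [Module R N]
variable {D D' : Derivation ℝ R R}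

theorem DerivOp.alt_congr {k : ℕ} {δ : DerivOp D V} {δ' : DerivOp D' V} {τ : DerivOp D N}
    {τ' : DerivOp D' N} (h : ∀ v, δ v = δ' v) (h' : ∀ x, τ x = τ' x) (θ : V [⋀^Fin k]→ₗ[R] N) :
    δ.alt τ k θ = δ'.alt τ' k θ := by
  ext v; simp [h, h']

theorem DerivOp.alt_comm {k : ℕ} (δ : DerivOp D V) (τ : DerivOp D N) (δ' : DerivOp D' V)
    (τ' : DerivOp D' N) (θ : V [⋀^Fin k]→ₗ[R] N) :
    (δ.comm δ').alt (τ.comm τ') k θ = (δ.alt τ k).comm (δ'.alt τ' k) θ := by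
  have := congrFun (DFunLike.congr_fun (lieOp_comm δ τ δ' τ') (Pi.single k θ)) k
  change δ.alt τ k (δ'.alt τ' k ((Pi.single k θ : Forms R V N) k)) -
    δ'.alt τ' k (δ.alt τ k ((Pi.single k θ : Forms R V N) k)) =
    (δ.comm δ').alt (τ.comm τ') k ((Pi.single k θ : Forms R V N) k) at this
  rw [Pi.single_eq_same] at this
  exact this.symm

theorem DerivOp.alt_add {k : ℕ} {D D' D'' : Derivation ℝ R R}
    (δ : DerivOp D V) (δ' : DerivOp D' V) (δ'' : DerivOp D'' V) (τ : DerivOp D N)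
    (τ' : DerivOp D' N) (τ'' : DerivOp D'' N) (h : ∀ v, δ'' v = δ v + δ' v)
    (h' : ∀ x, τ'' x = τ x + τ' x) (θ : V [⋀^Fin k]→ₗ[R] N) :
    δ''.alt τ'' k θ = δ.alt τ k θ + δ'.alt τ' k θ := by
  ext v
  simp only [DerivOp.alt_apply, AlternatingMap.add_apply, h, h', AlternatingMap.map_update_add,
    Finset.sum_add_distrib]
  abel

/-- How the induced operator on top-degree forms changes under
`δ ↦ f δ + φ ⊗ x`, `τ ↦ f τ + c`. -/
theorem DerivOp.alt_smul {I : Type*} {r : I → R} {n : ℕ} {e : I → Fin n → V}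
    {ε : I → Fin n → Module.Dual R V} (hf : ∀ i, IsFrame (r i) (e i) (ε i)) (hN : Separates r N)
    (δ : DerivOp D V) (δ' : DerivOp D' V) (τ : DerivOp D N) (τ' : DerivOp D' N)
    (f c : R) (φ : Module.Dual R V) (x : V)
    (h : ∀ v, δ' v = f • δ v + φ v • x) (h' : ∀ y, τ' y = f • τ y + c • y)
    (θ : V [⋀^Fin n]→ₗ[R] N) :
    δ'.alt τ' n θ = f • δ.alt τ n θ + (c - φ x) • θ := by
  ext v
  -- The rank one part `φ ⊗ x` of `δ'` acts on top-degree forms by its trace.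
  have key : ∑ l, φ (v l) • θ (Function.update v l x) = φ x • θ v :=
    hN.eq fun i => (hf i).smul_sum_update φ x θ v
  simp only [DerivOp.alt_apply, AlternatingMap.add_apply, AlternatingMap.smul_apply, h, h',
    AlternatingMap.map_update_add, AlternatingMap.map_update_smul, Finset.sum_add_distrib, key,
    smul_sub, Finset.smul_sum]
  rw [sub_smul]
  abel

theorem DerivOp.hom_comm {W : Type*} [AddCommGroup W] [Module R W] (δ : DerivOp D V)
    (τ : DerivOp D W) (δ' : DerivOp D' V) (τ' : DerivOp D' W) (φ : V →ₗ[R] W) :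
    (δ.comm δ').hom (τ.comm τ') φ = (δ.hom τ).comm (δ'.hom τ') φ := by
  ext v
  simp only [DerivOp.hom_apply, DerivOp.comm_apply, LinearMap.sub_apply, map_sub]
  abel

end Operators

/-! ### The canonical operators on `∧ⁿA* ⊗ ∧ᵐT*M`. -/

section Canonical
variable {R : Type*} [CommRing R] [Algebra ℝ R] {Γ : Type*} [AddCommGroup Γ] [Module R Γ]
variable (n m : ℕ) {D D' : Derivation ℝ R R}

/-- The operator on `∧ⁿA* ⊗ ∧ᵐT*M` induced by an operator on `A*` and a vector field. -/
def canonicalOp (δ : DerivOp D (Module.Dual R Γ)) : DerivOp D (CanonicalLine R Γ n m) :=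
  (δ.alt (DerivOp.fn D) n).hom (lieTopForm m D)

theorem canonicalOp_apply (δ : DerivOp D (Module.Dual R Γ)) (φ : CanonicalLine R Γ n m)
    (P : TopMultivector R Γ n) :
    canonicalOp n m δ φ P = lieTopForm m D (φ P) - φ (δ.alt (DerivOp.fn D) n P) := rfl

theorem lieTopForm_comm (μ : TopForm R m) :
    lieTopForm m ⁅D, D'⁆ μ = (lieTopForm m D).comm (lieTopForm m D') μ := by
  refine Eq.trans ?_ (DerivOp.alt_comm ((tangent R).ad D) (DerivOp.fn D) ((tangent R).ad D')
    (DerivOp.fn D') μ)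
  refine DerivOp.alt_congr (fun v => ?_) (fun x => ?_) μ
  · change ⁅⁅D, D'⁆, v⁆ = ⁅D, ⁅D', v⁆⁆ - ⁅D', ⁅D, v⁆⁆
    rw [leibniz_lie D D' v]; abel
  · simp [Derivation.commutator_apply, DerivOp.comm_apply]; rfl

theorem canonicalOp_comm {D'' : Derivation ℝ R R} (hD : D'' = ⁅D, D'⁆)
    (δ : DerivOp D (Module.Dual R Γ)) (δ' : DerivOp D' (Module.Dual R Γ))
    (δ'' : DerivOp D'' (Module.Dual R Γ)) (h : ∀ ξ, δ'' ξ = δ.comm δ' ξ)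
    (φ : CanonicalLine R Γ n m) :
    canonicalOp n m δ'' φ = (canonicalOp n m δ).comm (canonicalOp n m δ') φ := by
  subst hD
  rw [canonicalOp, canonicalOp, canonicalOp, ← DerivOp.hom_comm]
  ext1 P
  rw [DerivOp.hom_apply, DerivOp.hom_apply, lieTopForm_comm]
  congr 2
  change _ = ((δ.alt (DerivOp.fn D) n).comm (δ'.alt (DerivOp.fn D') n)) P
  rw [← DerivOp.alt_comm]
  exact DerivOp.alt_congr h (fun x => by simp [Derivation.commutator_apply]) P

theorem lieTopForm_add (μ : TopForm R m) :
    lieTopForm m (D + D') μ = lieTopForm m D μ + lieTopForm m D' μ := by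
  refine DerivOp.alt_add _ _ _ _ _ _ (fun v => ?_) (fun x => ?_) μ
  · exact add_lie D D' v
  · simp

theorem canonicalOp_add {D'' : Derivation ℝ R R} (hD : D'' = D + D')
    (δ : DerivOp D (Module.Dual R Γ)) (δ' : DerivOp D' (Module.Dual R Γ))
    (δ'' : DerivOp D'' (Module.Dual R Γ)) (h : ∀ ξ, δ'' ξ = δ ξ + δ' ξ)
    (φ : CanonicalLine R Γ n m) :
    canonicalOp n m δ'' φ = canonicalOp n m δ φ + canonicalOp n m δ' φ := by
  subst hD
  ext1 P
  rw [LinearMap.add_apply, canonicalOp_apply, canonicalOp_apply, canonicalOp_apply,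
    lieTopForm_add, DerivOp.alt_add δ δ' δ'' (DerivOp.fn D) (DerivOp.fn D') _ h (fun x => by simp),
    map_add]
  abel

variable {m} {I : Type*} {r : I → R} {d : I → Fin m → Derivation ℝ R R}
  {dx : I → Fin m → Module.Dual R (Derivation ℝ R R)} (hD : ∀ i, IsFrame (r i) (d i) (dx i))
  (hR : Separates r R)

-- In `[fD, v] = f[D, v] - v(f)D` the rank one term has trace `-Df`, and it enters the Lie
-- derivative with a minus sign.
include hD hR in
theorem lieTopForm_smul (f : R) (μ : TopForm R m) :
    lieTopForm m (f • D) μ = f • lieTopForm m D μ + D f • μ := by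
  let φ : Module.Dual R (Derivation ℝ R R) :=
    { toFun := fun v => - v f
      map_add' := fun v w => by simp [add_comm]
      map_smul' := fun a v => by simp }
  have := DerivOp.alt_smul hD hR ((tangent R).ad D) ((tangent R).ad (f • D)) (DerivOp.fn D)
    (DerivOp.fn (f • D)) f 0 φ D (fun v => ?_) (fun y => by simp) μ
  · refine this.trans ?_
    rw [show φ D = - D f from rfl, zero_sub, neg_neg]; rfl
  · change ⁅f • D, v⁆ = f • ⁅D, v⁆ + (- v f) • D
    ext g
    simp [Derivation.commutator_apply]
    ring

variable {n} {e : I → Fin n → Γ} {ε : I → Fin n → Module.Dual R Γ}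
  (hf : ∀ i, IsFrame (r i) (e i) (ε i))

-- Two failures of linearity add up: `Df` from `∧ᵐT*M` and `φ(x)` from `∧ⁿA*`. For the Lie
-- derivative along a section of `A` they are equal, for the action of `A*` they cancel.
include hD hR hf in
theorem canonicalOp_smul {f : R} (hD' : D' = f • D)
    (δ : DerivOp D (Module.Dual R Γ)) (δ' : DerivOp D' (Module.Dual R Γ))
    (φ : Module.Dual R (Module.Dual R Γ)) (x : Module.Dual R Γ)
    (h : ∀ ξ, δ' ξ = f • δ ξ + φ ξ • x) (ψ : CanonicalLine R Γ n m) :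
    canonicalOp n m δ' ψ = f • canonicalOp n m δ ψ + (D f + φ x) • ψ := by
  subst hD'
  ext1 P
  have h1 : ∀ (a b : R) (μ : TopForm R m), (a + b) • μ = a • μ + b • μ := fun a b μ => add_smul a b μ
  have h2 : ∀ (a : R) (μ : TopForm R m), (-a) • μ = - (a • μ) := fun a μ => neg_smul a μ
  rw [LinearMap.add_apply, LinearMap.smul_apply, LinearMap.smul_apply, canonicalOp_apply,
    canonicalOp_apply, lieTopForm_smul hD hR,
    DerivOp.alt_smul (fun i => (hf i).toDual) hR δ δ' (DerivOp.fn D) (DerivOp.fn (f • D)) f 0 φ x h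
      (fun y => by simp), map_add, map_smul, map_smul, zero_sub, smul_sub, h1, h2]
  abel

end Canonical

/-! ### The two root actions: existence, uniqueness, flatness. -/

section Actions
variable {R : Type*} [CommRing R] [Algebra ℝ R] {Γ : Type*} [AddCommGroup Γ] [Module R Γ]
  {N : Type*} [AddCommGroup N] [Module R N] {n m : ℕ}

theorem SkewAlgebroid.adDual_add (S : SkewAlgebroid R Γ) (X Y : Γ) (ξ : Module.Dual R Γ) :
    S.adDual (X + Y) ξ = S.adDual X ξ + S.adDual Y ξ := by
  ext Z; simp [adDual_apply]; ring

theorem SkewAlgebroid.adDual_smul (S : SkewAlgebroid R Γ) (f : R) (X : Γ) (ξ : Module.Dual R Γ) :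
    S.adDual (f • X) ξ = f • S.adDual X ξ + ξ X • S.d₀ f := by
  ext Z; simp [adDual_apply, S.bracket_smul_left, SkewAlgebroid.d₀]; ring

theorem LieAlgebroid.adDual_bracket (S : LieAlgebroid R Γ) (X Y : Γ) (ξ : Module.Dual R Γ) :
    S.adDual (S.bracket X Y) ξ = (S.adDual X).comm (S.adDual Y) ξ := by
  ext Z
  simp only [DerivOp.comm_apply, LinearMap.sub_apply, adDual_apply, S.anchor_bracket, map_sub,
    Derivation.commutator_apply, S.jacobi X Y Z, map_add]
  ring

variable {I : Type*} {τ : I → R} {l : I → N} {c : I → Module.Dual R N}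
  (hL : ∀ i, IsLineFrame (τ i) (l i) (c i))
  (hR : Separates (fun i => τ i ^ 2) R) (hN : Separates (fun i => τ i ^ 2) N)
  (hG : Glues (fun i => τ i ^ 2) N)
  (q : (N ⊗[R] N) ≃ₗ[R] CanonicalLine R Γ n m)
  {d : I → Fin m → Derivation ℝ R R}
  {dx : I → Fin m → Module.Dual R (Derivation ℝ R R)} (hD : ∀ i, IsFrame (τ i) (d i) (dx i))
  {e : I → Fin n → Γ} {ε : I → Fin n → Module.Dual R Γ}
  (hf : ∀ i, IsFrame (τ i) (e i) (ε i))

/-- The square root of the operator `Q`. -/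
def rootOp {D : Derivation ℝ R R} (Q : DerivOp D (CanonicalLine R Γ n m)) : DerivOp D N :=
  (exists_root hL hN q hG hR.alternating.linearMap Q).choose

theorem isRoot_rootOp {D : Derivation ℝ R R} (Q : DerivOp D (CanonicalLine R Γ n m)) :
    IsRoot q Q (rootOp hL hR hN hG q Q) :=
  (exists_root hL hN q hG hR.alternating.linearMap Q).choose_spec

theorem IsFrame.sq {V : Type*} [AddCommGroup V] [Module R V] {r : R} {n : ℕ} {e : Fin n → V}
    {ε : Fin n → Module.Dual R V} (h : IsFrame r e ε) : IsFrame (r ^ 2) e ε := by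
  rw [pow_two]; exact h.mul r

/-- The Lie derivative on the half-densities `L`; it is not linear over functions. -/
def lieRoot (S : SkewAlgebroid R Γ) (X : Γ) : DerivOp (S.anchor X) N :=
  rootOp hL hR hN hG q (canonicalOp n m (S.adDual X))

theorem isRoot_lieRoot (S : SkewAlgebroid R Γ) (X : Γ) :
    IsRoot q (canonicalOp n m (S.adDual X)) (lieRoot hL hR hN hG q S X) :=
  isRoot_rootOp hL hR hN hG q _

theorem IsRoot.congr {D D' : Derivation ℝ R R} {C : Type*} [AddCommGroup C] [Module R C]
    {q : (N ⊗[R] N) ≃ₗ[R] C} {Q : DerivOp D C}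
    {Q' : DerivOp D' C} (hQ : ∀ x, Q x = Q' x) {δ : N → N} (h : IsRoot q Q δ) : IsRoot q Q' δ :=
  fun x y => (h x y).trans (hQ _)

theorem lieRoot_add (S : SkewAlgebroid R Γ) (X Y : Γ) (x : N) :
    lieRoot hL hR hN hG q S (X + Y) x =
      lieRoot hL hR hN hG q S X x + lieRoot hL hR hN hG q S Y x := by
  refine congrFun (IsRoot.unique hL hN (isRoot_lieRoot hL hR hN hG q S (X + Y))
    (δ' := fun x => lieRoot hL hR hN hG q S X x + lieRoot hL hR hN hG q S Y x) fun x y => ?_) x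
  rw [canonicalOp_add n m (map_add _ _ _) (S.adDual X) (S.adDual Y) _ (S.adDual_add X Y),
    ← isRoot_lieRoot hL hR hN hG q S X, ← isRoot_lieRoot hL hR hN hG q S Y,
    TensorProduct.add_tmul, TensorProduct.tmul_add, map_add, map_add]
  abel

-- The canonical operator fails to be linear by `2a(X)f`, and its square root by half of that.
include hD hf in
theorem lieRoot_smul (S : SkewAlgebroid R Γ) (f : R) (X : Γ) (x : N) :
    lieRoot hL hR hN hG q S (f • X) x = f • lieRoot hL hR hN hG q S X x + S.anchor X f • x := by
  refine congrFun (IsRoot.unique hL hN (isRoot_lieRoot hL hR hN hG q S (f • X))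
    (δ' := fun x => f • lieRoot hL hR hN hG q S X x + S.anchor X f • x) fun x y => ?_) x
  rw [canonicalOp_smul (fun i => (hD i).sq) hR (fun i => (hf i).sq) (map_smul _ _ _) (S.adDual X) _
    (Module.Dual.eval R Γ X) (S.d₀ f) (S.adDual_smul f X), ← isRoot_lieRoot hL hR hN hG q S X,
    TensorProduct.add_tmul, TensorProduct.tmul_add, ← TensorProduct.smul_tmul',
    ← TensorProduct.smul_tmul', TensorProduct.tmul_smul, TensorProduct.tmul_smul]
  simp only [map_add, map_smul]
  rw [show Module.Dual.eval R Γ X (S.d₀ f) = S.anchor X f from rfl, add_smul, smul_add]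
  abel

/-- By uniqueness, since the commutator of two roots is a root of the commutator. -/
theorem lieRoot_bracket (S : LieAlgebroid R Γ) (X Y : Γ) (x : N) :
    lieRoot hL hR hN hG q S.toSkewAlgebroid (S.bracket X Y) x =
      (lieRoot hL hR hN hG q S.toSkewAlgebroid X).comm
        (lieRoot hL hR hN hG q S.toSkewAlgebroid Y) x := by
  have hc := IsRoot.comm (Q := canonicalOp n m (S.adDual X)) (Q' := canonicalOp n m (S.adDual Y)) q
    (isRoot_lieRoot hL hR hN hG q S.toSkewAlgebroid X)
    (isRoot_lieRoot hL hR hN hG q S.toSkewAlgebroid Y)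
  refine congrFun (IsRoot.unique hL hN (isRoot_lieRoot hL hR hN hG q _ (S.bracket X Y))
    (IsRoot.congr (fun φ => ?_) hc)) x
  exact (canonicalOp_comm n m (S.anchor_bracket X Y) _ _ _ (S.adDual_bracket X Y) φ).symm

/-- The action of `A` on `∧ⁿA ⊗ L`. -/
def dualRootConnection (S : SkewAlgebroid R Γ) :
    S.Connection (Module.Dual R Γ [⋀^Fin n]→ₗ[R] N) where
  act X := (S.adDual X).alt (lieRoot hL hR hN hG q S X) n
  add_left X Y b := DerivOp.alt_add _ _ _ _ _ _ (S.adDual_add X Y)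
    (lieRoot_add hL hR hN hG q S X Y) b
  smul_left f X b := by
    -- The failure `a(X)f` of `lieRoot` cancels against the trace of `df ⊗ X` on `∧ⁿA`.
    refine (DerivOp.alt_smul (fun i => (hf i).sq.toDual) hN (S.adDual X) _
      (lieRoot hL hR hN hG q S X) _ f _ (Module.Dual.eval R Γ X) (S.d₀ f) (S.adDual_smul f X)
      (lieRoot_smul hL hR hN hG q hD hf S f X) b).trans ?_
    rw [show Module.Dual.eval R Γ X (S.d₀ f) = S.anchor X f from rfl, sub_self, zero_smul,
      add_zero]

theorem dualRootConnection_isFlat (S : LieAlgebroid R Γ) :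
    (dualRootConnection hL hR hN hG q hD hf S.toSkewAlgebroid).IsFlat := fun X Y b => by
  refine Eq.trans ?_ (DerivOp.alt_comm (S.adDual X) (lieRoot hL hR hN hG q S.toSkewAlgebroid X)
    (S.adDual Y) (lieRoot hL hR hN hG q S.toSkewAlgebroid Y) b)
  exact DerivOp.alt_congr (S.adDual_bracket X Y) (lieRoot_bracket hL hR hN hG q S X Y) b

/-- The action of `A*` on `L`. -/
def rootConnection (S : SkewAlgebroid R (Module.Dual R Γ)) : S.Connection N where
  act ξ := rootOp hL hR hN hG q (canonicalOp n m (S.ad ξ))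
  add_left ξ η x := by
    refine congrFun (IsRoot.unique hL hN (isRoot_rootOp hL hR hN hG q (canonicalOp n m
      (S.ad (ξ + η)))) (δ' := fun x => rootOp hL hR hN hG q (canonicalOp n m (S.ad ξ)) x +
        rootOp hL hR hN hG q (canonicalOp n m (S.ad η)) x) fun x y => ?_) x
    rw [canonicalOp_add n m (map_add _ _ _) (S.ad ξ) (S.ad η) _
      (fun ζ => DFunLike.congr_fun (map_add S.bracket ξ η) ζ),
      ← isRoot_rootOp hL hR hN hG q (canonicalOp n m (S.ad ξ)),
      ← isRoot_rootOp hL hR hN hG q (canonicalOp n m (S.ad η)),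
      TensorProduct.add_tmul, TensorProduct.tmul_add, map_add, map_add]
    abel
  smul_left f ξ x := by
    refine congrFun (IsRoot.unique hL hN (isRoot_rootOp hL hR hN hG q (canonicalOp n m
      (S.ad (f • ξ)))) (δ' := fun x => f • rootOp hL hR hN hG q (canonicalOp n m (S.ad ξ)) x)
      fun x y => ?_) x
    rw [canonicalOp_smul (fun i => (hD i).sq) hR (fun i => (hf i).sq) (map_smul _ _ _) (S.ad ξ) _
      (- S.d₀ f) ξ (fun η => ?_), ← isRoot_rootOp hL hR hN hG q (canonicalOp n m (S.ad ξ)),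
      ← TensorProduct.smul_tmul', TensorProduct.tmul_smul, map_smul, map_smul]
    · have : S.anchor ξ f + (- S.d₀ f) ξ = 0 := add_neg_cancel _
      rw [this, zero_smul, add_zero, smul_add]
    · change S.bracket (f • ξ) η = f • S.bracket ξ η + (- S.anchor η f) • ξ
      have : (- S.anchor η f) • ξ = - (S.anchor η f • ξ) := neg_smul _ ξ
      rw [S.bracket_smul_left, this, sub_eq_add_neg]

theorem rootConnection_isFlat (S : LieAlgebroid R (Module.Dual R Γ)) :
    (rootConnection hL hR hN hG q hD hf S.toSkewAlgebroid).IsFlat := fun ξ η x => by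
  have hc := IsRoot.comm (Q := canonicalOp n m (S.ad ξ)) (Q' := canonicalOp n m (S.ad η)) q
    (isRoot_rootOp hL hR hN hG q (canonicalOp n m (S.ad ξ)))
    (isRoot_rootOp hL hR hN hG q (canonicalOp n m (S.ad η)))
  refine congrFun (IsRoot.unique hL hN (isRoot_rootOp hL hR hN hG q (canonicalOp n m
    (S.ad (S.bracket ξ η)))) (IsRoot.congr (fun φ => ?_) hc)) x
  refine (canonicalOp_comm n m (S.anchor_bracket ξ η) (S.ad ξ) (S.ad η) _ (fun ζ => ?_) φ).symm
  change S.bracket (S.bracket ξ η) ζ = S.bracket ξ (S.bracket η ζ) - S.bracket η (S.bracket ξ ζ)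
  rw [S.jacobi ξ η ζ]; abel

theorem isRootAction_iff (S : SkewAlgebroid R (Module.Dual R Γ)) (E : S.Connection N) :
    IsRootAction S q E ↔ E = rootConnection hL hR hN hG q hD hf S := by
  constructor
  · intro h
    ext ξ x
    have h' : IsRoot q (canonicalOp n m (S.ad ξ)) (E.act ξ) := h ξ
    exact congrFun (IsRoot.unique hL hN h' (isRoot_rootOp hL hR hN hG q _)) x
  · rintro rfl ξ
    exact isRoot_rootOp hL hR hN hG q (canonicalOp n m (S.ad ξ))

include hL hN in
theorem tmul_comm_of_isLineFrame (hR : Separates (fun i => τ i ^ 2) R) (x y : N) :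
    q (x ⊗ₜ y) = q (y ⊗ₜ x) :=
  hR.alternating.linearMap.eq fun i => by
    rw [← map_smul, (hL i).sq.tmul_comm, map_smul]

include hf hR in
theorem topMultivector_comm (φ : TopMultivector R Γ n →ₗ[R] TopForm R m)
    (P P' : TopMultivector R Γ n) (η : Fin n → Module.Dual R Γ) :
    P η • φ P' = P' η • φ P := by
  rw [← map_smul, ← map_smul]
  congr 1
  ext w
  exact hR.eq fun i => by
    have := (hf i).sq.toDual.top_smul_comm P P' η w
    simpa [mul_comm] using this

/-- Existence is the Leibniz rule on `P ⊗ l`, together with the freedom to interchange sections of a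
line bundle inside products. For uniqueness, the difference of two actions is linear over functions,
so it is tested on a local generator `P ⊗ l`, where the root equation gives twice its value. -/
theorem isDualRootAction_iff (S : SkewAlgebroid R Γ)
    (E : S.Connection (Module.Dual R Γ [⋀^Fin n]→ₗ[R] N)) :
    IsDualRootAction S q E ↔ E = dualRootConnection hL hR hN hG q hD hf S := by
  have main : IsDualRootAction S q (dualRootConnection hL hR hN hG q hD hf S) := by
    intro X P P' l l'
    set δ := lieRoot hL hR hN hG q S X
    have hact : ∀ P l (η : Fin n → Module.Dual R Γ),
        (dualRootConnection hL hR hN hG q hD hf S).act X (tensorTop P l) η =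
        (S.adDual X).alt (DerivOp.fn _) n P η • l + P η • δ l := fun P l η => by
      change (S.adDual X).alt δ n (tensorTop P l) η = _
      simp only [DerivOp.alt_apply, tensorTop, LinearMap.compAlternatingMap_apply,
        LinearMap.toSpanSingleton_apply, DerivOp.leibniz, DerivOp.fn_apply, sub_smul,
        Finset.sum_smul]
      abel
    ext1 η
    have h1 := isRoot_lieRoot hL hR hN hG q S X l l'
    have h2 := DFunLike.congr_fun h1 P'
    rw [LinearMap.add_apply, canonicalOp_apply] at h2
    have e1 : lieDualLine S n m X (dualSquare q (tensorTop P l) P' l') η =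
        (S.adDual X).alt (DerivOp.fn _) n P η • q (l ⊗ₜ l') P' +
          P η • lieTopForm m (S.anchor X) (q (l ⊗ₜ l') P') := by
      have hs : ∀ (a b : R) (μ : TopForm R m), (a - b) • μ = a • μ - b • μ :=
        fun a b μ => sub_smul a b μ
      rw [lieDualLine]
      simp only [DerivOp.alt_apply, dualSquare_apply, tensorTop,
        LinearMap.compAlternatingMap_apply, LinearMap.toSpanSingleton_apply,
        ← TensorProduct.smul_tmul', map_smul, LinearMap.smul_apply, DerivOp.leibniz,
        DerivOp.fn_apply, hs, Finset.sum_smul]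
      abel
    rw [e1, eq_add_of_sub_eq h2.symm, AlternatingMap.add_apply, dualSquare_apply, dualSquare_apply,
      hact, hact]
    simp only [TensorProduct.add_tmul, ← TensorProduct.smul_tmul', map_add, map_smul,
      LinearMap.add_apply, LinearMap.smul_apply]
    rw [topMultivector_comm hR hf (q (l' ⊗ₜ l)) _ P, topMultivector_comm hR hf (q (δ l' ⊗ₜ l)) _ P,
      tmul_comm_of_isLineFrame hL hN q hR l' l, tmul_comm_of_isLineFrame hL hN q hR (δ l') l]
    simp only [smul_add]
    abel
  constructor
  · intro h
    ext X b : 3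
    set E₀ := dualRootConnection hL hR hN hG q hD hf S
    let κ : (Module.Dual R Γ [⋀^Fin n]→ₗ[R] N) →ₗ[R] (Module.Dual R Γ [⋀^Fin n]→ₗ[R] N) :=
      { toFun := fun b => E.act X b - E₀.act X b
        map_add' := fun b b' => by rw [map_add, map_add]; abel
        map_smul' := fun f b => by
          rw [DerivOp.leibniz, DerivOp.leibniz, RingHom.id_apply, smul_sub]; abel }
    have hκ : ∀ (P P' : TopMultivector R Γ n) (l l' : N) (η : Fin n → Module.Dual R Γ),
        q (κ (tensorTop P l) η ⊗ₜ l') P' + q (κ (tensorTop P' l') η ⊗ₜ l) P = 0 :=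
      fun P P' l l' η => by
        have := DFunLike.congr_fun ((h X P P' l l').trans (main X P P' l l').symm) η
        simp only [AlternatingMap.add_apply, dualSquare_apply] at this
        change q ((E.act X (tensorTop P l) η - E₀.act X (tensorTop P l) η) ⊗ₜ l') P' +
          q ((E.act X (tensorTop P' l') η - E₀.act X (tensorTop P' l') η) ⊗ₜ l) P = 0
        rw [TensorProduct.sub_tmul, TensorProduct.sub_tmul, map_sub, map_sub, LinearMap.sub_apply,
          LinearMap.sub_apply, sub_add_sub_comm, this, sub_self]
    suffices κ b = 0 from sub_eq_zero.mp this
    refine hN.alternating _ fun i => ?_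
    set P := topForm (fun j => Module.Dual.eval R Γ (e i j))
    have hP : τ i ^ 2 * P (ε i) = τ i ^ 2 := (hf i).sq.toDual.topForm_apply
    have hPl : τ i ^ 2 • κ (tensorTop P (l i)) = 0 := by
      ext1 η
      refine (hL i).sq.smul_eq_zero_of_tmul (z := κ (tensorTop P (l i)) η) ?_
      have h1 : q (κ (tensorTop P (l i)) η ⊗ₜ l i) P = 0 :=
        two_smul_cancel (R := R) (hκ P P (l i) (l i) η)
      refine (q.map_eq_zero_iff).mp ?_
      ext1 P'
      rw [map_smul]
      -- Locally `P` spans the top multivectors, so vanishing against `P` is vanishing against all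
      -- `P'`.
      have h2 : τ i ^ 2 • P' = τ i ^ 2 • P' (ε i) • P := by
        ext w
        have h3 := (hf i).sq.toDual.top_smul_comm P P' w (ε i)
        simp only [smul_eq_mul] at h3
        simp only [AlternatingMap.smul_apply, smul_eq_mul]
        rw [mul_left_comm, mul_comm (P' _)] at *
        linear_combination (-1 : R) * P' w * hP - h3
      rw [LinearMap.smul_apply, ← map_smul, h2, map_smul, map_smul, h1, smul_zero, smul_zero]
      rfl
    have hb : τ i ^ 2 • b = τ i ^ 2 • tensorTop P (b (ε i)) := by
      refine (hf i).sq.toDual.smul_congr ?_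
      change _ = τ i ^ 2 • P (ε i) • b (ε i)
      rw [smul_smul, hP]
    have hb' : τ i ^ 2 • tensorTop P (b (ε i)) = τ i ^ 2 • c i (b (ε i)) • tensorTop P (l i) := by
      ext1 η
      change τ i ^ 2 • P η • b (ε i) = τ i ^ 2 • c i (b (ε i)) • P η • l i
      rw [smul_comm, (hL i).sq.span, smul_comm, smul_comm (P η)]
    rw [← map_smul, hb, hb', map_smul, map_smul, smul_comm, hPl, smul_zero]
  · rintro rfl; exact main

end Actions

/-! ### Invariance of `[Λ,Λ]` forces `ι_{df}[Λ,Λ] = 0`. -/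

section Tensoriality
variable {R : Type*} [CommRing R] [Algebra ℝ R] {Γ : Type*} [AddCommGroup Γ] [Module R Γ]

theorem sharpDefect_self (S : SkewAlgebroid R Γ) (Λ : Bivector R Γ) (α : Module.Dual R Γ) :
    sharpDefect S Λ α α = 0 :=
  two_smul_cancel (R := R) (eq_neg_iff_add_eq_zero.mp (sharpDefect_skew S Λ α α))

/-- Half the Schouten square of `Λ`, as an alternating form. -/
def schoutenForm (S : SkewAlgebroid R Γ) (Λ : Bivector R Γ) : Module.Dual R Γ [⋀^Fin 3]→ₗ[R] R :=
  have h0 : ∀ v : Fin 3 → Module.Dual R Γ,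
      v 2 (sharpDefect S Λ (v 0) (v 1)) = v 0 (sharpDefect S Λ (v 1) (v 2)) := fun v =>
    sharpDefect_cyclic S Λ _ _ _
  have h1 : ∀ v : Fin 3 → Module.Dual R Γ,
      v 2 (sharpDefect S Λ (v 0) (v 1)) = v 1 (sharpDefect S Λ (v 2) (v 0)) := fun v =>
    (sharpDefect_cyclic S Λ _ _ _).trans (sharpDefect_cyclic S Λ _ _ _)
  have h10 : (1 : Fin 3) ≠ 0 := by decide
  have h20 : (2 : Fin 3) ≠ 0 := by decide
  have h21 : (2 : Fin 3) ≠ 1 := by decide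
  { toFun := fun v => v 2 (sharpDefect S Λ (v 0) (v 1))
    map_update_add' := fun {inst} v i x y => by
      rw [Subsingleton.elim inst (instDecidableEqFin 3)]
      have hi : i = 0 ∨ i = 1 ∨ i = 2 := by omega
      obtain rfl | rfl | rfl := hi
      · rw [h0, h0, h0]
        simp only [Function.update_self, ne_eq, h10, h20, h21, h10.symm, h20.symm, h21.symm,
          not_false_eq_true, Function.update_of_ne, LinearMap.add_apply]
      · rw [h1, h1, h1]
        simp only [Function.update_self, ne_eq, h10, h20, h21, h10.symm, h20.symm, h21.symm,
          not_false_eq_true, Function.update_of_ne, LinearMap.add_apply]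
      · simp only [Function.update_self, ne_eq, h10, h20, h21, h10.symm, h20.symm, h21.symm,
          not_false_eq_true, Function.update_of_ne, LinearMap.add_apply]
    map_update_smul' := fun {inst} v i c x => by
      rw [Subsingleton.elim inst (instDecidableEqFin 3)]
      have hi : i = 0 ∨ i = 1 ∨ i = 2 := by omega
      obtain rfl | rfl | rfl := hi
      · rw [h0, h0]
        simp only [Function.update_self, ne_eq, h10, h20, h21, h10.symm, h20.symm, h21.symm,
          not_false_eq_true, Function.update_of_ne, LinearMap.smul_apply]
      · rw [h1, h1]
        simp only [Function.update_self, ne_eq, h10, h20, h21, h10.symm, h20.symm, h21.symm,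
          not_false_eq_true, Function.update_of_ne, LinearMap.smul_apply]
      · simp only [Function.update_self, ne_eq, h10, h20, h21, h10.symm, h20.symm, h21.symm,
          not_false_eq_true, Function.update_of_ne, LinearMap.smul_apply]
    map_eq_zero_of_eq' := fun v i j hv hij => by
      have a1 : v 0 = v 1 → v 2 (sharpDefect S Λ (v 0) (v 1)) = 0 := fun h => by
        rw [h, sharpDefect_self, map_zero]
      have a2 : v 1 = v 2 → v 2 (sharpDefect S Λ (v 0) (v 1)) = 0 := fun h => by
        rw [h0, h, sharpDefect_self, map_zero]
      have a3 : v 2 = v 0 → v 2 (sharpDefect S Λ (v 0) (v 1)) = 0 := fun h => by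
        rw [h1, h, sharpDefect_self, map_zero]
      fin_cases i <;> fin_cases j <;> first | exact absurd rfl hij | skip
      · exact a1 hv
      · exact a3 hv.symm
      · exact a1 hv.symm
      · exact a2 hv
      · exact a3 hv
      · exact a2 hv.symm }

/-- Invariance along `fX` minus `f` times invariance along `X` leaves only the terms with `df`; they
express `ι_{df}[Λ,Λ] ∧ X = 0`. -/
theorem sharpDefect_tensorial (S : SkewAlgebroid R Γ) (Λ : Bivector R Γ)
    (hΛ : ∀ X, bracketSection S (schouten S Λ Λ) X = 0) (f : R) (α β γ : Module.Dual R Γ) (X : Γ) :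
    α X * S.d₀ f (sharpDefect S Λ β γ) + β X * S.d₀ f (sharpDefect S Λ γ α) +
      γ X * S.d₀ f (sharpDefect S Λ α β) = 0 := by
  have key : ∀ X, S.adDual X α (sharpDefect S Λ β γ) + S.adDual X β (sharpDefect S Λ γ α) +
      S.adDual X γ (sharpDefect S Λ α β) = S.anchor X (γ (sharpDefect S Λ α β)) := fun X => by
    have h := congrFun (congrFun (congrFun (hΛ X) α) β) γ
    simp only [bracketSection, Pi.zero_apply] at h
    rw [schouten_cyclic S Λ (S.adDual X α) β γ, schouten_cyclic S Λ α (S.adDual X β) γ,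
      schouten_cyclic S Λ (S.adDual X β) γ α] at h
    have e : S.anchor X (2 * γ (sharpDefect S Λ α β)) =
        2 * S.anchor X (γ (sharpDefect S Λ α β)) := by
      rw [two_mul, map_add, two_mul]
    simp only [schouten_self, e] at h
    exact two_mul_cancel (by linear_combination h)
  have h := key (f • X)
  simp only [S.adDual_smul, LinearMap.add_apply, LinearMap.smul_apply, map_smul,
    Derivation.smul_apply, smul_eq_mul] at h
  linear_combination h - f * key X

variable {I : Type*} {τ : I → R} {n : ℕ} {e : I → Fin n → Γ} {ε : I → Fin n → Module.Dual R Γ}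
  (hf : ∀ i, IsFrame (τ i) (e i) (ε i)) (hR : Separates τ R)

-- Setting `α = ε_p`, `X = e_p` in `sharpDefect_tensorial` and summing gives `(n - 2) ι_{df}[Λ,Λ] =
-- 0`. In rank two the trivector `[Λ,Λ]` vanishes by itself.
include hf hR in
theorem schouten_d₀ (S : SkewAlgebroid R Γ) (Λ : Bivector R Γ)
    (hΛ : ∀ X, bracketSection S (schouten S Λ Λ) X = 0) (f : R) (β γ : Module.Dual R Γ) :
    schouten S Λ Λ (S.d₀ f) β γ = 0 := by
  rw [schouten_cyclic, schouten_self]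
  suffices S.d₀ f (sharpDefect S Λ β γ) = 0 by rw [this, mul_zero]
  rcases eq_or_ne n 2 with hn | hn
  · have := alternating_eq_zero (fun i => (hf i).toDual) hR (by omega) (schoutenForm S Λ)
    exact DFunLike.congr_fun this ![β, γ, S.d₀ f]
  refine hR _ fun i => ?_
  set x := S.d₀ f (sharpDefect S Λ β γ)
  have h1 : ∀ p, τ i * ε i p (e i p) = τ i := fun p => by rw [(hf i).dual]; simp
  have h2 : ∀ (ζ : Module.Dual R Γ) (Y : Γ), τ i * ζ Y = τ i * ∑ p, ε i p Y * ζ (e i p) := fun ζ Y => by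
    have := congrArg ζ ((hf i).span Y)
    simpa using this
  have hs : ∑ p, τ i * (ε i p (e i p) * x + β (e i p) * S.d₀ f (sharpDefect S Λ γ (ε i p)) +
      γ (e i p) * S.d₀ f (sharpDefect S Λ (ε i p) β)) = 0 :=
    Finset.sum_eq_zero fun p _ => by rw [sharpDefect_tensorial S Λ hΛ, mul_zero]
  have hx : ∀ ζ, S.d₀ f (sharpDefect S Λ γ β) = ζ → ζ = - x := fun ζ h => by
    rw [← h, sharpDefect_skew, map_neg]
  have h3 : ∑ p, τ i * (β (e i p) * S.d₀ f (sharpDefect S Λ γ (ε i p))) = - (τ i * x) := by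
    have := h2 β (sharpDefect S Λ (S.d₀ f) γ)
    rw [← mul_neg, ← hx _ (sharpDefect_cyclic S Λ (S.d₀ f) γ β).symm, this, Finset.mul_sum]
    refine Finset.sum_congr rfl fun p _ => ?_
    rw [sharpDefect_cyclic S Λ (S.d₀ f), mul_comm (β _)]
  have h4 : ∑ p, τ i * (γ (e i p) * S.d₀ f (sharpDefect S Λ (ε i p) β)) = - (τ i * x) := by
    rw [← mul_neg, ← hx _ ((sharpDefect_cyclic S Λ γ β _)), h2, Finset.mul_sum]
    refine Finset.sum_congr rfl fun p _ => ?_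
    rw [← sharpDefect_cyclic S Λ (ε i p), mul_comm (γ _)]
  simp only [mul_add, Finset.sum_add_distrib, h3, h4] at hs
  simp only [← mul_assoc, h1, Finset.sum_const,
    Finset.card_univ, Fintype.card_fin, ← Nat.cast_smul_eq_nsmul R, smul_eq_mul] at hs
  have h5 : ((n : ℝ) - 2) ≠ 0 := sub_ne_zero.mpr (by exact_mod_cast hn)
  have h6 : algebraMap ℝ R ((n : ℝ) - 2)⁻¹ * ((n : R) - 2) = 1 := by
    have := congrArg (algebraMap ℝ R) (inv_mul_cancel₀ h5)
    rwa [map_mul, map_sub, map_natCast, map_ofNat, map_one] at this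
  rw [smul_eq_mul]
  linear_combination (- τ i * x) * h6 + algebraMap ℝ R ((n : ℝ) - 2)⁻¹ * hs

end Tensoriality

/-! ### The correction term of `A*` on `L` as half a trace. -/

section Trace
variable {R : Type*} [CommRing R] [Algebra ℝ R] {Γ : Type*} [AddCommGroup Γ] [Module R Γ]
  {N : Type*} [AddCommGroup N] [Module R N] {n m : ℕ}

/-- The two-form `dξ`. -/
def extD (S : SkewAlgebroid R Γ) (ξ : Module.Dual R Γ) : Γ →ₗ[R] Module.Dual R Γ where
  toFun X := S.adDual X ξ - S.d₀ (ξ X)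
  map_add' X Y := by
    ext Z; simp [S.adDual_add, SkewAlgebroid.d₀]; ring
  map_smul' f X := by
    ext Z; simp [S.adDual_smul, SkewAlgebroid.d₀]; ring

theorem extD_skew (S : SkewAlgebroid R Γ) (ξ : Module.Dual R Γ) (X Y : Γ) :
    extD S ξ X Y = - extD S ξ Y X := by
  change S.anchor X (ξ Y) - ξ (S.bracket X Y) - S.anchor Y (ξ X) =
    - (S.anchor Y (ξ X) - ξ (S.bracket Y X) - S.anchor X (ξ Y))
  rw [S.bracket_skew X Y, map_neg]; ring

/-- Isolates the endomorphism `dξ ∘ Λ♯`, whose trace is the difference between the action of `ξ` and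
the Lie derivative along `Λ♯ξ` on top multivectors. -/
theorem dualOf_ad_apply (S : SkewAlgebroid R Γ) (Λ : Bivector R Γ) (ξ θ : Module.Dual R Γ) :
    (S.dualOf Λ).ad ξ θ = S.adDual (Λ.sharp ξ) θ - extD S ξ (Λ.sharp θ) := by
  change Λ.bracketAux S ξ θ = _ - (S.adDual (Λ.sharp θ) ξ - S.d₀ (ξ (Λ.sharp θ)))
  have : ξ (Λ.sharp θ) = - Λ.toFun ξ θ := Λ.toFun_skew θ ξ
  rw [this, S.d₀_neg, Bivector.bracketAux]
  abel

/-- In a frame, `Λ = ½ ∑ e_p ∧ Λ♯ε_p`. By rigidity only contractions with `ξ` are compared;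
skew-symmetry of `Λ` makes each of the two factors contribute `Λ♯ξ`. -/
theorem IsFrame.scale_bivector_wedgeOp {r : R} {e : Fin n → Γ} {ε : Fin n → Module.Dual R Γ}
    (h : IsFrame r e ε) (Λ : Bivector R Γ) :
    (scale r * Λ.wedgeOp : AddMonoid.End (Forms R (Module.Dual R Γ) N)) =
      scale (algebraMap ℝ R 2⁻¹) * (scale r * ∑ p, wedgeOp (e p) * wedgeOp (Λ.sharp (ε p))) := by
  rw [← sub_eq_zero]
  refine op_eq_zero_of_comm _ (fun w => ?_) (fun ξ => ?_)
  · ext x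
    let ev : AddMonoid.End (Forms R (Module.Dual R Γ) N) →+ N := AddMonoidHom.mk'
      (fun T => T w 0 x) fun T T' => rfl
    set W : AddMonoid.End (Forms R (Module.Dual R Γ) N) := scale (algebraMap ℝ R 2⁻¹) *
      (scale r * ∑ p, wedgeOp (e p) * wedgeOp (Λ.sharp (ε p))) with hW
    have h1 : W w 0 x = 0 := by
      simp only [hW]
      simp only [Finset.mul_sum]
      refine (map_sum ev _ _).trans (Finset.sum_eq_zero fun p _ => ?_)
      change algebraMap ℝ R 2⁻¹ • r • (0 : N) = 0
      simp
    change r • (0 : N) - W w 0 x = 0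
    rw [h1]; simp
  · have h1 := Λ.contract_wedgeOp (N := N) ξ
    have h2 := contract_scale (R := R) (V := Module.Dual R Γ) (N := N)
    have h3 : r • ∑ p, (ξ (e p) • Λ.sharp (ε p) - ξ (Λ.sharp (ε p)) • e p) =
        r • (Λ.sharp ξ + Λ.sharp ξ) := by
      have a1 := congrArg Λ.sharp (h.span_dual ξ)
      have a2 : ∀ p, ξ (Λ.sharp (ε p)) = - ε p (Λ.sharp ξ) := fun p => Λ.toFun_skew (ε p) ξ
      simp only [map_smul, map_sum] at a1
      simp only [a2, neg_smul, sub_neg_eq_add, Finset.sum_add_distrib, smul_add, ← h.span, ← a1]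
    let om : Γ →+ AddMonoid.End (Forms R (Module.Dual R Γ) N) := AddMonoidHom.mk' wedgeOp wedgeOp_add
    have h4 : (contract ξ * ∑ p, wedgeOp (e p) * wedgeOp (Λ.sharp (ε p)) :
        AddMonoid.End (Forms R (Module.Dual R Γ) N)) =
        wedgeOp (∑ p, (ξ (e p) • Λ.sharp (ε p) - ξ (Λ.sharp (ε p)) • e p)) +
          (∑ p, wedgeOp (e p) * wedgeOp (Λ.sharp (ε p))) * contract ξ := by
      change _ = om _ + _
      rw [map_sum, Finset.mul_sum, Finset.sum_mul, ← Finset.sum_add_distrib]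
      refine Finset.sum_congr rfl fun p _ => ?_
      rw [map_sub]
      change _ = wedgeOp _ - wedgeOp _ + _
      rw [wedgeOp_smul, wedgeOp_smul, ← mul_assoc, contract_wedgeOp, sub_mul, mul_assoc (wedgeOp _),
        contract_wedgeOp, mul_sub, wedgeOp_scale, mul_assoc]
      abel
    have h5 : (scale (algebraMap ℝ R 2⁻¹) * (scale r * wedgeOp (∑ p, (ξ (e p) • Λ.sharp (ε p) -
        ξ (Λ.sharp (ε p)) • e p))) : AddMonoid.End (Forms R (Module.Dual R Γ) N)) =
        scale r * wedgeOp (Λ.sharp ξ) := by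
      rw [← wedgeOp_smul, ← wedgeOp_smul, ← wedgeOp_smul, h3, smul_add, half_smul_add_self]
    have h2' : ∀ (f : R) (T : AddMonoid.End (Forms R (Module.Dual R Γ) N)),
        contract ξ * (scale f * T) = scale f * (contract ξ * T) := fun f T => by
      rw [← mul_assoc, h2, mul_assoc]
    rw [mul_sub, sub_mul, h2', h2', h2', h1, h4, mul_add, mul_add, mul_add, h5]
    simp only [mul_assoc]
    abel

variable (hs : Function.Bijective (starMap (R := R) (Γ := Γ) (N := N) n))
  (S : SkewAlgebroid R Γ) (E : S.Connection (Module.Dual R Γ [⋀^Fin n]→ₗ[R] N))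
  (δ : ∀ X, DerivOp (S.anchor X) N) (hδ : ∀ X b, E.act X b = (S.adDual X).alt (δ X) n b)

include hδ in
theorem smul_contractD_bivector (hvan : ∀ b : Module.Dual R Γ [⋀^Fin (n + 1)]→ₗ[R] N, b = 0)
    {r : R} {e : Fin n → Γ} {ε : Fin n → Module.Dual R Γ}
    (h : IsFrame r e ε) (Λ : Bivector R Γ) (ξ : Module.Dual R Γ)
    (w : Forms R (Module.Dual R Γ) N) (x : Fin 0 → Module.Dual R Γ) :
    r • contractD hs S E ξ (Λ.wedgeOp w) 0 x =
      r • algebraMap ℝ R 2⁻¹ • (∑ p, extD S ξ (Λ.sharp (ε p)) (e p)) • w 0 x := by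
  have h1 : ∀ (f : R) u, contractD hs S E ξ (scale f u) = scale f (contractD hs S E ξ u) :=
    fun f u => DFunLike.congr_fun (contractD_scale hs S E δ hδ hvan ξ f) u
  -- A product with `X` has no component of degree zero, so the left side of `wedgeOp_contractD`
  -- vanishes there.
  have h2 : ∀ X Y, contractD hs S E ξ (wedgeOp X (wedgeOp Y w)) 0 x =
      extD S ξ Y X • w 0 x := fun X Y => by
    have h3 := DFunLike.congr_fun (wedgeOp_contractD hs S E δ hδ hvan ξ X) (wedgeOp Y w)
    have h4 := DFunLike.congr_fun (congrFun h3 0) x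
    change (0 : N) = contractD hs S E ξ (wedgeOp X (wedgeOp Y w)) 0 x +
      contract (extD S ξ X) (wedgeOp Y w) 0 x at h4
    have h5 := DFunLike.congr_fun (contract_wedgeOp (N := N) (extD S ξ X) Y) w
    have h6 := DFunLike.congr_fun (congrFun h5 0) x
    change contract (extD S ξ X) (wedgeOp Y w) 0 x = extD S ξ X Y • w 0 x - 0 at h6
    rw [h6, sub_zero] at h4
    rw [extD_skew, neg_smul]
    exact eq_neg_of_add_eq_zero_left h4.symm
  have h7 := DFunLike.congr_fun (h.scale_bivector_wedgeOp (N := N) Λ) w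
  have h8 := DFunLike.congr_fun (congrFun (congrArg (contractD hs S E ξ) h7) 0) x
  simp only [AddMonoid.End.coe_mul, Function.comp_apply, h1] at h8
  change r • contractD hs S E ξ (Λ.wedgeOp w) 0 x = algebraMap ℝ R 2⁻¹ • r •
    contractD hs S E ξ ((∑ p, wedgeOp (e p) * wedgeOp (Λ.sharp (ε p)) :
      AddMonoid.End (Forms R (Module.Dual R Γ) N)) w) 0 x at h8
  let ev : AddMonoid.End (Forms R (Module.Dual R Γ) N) →+ N := AddMonoidHom.mk'
    (fun T => contractD hs S E ξ (T w) 0 x) fun T T' => by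
      change contractD hs S E ξ (T w + T' w) 0 x = _
      rw [map_add]; rfl
  have h9 := map_sum ev (fun p => wedgeOp (e p) * wedgeOp (Λ.sharp (ε p))) Finset.univ
  rw [h8, smul_comm, Finset.sum_smul]
  refine congrArg (fun y => r • algebraMap ℝ R 2⁻¹ • y) (h9.trans ?_)
  exact Finset.sum_congr rfl fun p _ => h2 _ _

/-- The canonical action of `A*` and the Lie derivative along `Λ♯ξ` differ by a trace. -/
theorem smul_canonicalOp_dualOf {r : R} {e : Fin n → Γ} {ε : Fin n → Module.Dual R Γ}
    (h : IsFrame r e ε) (Λ : Bivector R Γ) (ξ : Module.Dual R Γ) (φ : CanonicalLine R Γ n m) :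
    r • canonicalOp n m ((S.dualOf Λ).ad ξ) φ = r • (canonicalOp n m (S.adDual (Λ.sharp ξ)) φ -
      (∑ p, extD S ξ (Λ.sharp (ε p)) (e p)) • φ) := by
  set t := ∑ p, extD S ξ (Λ.sharp (ε p)) (e p)
  ext1 P
  have h1 : r • ((S.dualOf Λ).ad ξ).alt (DerivOp.fn _) n P =
      r • ((S.adDual (Λ.sharp ξ)).alt (DerivOp.fn _) n P + t • P) := by
    ext v
    have h2 := h.toDual.smul_trace (extD S ξ ∘ₗ Λ.sharp) P v
    simp only [LinearMap.comp_apply, Module.Dual.eval_apply] at h2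
    change _ = r • t • P v at h2
    simp only [AlternatingMap.smul_apply, AlternatingMap.add_apply, DerivOp.alt_apply,
      dualOf_ad_apply, AlternatingMap.map_update_sub, Finset.sum_sub_distrib, smul_add, ← h2]
    rw [← smul_add]
    congr 1
    change S.anchor (Λ.sharp ξ) (P v) - _ = S.anchor (Λ.sharp ξ) (P v) - _ + _
    abel
  have h3 : r • φ (((S.dualOf Λ).ad ξ).alt (DerivOp.fn _) n P) =
      r • (φ ((S.adDual (Λ.sharp ξ)).alt (DerivOp.fn _) n P) + t • φ P) := by
    rw [← map_smul, h1, map_smul, map_add, map_smul]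
  rw [LinearMap.smul_apply, LinearMap.smul_apply, canonicalOp_apply, LinearMap.sub_apply,
    canonicalOp_apply, smul_sub, h3, smul_sub, smul_sub, smul_add]
  change r • lieTopForm m (S.anchor (Λ.sharp ξ)) (φ P) - _ =
    r • lieTopForm m (S.anchor (Λ.sharp ξ)) (φ P) - _ - r • t • φ P
  abel

end Trace

/-! ### Assembly over an abstract ring of functions. -/

section Main
variable {R : Type*} [CommRing R] [Algebra ℝ R] {Γ : Type*} [AddCommGroup Γ] [Module R Γ]
  {N : Type*} [AddCommGroup N] [Module R N] {n m : ℕ}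
variable {I : Type*} {τ : I → R} {l : I → N} {c : I → Module.Dual R N}
  (hL : ∀ i, IsLineFrame (τ i) (l i) (c i))
  (hR : Separates (fun i => τ i ^ 2) R) (hN : Separates (fun i => τ i ^ 2) N)
  (hG : Glues (fun i => τ i ^ 2) N)
  (q : (N ⊗[R] N) ≃ₗ[R] CanonicalLine R Γ n m)
  {d : I → Fin m → Derivation ℝ R R}
  {dx : I → Fin m → Module.Dual R (Derivation ℝ R R)} (hD : ∀ i, IsFrame (τ i) (d i) (dx i))
  {e : I → Fin n → Γ} {ε : I → Fin n → Module.Dual R Γ}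
  (hf : ∀ i, IsFrame (τ i) (e i) (ε i))

/-- The right side is also a square root of the canonical operator of `ξ`: the correction is locally
multiplication by half the trace, and the two tensor factors contribute one half each. Uniqueness of
roots concludes. -/
theorem rootConnection_dualOf_act (S : SkewAlgebroid R Γ) (Λ : Bivector R Γ)
    (hs : Function.Bijective (starMap (R := R) (Γ := Γ) (N := N) n))
    (ξ : Module.Dual R Γ) (w : Forms R (Module.Dual R Γ) N) (x : Fin 0 → Module.Dual R Γ) :
    (rootConnection hL hR hN hG q hD hf (S.dualOf Λ)).act ξ (w 0 x) =
      lieRoot hL hR hN hG q S (Λ.sharp ξ) (w 0 x) -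
        contractD hs S (dualRootConnection hL hR hN hG q hD hf S) ξ (Λ.wedgeOp w) 0 x := by
  set E := dualRootConnection hL hR hN hG q hD hf S
  have hvan : ∀ b : Module.Dual R Γ [⋀^Fin (n + 1)]→ₗ[R] N, b = 0 :=
    alternating_eq_zero (fun i => (hf i).sq.toDual) hN n.lt_succ_self
  set t : I → R := fun i => ∑ p, extD S ξ (Λ.sharp (ε i p)) (e i p)
  have hC : ∀ i (w : Forms R (Module.Dual R Γ) N) x, τ i ^ 2 • contractD hs S E ξ (Λ.wedgeOp w) 0 x
      = τ i ^ 2 • algebraMap ℝ R 2⁻¹ • t i • w 0 x := fun i w x =>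
    smul_contractD_bivector hs S E (lieRoot hL hR hN hG q S) (fun _ _ => rfl) hvan (hf i).sq Λ ξ w x
  -- Elements of `N` become forms of degree zero, which turns the correction into a map on `N`.
  let u : N → Forms R (Module.Dual R Γ) N := fun y =>
    Pi.single 0 (AlternatingMap.constOfIsEmpty R (Module.Dual R Γ) (Fin 0) y)
  have hu : ∀ y, u y 0 x = y := fun y => by
    change (Pi.single 0 _ : Forms R (Module.Dual R Γ) N) 0 x = y
    rw [Pi.single_eq_same]; rfl
  set C : N → N := fun y => contractD hs S E ξ (Λ.wedgeOp (u y)) 0 x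
  have hC' : ∀ i y, τ i ^ 2 • C y = τ i ^ 2 • algebraMap ℝ R 2⁻¹ • t i • y := fun i y => by
    rw [hC, hu]
  have h1 : contractD hs S E ξ (Λ.wedgeOp w) 0 x = C (w 0 x) :=
    hN.eq fun i => by rw [hC, hC']
  rw [h1]
  have h2 : IsRoot q (canonicalOp n m ((S.dualOf Λ).ad ξ))
      (fun y => lieRoot hL hR hN hG q S (Λ.sharp ξ) y - C y) := fun y z => by
    refine hR.alternating.linearMap.eq fun i => ?_
    refine Eq.trans ?_ (smul_canonicalOp_dualOf S (hf i).sq Λ ξ (q (y ⊗ₜ z))).symm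
    have h0 : ∀ A B : CanonicalLine R Γ n m, τ i ^ 2 • (A - B) = τ i ^ 2 • A - τ i ^ 2 • B :=
      fun A B => smul_sub _ A B
    have h0' : ∀ A B : CanonicalLine R Γ n m, τ i ^ 2 • (A + B) = τ i ^ 2 • A + τ i ^ 2 • B :=
      fun A B => smul_add _ A B
    change τ i ^ 2 • _ = τ i ^ 2 • (_ - t i • q (y ⊗ₜ z))
    rw [← isRoot_lieRoot hL hR hN hG q S (Λ.sharp ξ) y z,
      TensorProduct.sub_tmul, TensorProduct.tmul_sub, map_sub, map_sub]
    have h3 : τ i ^ 2 • q (C y ⊗ₜ z) = algebraMap ℝ R 2⁻¹ • τ i ^ 2 • t i • q (y ⊗ₜ z) := by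
      rw [← map_smul, TensorProduct.smul_tmul', hC', ← TensorProduct.smul_tmul',
        ← TensorProduct.smul_tmul', ← TensorProduct.smul_tmul', map_smul, map_smul, map_smul,
        smul_comm]
    have h4 : τ i ^ 2 • q (y ⊗ₜ C z) = algebraMap ℝ R 2⁻¹ • τ i ^ 2 • t i • q (y ⊗ₜ z) := by
      rw [← map_smul, ← TensorProduct.tmul_smul, hC', TensorProduct.tmul_smul,
        TensorProduct.tmul_smul, TensorProduct.tmul_smul, map_smul, map_smul, map_smul, smul_comm]
    have h5 := half_smul_add_self (R := R) (τ i ^ 2 • t i • q (y ⊗ₜ z))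
    rw [smul_add] at h5
    rw [h0, h0', h0', h0, h0, h3, h4]
    conv_rhs => rw [← h5]
    abel
  exact congrFun (IsRoot.unique hL hN (isRoot_rootOp hL hR hN hG q _) h2) (w 0 x)

include hL hR hN hG hD hf in
theorem exists_dirac (S : LieAlgebroid R Γ) (Λ : Bivector R Γ)
    (hΛ : ∀ X, bracketSection S.toSkewAlgebroid (schouten S.toSkewAlgebroid Λ Λ) X = 0) :
    ∃ hs : Function.Bijective (starMap (R := R) (Γ := Γ) (N := N) n),
      ∃ E E', (∀ E₁, IsDualRootAction S.toSkewAlgebroid q E₁ ↔ E₁ = E) ∧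
        (∀ E₁, IsRootAction (S.dualOf Λ) q E₁ ↔ E₁ = E') ∧
        ∀ a, dirac S.toSkewAlgebroid (S.dualOf Λ) hs E E'
          (dirac S.toSkewAlgebroid (S.dualOf Λ) hs E E' a) = 0 := by
  have hs := starMap_bijective (fun i => (hf i).sq) hN hG
  have hT := schouten_d₀ (fun i => (hf i).sq) hR S.toSkewAlgebroid Λ hΛ
  refine ⟨hs, dualRootConnection hL hR hN hG q hD hf S.toSkewAlgebroid,
    rootConnection hL hR hN hG q hD hf (S.dualOf Λ),
    isDualRootAction_iff hL hR hN hG q hD hf S.toSkewAlgebroid,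
    isRootAction_iff hL hR hN hG q hD hf _, ?_⟩
  refine dirac_dirac hs S.toSkewAlgebroid _ (lieRoot hL hR hN hG q S.toSkewAlgebroid)
    (fun _ _ => rfl) Λ _ (alternating_eq_zero (fun i => (hf i).sq.toDual) hN n.lt_succ_self)
    (rootConnection_dualOf_act hL hR hN hG q hD hf S.toSkewAlgebroid Λ hs)
    (LieAlgebroid.dOp_dOp S _ (dualRootConnection_isFlat hL hR hN hG q hD hf S)) ?_
  exact LieAlgebroid.dOp_dOp (S.exactDual Λ hΛ hT) _
    (rootConnection_isFlat hL hR hN hG q hD hf (S.exactDual Λ hΛ hT))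

end Main

/-! ### Hadamard's lemma. -/

section Hadamard
open MeasureTheory
variable {E W : Type*} [NormedAddCommGroup E] [NormedSpace ℝ E] [NormedAddCommGroup W]
  [NormedSpace ℝ W]

/-- The integral is the value at `0` of the convolution of the indicator of `(0, 1]` with `t ↦ φ p
(-t)`, for which smooth dependence on parameters is available. The bump function supplies the
compact support and equals `1` on the interval that counts. -/
theorem contDiff_parametric_integral {φ : E → ℝ → W} (hφ : ContDiff ℝ ∞ ↿φ) :
    ContDiff ℝ ∞ fun p => ∫ t in (0 : ℝ)..1, φ p t := by
  let χ : ContDiffBump (0 : ℝ) := ⟨2, 3, by norm_num, by norm_num⟩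
  let f : ℝ → ℝ := Set.indicator (Set.Ioc 0 1) 1
  let g : E → ℝ → W := fun p t => χ t • φ p (-t)
  have hg : ContDiff ℝ ∞ ↿g := by
    have h1 : ContDiff ℝ ∞ fun q : E × ℝ => χ q.2 := χ.contDiff.comp contDiff_snd
    have h2 : ContDiff ℝ ∞ fun q : E × ℝ => φ q.1 (-q.2) :=
      hφ.comp (contDiff_fst.prodMk contDiff_snd.neg)
    exact h1.smul h2
  have hf : LocallyIntegrable f volume :=
    ((integrable_indicator_iff measurableSet_Ioc).mpr
      (integrableOn_const (by simp))).locallyIntegrable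
  have key := contDiffOn_convolution_right_with_param_comp (μ := volume) (n := ⊤)
    (ContinuousLinearMap.lsmul ℝ ℝ) (v := fun _ : E => (0 : ℝ)) (s := Set.univ) (g := g) (f := f)
    (k := Metric.closedBall 0 3) contDiffOn_const isOpen_univ (isCompact_closedBall _ _)
    (fun p t _ ht => by
      have : χ t = 0 := χ.zero_of_le_dist (not_le.mp ht).le
      simp [g, this]) hf hg.contDiffOn
  rw [contDiffOn_univ] at key
  convert key using 2 with p
  rw [intervalIntegral.integral_of_le zero_le_one, convolution, ← integral_indicator measurableSet_Ioc]
  congr 1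
  ext t
  by_cases ht : t ∈ Set.Ioc (0 : ℝ) 1
  · have : χ (-t) = 1 := χ.one_of_mem_closedBall (by
      rw [mem_closedBall_zero_iff, norm_neg, Real.norm_eq_abs, abs_of_pos ht.1]
      change t ≤ 2
      linarith [ht.2])
    simp [f, g, ht, this]
  · simp [f, g, ht]

/-- Hadamard's lemma: a smooth function is its value at `z₀` plus a smooth family of linear
functions of the displacement. -/
theorem exists_hadamard [CompleteSpace W] {h : E → W} (hh : ContDiff ℝ ∞ h) (z₀ : E) :
    ∃ G : E → E →L[ℝ] W, ContDiff ℝ ∞ G ∧ G z₀ = fderiv ℝ h z₀ ∧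
      ∀ z, h z = h z₀ + G z (z - z₀) := by
  have hd : ContDiff ℝ ∞ (fderiv ℝ h) := hh.fderiv_right (by simp)
  refine ⟨fun z => ∫ t in (0 : ℝ)..1, fderiv ℝ h (z₀ + t • (z - z₀)), ?_, by simp, fun z => ?_⟩
  · refine contDiff_parametric_integral (φ := fun z t => fderiv ℝ h (z₀ + t • (z - z₀))) ?_
    refine hd.comp (contDiff_const.add ?_)
    exact contDiff_snd.smul (contDiff_fst.sub contDiff_const)
  · have hc : Continuous fun t : ℝ => fderiv ℝ h (z₀ + t • (z - z₀)) :=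
      hd.continuous.comp (by fun_prop)
    rw [ContinuousLinearMap.intervalIntegral_apply (hc.intervalIntegrable _ _)]
    have h1 : ∀ t ∈ Set.uIcc (0 : ℝ) 1, HasDerivAt (fun t : ℝ => h (z₀ + t • (z - z₀)))
        (fderiv ℝ h (z₀ + t • (z - z₀)) (z - z₀)) t := fun t _ => by
      have h2 : HasDerivAt (fun t : ℝ => z₀ + t • (z - z₀)) (z - z₀) t := by
        simpa using ((hasDerivAt_id t).smul_const (z - z₀)).const_add z₀
      exact ((hh.differentiable (by simp) _).hasFDerivAt).comp_hasDerivAt t h2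
    rw [intervalIntegral.integral_eq_sub_of_hasDerivAt h1
      ((hc.clm_apply continuous_const).intervalIntegrable _ _)]
    simp

end Hadamard

/-! ### Cut-off functions and local frames of bundles. -/

section CutOff
open Topology Bundle
variable {𝕂 : Type*} [RCLike 𝕂] {m : ℕ}
  {M : Type*} [TopologicalSpace M] [ChartedSpace (EuclideanSpace ℝ (Fin m)) M]

variable (m) in
/-- A smooth real function with closed support in `U`. -/
structure CutOff (U : Set M) where
  toFun : M → ℝ
  contMDiff : ContMDiff (𝓡 m) 𝓘(ℝ, ℝ) ∞ toFun
  tsupport_subset : tsupport toFun ⊆ U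

namespace CutOff
variable {U : Set M}

instance : CoeFun (CutOff m U) (fun _ => M → ℝ) := ⟨toFun⟩

theorem exists_eventually_eq_one [IsManifold (𝓡 m) ∞ M] [T2Space M] {x : M} (hU : U ∈ 𝓝 x) :
    ∃ ρ : CutOff m U, ∀ᶠ y in 𝓝 x, ρ y = 1 := by
  obtain ⟨f, -, hf⟩ := (SmoothBumpFunction.nhds_basis_tsupport (I := 𝓡 m) x).mem_iff.mp hU
  exact ⟨⟨f, f.contMDiff, hf⟩, f.eventuallyEq_one⟩

theorem apply_eq_zero (ρ : CutOff m U) {y : M} (hy : y ∉ U) : ρ y = 0 :=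
  image_eq_zero_of_notMem_tsupport fun h => hy (ρ.tsupport_subset h)

/-- The product of a cut-off function with a function that is smooth on `U`. -/
def smulFn (ρ : CutOff m U) (hU : IsOpen U) (g : M → 𝕂)
    (hg : ContMDiffOn (𝓡 m) 𝓘(ℝ, 𝕂) ∞ g U) : SmoothFunctions 𝕂 m M :=
  ⟨fun y => ρ y • g y, contMDiff_of_tsupport fun x hx => by
    have hxU : x ∈ U := ρ.tsupport_subset (tsupport_smul_subset_left _ _ hx)
    exact (ρ.contMDiff x).smul ((hg x hxU).contMDiffAt (hU.mem_nhds hxU))⟩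

/-- A cut-off function as a scalar. -/
def scalar (ρ : CutOff m U) : SmoothFunctions 𝕂 m M :=
  ⟨fun y => ρ y • (1 : 𝕂), ρ.contMDiff.smul contMDiff_const⟩

theorem scalar_apply (ρ : CutOff m U) (y : M) : (ρ.scalar : SmoothFunctions 𝕂 m M) y = (ρ y : 𝕂) := by
  change ρ y • (1 : 𝕂) = _
  rw [Algebra.smul_def, mul_one]

variable {F : Type*} [NormedAddCommGroup F] [NormedSpace ℝ F] [NormedSpace 𝕂 F]
  [IsScalarTower ℝ 𝕂 F]
  {A : M → Type*} [TopologicalSpace (Bundle.TotalSpace F A)]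
  [∀ x, TopologicalSpace (A x)] [∀ x, AddCommGroup (A x)] [∀ x, Module ℝ (A x)]
  [∀ x, Module 𝕂 (A x)] [FiberBundle F A] [VectorBundle ℝ F A] [VectorBundle 𝕂 F A]
  [ContMDiffVectorBundle ∞ F A (𝓡 m)]
  (e : Trivialization F (TotalSpace.proj : TotalSpace F A → M)) [MemTrivializationAtlas e]

/-- The section that is constant with value `v` in a trivialization, cut off. -/
def cutSection (ρ : CutOff m U) (hU : IsOpen U) (hUe : U ⊆ e.baseSet) (v : F) :
    Cₛ^∞⟮𝓡 m; F, A⟯ :=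
  ⟨fun y => ρ y • e.symm y v, ContMDiffOn.smul_section_of_tsupport (ρ.contMDiff.contMDiffOn) hU
    ρ.tsupport_subset (by
      rw [e.contMDiffOn_section_iff hU hUe]
      refine (contMDiffOn_const (c := v)).congr fun y hy => ?_
      rw [e.apply_mk_symm (hUe hy)])⟩

theorem cutSection_apply (ρ : CutOff m U) (hU : IsOpen U) (hUe : U ⊆ e.baseSet) (v : F) {y : M}
    (hy : y ∈ U) : (e ⟨y, ρ.cutSection e hU hUe v y⟩).2 = ρ y • v := by
  change (e ⟨y, ρ y • e.symm y v⟩).2 = _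
  rw [(e.linear ℝ (hUe hy)).2, e.apply_mk_symm (hUe hy)]

/-- A linear function of a section, read in a trivialization and cut off. -/
def coord [FiniteDimensional 𝕂 F] (ρ : CutOff m U) (hU : IsOpen U) (hUe : U ⊆ e.baseSet)
    (φ : F →ₗ[𝕂] 𝕂) : Module.Dual (SmoothFunctions 𝕂 m M) Cₛ^∞⟮𝓡 m; F, A⟯ where
  toFun s := ρ.smulFn hU (fun y => φ (e ⟨y, s y⟩).2) (by
    have h1 := (e.contMDiffOn_section_iff hU hUe).mp (s.contMDiff.contMDiffOn (s := U))
    have h2 : ContDiff ℝ ∞ φ := by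
      have : ContDiff 𝕂 ∞ φ.toContinuousLinearMap := φ.toContinuousLinearMap.contDiff
      exact this.restrict_scalars ℝ
    exact h2.contMDiff.comp_contMDiffOn h1)
  map_add' s t := by
    ext y
    change ρ y • φ (e ⟨y, s y + t y⟩).2 = ρ y • φ (e ⟨y, s y⟩).2 + ρ y • φ (e ⟨y, t y⟩).2
    by_cases hy : y ∈ U
    · rw [(e.linear 𝕂 (hUe hy)).1, map_add, smul_add]
    · simp [ρ.apply_eq_zero hy]
  map_smul' f s := by
    ext y
    change ρ y • φ (e ⟨y, f y • s y⟩).2 = f y * ρ y • φ (e ⟨y, s y⟩).2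
    by_cases hy : y ∈ U
    · rw [(e.linear 𝕂 (hUe hy)).2, map_smul, smul_eq_mul, mul_smul_comm]
    · simp [ρ.apply_eq_zero hy]

/-- The cut-offs in frame and coframe equal `1` wherever `τ` is nonzero, so multiplication by `τ`
hides them. -/
theorem isFrame [FiniteDimensional 𝕂 F] (ρ : CutOff m U) (hU : IsOpen U) (hUe : U ⊆ e.baseSet)
    {n : ℕ} (b : Module.Basis (Fin n) 𝕂 F) {τ : SmoothFunctions 𝕂 m M}
    (hτ : ∀ y, τ y ≠ 0 → ρ y = 1) :
    IsFrame τ (fun i => (ρ.cutSection e hU hUe (b i) : Cₛ^∞⟮𝓡 m; F, A⟯))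
      (fun i => ρ.coord e hU hUe (b.coord i)) where
  span X := by
    ext y
    rw [smul_section_apply, smul_section_apply]
    by_cases hy : τ y = 0
    · rw [hy, zero_smul, zero_smul]
    have h1 := hτ y hy
    have hyU : y ∈ U := by
      by_contra h
      rw [ρ.apply_eq_zero h] at h1; exact zero_ne_one h1
    congr 1
    have h2 : Function.Injective (e.linearEquivAt 𝕂 y (hUe hyU)) := LinearEquiv.injective _
    apply h2
    let ev : Cₛ^∞⟮𝓡 m; F, A⟯ →+ A y := AddMonoidHom.mk' (fun s => s y) fun s t => rfl
    change _ = e.linearEquivAt 𝕂 y (hUe hyU) (ev _)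
    rw [map_sum, map_sum]
    change (e ⟨y, X y⟩).2 = ∑ i, (e ⟨y, (ρ.coord e hU hUe (b.coord i) X) y •
      (ρ.cutSection e hU hUe (b i) : Cₛ^∞⟮𝓡 m; F, A⟯) y⟩).2
    refine (b.sum_repr (e ⟨y, X y⟩).2).symm.trans (Finset.sum_congr rfl fun i _ => ?_)
    rw [(e.linear 𝕂 (hUe hyU)).2, ρ.cutSection_apply e hU hUe _ hyU, h1, one_smul]
    change _ = (ρ y • b.coord i (e ⟨y, X y⟩).2) • b i
    rw [h1, one_smul]; rfl
  dual i j := by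
    ext y
    change τ y * ρ y • b.coord i (e ⟨y, (ρ.cutSection e hU hUe (b j) : Cₛ^∞⟮𝓡 m; F, A⟯) y⟩).2 = _
    by_cases hy : τ y = 0
    · rw [hy, zero_mul]; split_ifs
      · exact hy.symm
      · rfl
    have h1 := hτ y hy
    have hyU : y ∈ U := by
      by_contra h
      rw [ρ.apply_eq_zero h] at h1; exact zero_ne_one h1
    rw [ρ.cutSection_apply e hU hUe _ hyU, h1, one_smul, one_smul, b.coord_apply, b.repr_self]
    by_cases hij : i = j
    · rw [if_pos hij, hij, Finsupp.single_eq_same, mul_one]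
    · rw [if_neg hij, Finsupp.single_eq_of_ne (by simpa [eq_comm] using hij), mul_zero]; rfl

end CutOff
end CutOff

/-! ### Derivations of smooth functions are vector fields. -/

section VectorFields
open Topology
variable {𝕂 : Type*} [RCLike 𝕂] {m : ℕ}
  {M : Type*} [TopologicalSpace M] [ChartedSpace (EuclideanSpace ℝ (Fin m)) M]
  [IsManifold (𝓡 m) ∞ M]

/-- A constant function. -/
def constFn (c : 𝕂) : SmoothFunctions 𝕂 m M := ⟨fun _ => c, contMDiff_const⟩

/-- Derivations are only `ℝ`-linear. In the complex case `D(i) = 0` follows from `i² = -1`, since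
`2i D(i) = 0`. -/
theorem derivation_constFn (D : Derivation ℝ (SmoothFunctions 𝕂 m M) (SmoothFunctions 𝕂 m M))
    (c : 𝕂) : D (constFn c) = 0 := by
  have h1 : (constFn c : SmoothFunctions 𝕂 m M) =
      RCLike.re c • 1 + RCLike.im c • constFn (RCLike.I : 𝕂) := by
    ext y
    change c = RCLike.re c • (1 : 𝕂) + RCLike.im c • (RCLike.I : 𝕂)
    rw [Algebra.smul_def, Algebra.smul_def, mul_one]
    exact (RCLike.re_add_im c).symm
  have hI : D (constFn (RCLike.I : 𝕂)) = 0 := by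
    rcases RCLike.I_mul_I (K := 𝕂) with h | h
    · have : (constFn (RCLike.I : 𝕂) : SmoothFunctions 𝕂 m M) = 0 := by
        ext y; exact h
      rw [this, map_zero]
    · have h2 : (constFn (RCLike.I : 𝕂) : SmoothFunctions 𝕂 m M) * constFn (RCLike.I : 𝕂) =
          (-1 : ℝ) • 1 := by
        ext y
        change (RCLike.I : 𝕂) * RCLike.I = (-1 : ℝ) • (1 : 𝕂)
        rw [h, neg_smul, one_smul]
      have h3 := congrArg D h2
      rw [D.leibniz, D.map_smul, D.map_one_eq_zero, smul_zero] at h3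
      ext y
      have h4 := DFunLike.congr_fun h3 y
      change (RCLike.I : 𝕂) * D (constFn RCLike.I) y + (RCLike.I : 𝕂) * D (constFn RCLike.I) y = 0 at h4
      change D (constFn RCLike.I) y = 0
      have h5 : (RCLike.I : 𝕂) ≠ 0 := by rintro h0; rw [h0] at h; simp at h
      rw [← mul_add, ← two_mul] at h4
      simpa [h5] using h4
  rw [h1, map_add, D.map_smul, D.map_smul, hI, D.map_one_eq_zero, smul_zero, smul_zero, add_zero]

/-- A cut-off that is `1` at `y` and supported where `f = g` annihilates `f - g`; the Leibniz rule
for this product is evaluated at `y`. -/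
theorem derivation_congr [T2Space M]
    (D : Derivation ℝ (SmoothFunctions 𝕂 m M) (SmoothFunctions 𝕂 m M))
    {f g : SmoothFunctions 𝕂 m M} {y : M} (h : ∀ᶠ z in 𝓝 y, f z = g z) : D f y = D g y := by
  obtain ⟨σ, hσ⟩ := CutOff.exists_eventually_eq_one (m := m) h
  have h1 : (f - g) * σ.scalar = 0 := by
    ext z
    change (f z - g z) * (σ.scalar : SmoothFunctions 𝕂 m M) z = 0
    by_cases hz : f z = g z
    · rw [hz, sub_self, zero_mul]
    · rw [σ.scalar_apply, σ.apply_eq_zero hz]; simp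
  have h2 := DFunLike.congr_fun (congrArg D h1) y
  rw [D.leibniz, map_zero, map_sub] at h2
  change (f y - g y) * D σ.scalar y + (σ.scalar : SmoothFunctions 𝕂 m M) y * (D f y - D g y) = 0 at h2
  rw [h.self_of_nhds, sub_self, zero_mul, zero_add, σ.scalar_apply, hσ.self_of_nhds] at h2
  simpa [sub_eq_zero] using h2

variable {U : Set M} {x : M}

theorem contDiffOn_comp_extChartAt_symm (f : SmoothFunctions 𝕂 m M) :
    ContDiffOn ℝ ∞ (f ∘ (extChartAt (𝓡 m) x).symm) (extChartAt (𝓡 m) x).target :=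
  contMDiffOn_iff_contDiffOn.mp (f.contMDiff.comp_contMDiffOn (contMDiffOn_extChartAt_symm x))

theorem differentiableAt_comp_extChartAt_symm (f : SmoothFunctions 𝕂 m M) {y : M}
    (hy : y ∈ (extChartAt (𝓡 m) x).source) :
    DifferentiableAt ℝ (f ∘ (extChartAt (𝓡 m) x).symm) (extChartAt (𝓡 m) x y) :=
  ((contDiffOn_comp_extChartAt_symm f).contDiffAt ((isOpen_extChartAt_target x).mem_nhds
    ((extChartAt (𝓡 m) x).map_source hy))).differentiableAt (by simp)

namespace CutOff

/-- A function on the model space, pulled back by a chart and cut off. -/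
def pull (ρ : CutOff m U) (hU : IsOpen U) (hUx : U ⊆ (extChartAt (𝓡 m) x).source)
    (k : EuclideanSpace ℝ (Fin m) → 𝕂) (hk : ContDiff ℝ ∞ k) : SmoothFunctions 𝕂 m M :=
  ρ.smulFn hU (k ∘ extChartAt (𝓡 m) x) (hk.contMDiff.comp_contMDiffOn
    ((contMDiffOn_extChartAt (x := x)).mono (by rwa [extChartAt_source] at hUx)))

theorem pull_apply (ρ : CutOff m U) (hU : IsOpen U) (hUx : U ⊆ (extChartAt (𝓡 m) x).source)
    (k : EuclideanSpace ℝ (Fin m) → 𝕂) (hk : ContDiff ℝ ∞ k) (y : M) :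
    ρ.pull hU hUx k hk y = ρ y • k (extChartAt (𝓡 m) x y) := rfl

/-- The derivative in a fixed direction of a chart, cut off. -/
def partialDeriv (ρ : CutOff m U) (hU : IsOpen U) (hUx : U ⊆ (extChartAt (𝓡 m) x).source)
    (v : EuclideanSpace ℝ (Fin m)) :
    Derivation ℝ (SmoothFunctions 𝕂 m M) (SmoothFunctions 𝕂 m M) :=
  let φ := extChartAt (𝓡 m) x
  have hout : ∀ y, y ∉ U → ρ y = 0 := fun y hy => ρ.apply_eq_zero hy
  Derivation.mk'
    { toFun := fun f => ρ.smulFn hU (fun y => fderiv ℝ (f ∘ φ.symm) (φ y) v) (by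
        have h1 : ContDiffOn ℝ ∞ (fderiv ℝ (f ∘ φ.symm)) φ.target :=
          (contDiffOn_comp_extChartAt_symm f).fderiv_of_isOpen (isOpen_extChartAt_target x) (by simp)
        have h2 : ContDiffOn ℝ ∞ (fun z => fderiv ℝ (f ∘ φ.symm) z v) φ.target :=
          h1.clm_apply contDiffOn_const
        refine h2.contMDiffOn.comp ((contMDiffOn_extChartAt (x := x)).mono
          (by rwa [extChartAt_source] at hUx)) fun y hy => φ.map_source (hUx hy))
      map_add' := fun f g => by
        ext y
        change ρ y • fderiv ℝ (f ∘ φ.symm + g ∘ φ.symm) (φ y) v =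
          ρ y • fderiv ℝ (f ∘ φ.symm) (φ y) v + ρ y • fderiv ℝ (g ∘ φ.symm) (φ y) v
        by_cases hy : y ∈ U
        · rw [fderiv_add (differentiableAt_comp_extChartAt_symm f (hUx hy))
            (differentiableAt_comp_extChartAt_symm g (hUx hy)), ← smul_add]; rfl
        · simp [hout y hy]
      map_smul' := fun c f => by
        ext y
        change ρ y • fderiv ℝ (c • (f ∘ φ.symm)) (φ y) v = c • ρ y • fderiv ℝ (f ∘ φ.symm) (φ y) v
        by_cases hy : y ∈ U
        · rw [fderiv_const_smul (differentiableAt_comp_extChartAt_symm f (hUx hy)), smul_comm]; rfl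
        · simp [hout y hy] }
    fun f g => by
      ext y
      change ρ y • fderiv ℝ ((f ∘ φ.symm) * (g ∘ φ.symm)) (φ y) v =
        f y * ρ y • fderiv ℝ (g ∘ φ.symm) (φ y) v + g y * ρ y • fderiv ℝ (f ∘ φ.symm) (φ y) v
      by_cases hy : y ∈ U
      · rw [fderiv_mul (differentiableAt_comp_extChartAt_symm f (hUx hy))
            (differentiableAt_comp_extChartAt_symm g (hUx hy))]
        change ρ y • (f (φ.symm (φ y)) * fderiv ℝ (g ∘ φ.symm) (φ y) v +
          g (φ.symm (φ y)) * fderiv ℝ (f ∘ φ.symm) (φ y) v) = _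
        rw [φ.left_inv (hUx hy), smul_add, mul_smul_comm, mul_smul_comm]
      · simp [hout y hy]

theorem partialDeriv_apply (ρ : CutOff m U) (hU : IsOpen U)
    (hUx : U ⊆ (extChartAt (𝓡 m) x).source) (v : EuclideanSpace ℝ (Fin m))
    (f : SmoothFunctions 𝕂 m M) (y : M) :
    ρ.partialDeriv hU hUx v f y =
      ρ y • fderiv ℝ (f ∘ (extChartAt (𝓡 m) x).symm) (extChartAt (𝓡 m) x y) v := rfl

theorem partialDeriv_pull (ρ : CutOff m U) (hU : IsOpen U)
    (hUx : U ⊆ (extChartAt (𝓡 m) x).source) (v : EuclideanSpace ℝ (Fin m))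
    (k : EuclideanSpace ℝ (Fin m) → 𝕂) (hk : ContDiff ℝ ∞ k) {y : M}
    (hy : ∀ᶠ z in 𝓝 y, ρ z = 1) :
    ρ.partialDeriv hU hUx v (ρ.pull hU hUx k hk) y = fderiv ℝ k (extChartAt (𝓡 m) x y) v := by
  have hyU : y ∈ U := by
    by_contra h
    have := hy.self_of_nhds
    rw [ρ.apply_eq_zero h] at this; exact zero_ne_one this
  rw [partialDeriv_apply, hy.self_of_nhds, one_smul]
  set φ := extChartAt (𝓡 m) x
  have h1 : Filter.Tendsto φ.symm (𝓝 (φ y)) (𝓝 y) := by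
    have := (continuousAt_extChartAt_symm' (hUx hyU)).tendsto
    rwa [φ.left_inv (hUx hyU)] at this
  have h2 : (ρ.pull hU hUx k hk) ∘ φ.symm =ᶠ[𝓝 (φ y)] k := by
    filter_upwards [h1.eventually hy, (isOpen_extChartAt_target x).mem_nhds
      (φ.map_source (hUx hyU))] with z hz hzt
    rw [Function.comp_apply, pull_apply, hz, one_smul, φ.right_inv hzt]
  rw [h2.fderiv_eq]

/-- The `j`-th coordinate. -/
def coordCLM (j : Fin m) : EuclideanSpace ℝ (Fin m) →L[ℝ] 𝕂 :=
  RCLike.ofRealCLM ∘L EuclideanSpace.proj j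

theorem coordCLM_apply (j : Fin m) (z : EuclideanSpace ℝ (Fin m)) :
    (coordCLM j z : 𝕂) = ((z j : ℝ) : 𝕂) := rfl

theorem contDiff_coordCLM (j : Fin m) : ContDiff ℝ ∞ (coordCLM j : EuclideanSpace ℝ (Fin m) →L[ℝ] 𝕂) :=
  ContinuousLinearMap.contDiff _

/-- By Hadamard's lemma `f = f(y) + ∑ (x_j - x_j(y)) k_j` near `y`, with `k_j(y) = ∂_j f(y)`. A
derivation is local and kills constants, and the factors `x_j - x_j(y)` vanish at `y`. -/
theorem derivation_apply [T2Space M] (ρ : CutOff m U) (hU : IsOpen U)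
    (hUx : U ⊆ (extChartAt (𝓡 m) x).source) {y : M} (hy : ∀ᶠ z in 𝓝 y, ρ z = 1)
    (D : Derivation ℝ (SmoothFunctions 𝕂 m M) (SmoothFunctions 𝕂 m M))
    (f : SmoothFunctions 𝕂 m M) :
    D f y = ∑ j, D (ρ.pull hU hUx (coordCLM j) (contDiff_coordCLM j)) y *
      ρ.partialDeriv hU hUx (EuclideanSpace.single j 1) f y := by
  have hyU : y ∈ U := by
    by_contra h
    have := hy.self_of_nhds
    rw [ρ.apply_eq_zero h] at this; exact zero_ne_one this
  set φ := extChartAt (𝓡 m) x with hφ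
  have hmem : φ.target ∈ 𝓝 (φ y) :=
    (isOpen_extChartAt_target x).mem_nhds (φ.map_source (hUx hyU))
  obtain ⟨χ, hχ⟩ := CutOff.exists_eventually_eq_one (m := m) hmem
  -- The chart expression of `f` is cut off to a smooth function on the whole model space, as
  -- Hadamard's lemma requires.
  let h : SmoothFunctions 𝕂 m (EuclideanSpace ℝ (Fin m)) :=
    χ.smulFn (isOpen_extChartAt_target x) (f ∘ φ.symm) (contDiffOn_comp_extChartAt_symm f).contMDiffOn
  have hh : ContDiff ℝ ∞ h := contMDiff_iff_contDiff.mp h.contMDiff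
  have hhf : h =ᶠ[𝓝 (φ y)] f ∘ φ.symm := by
    filter_upwards [hχ] with z hz
    change χ z • (f ∘ φ.symm) z = _
    rw [hz, one_smul]
  obtain ⟨G, hG, hG0, hGz⟩ := exists_hadamard hh (φ y)
  let k : Fin m → EuclideanSpace ℝ (Fin m) → 𝕂 := fun j z => G z (EuclideanSpace.single j 1)
  have hk : ∀ j, ContDiff ℝ ∞ (k j) := fun j => hG.clm_apply contDiff_const
  have hexp : ∀ z, h z = f y + ∑ j, (coordCLM j z - coordCLM j (φ y)) * k j z := fun z => by
    rw [hGz z, hhf.self_of_nhds, Function.comp_apply, φ.left_inv (hUx hyU)]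
    congr 1
    have hz : z - φ y = ∑ j, (z j - φ y j) • EuclideanSpace.single j (1 : ℝ) := by
      ext i
      simp [Finset.sum_apply, Pi.single_apply]
    rw [hz, map_sum]
    refine Finset.sum_congr rfl fun j _ => ?_
    rw [map_smul, coordCLM_apply, coordCLM_apply, Algebra.smul_def, ← RCLike.ofReal_sub]
  let X : Fin m → SmoothFunctions 𝕂 m M := fun j =>
    ρ.pull hU hUx (coordCLM j) (contDiff_coordCLM j)
  let K : Fin m → SmoothFunctions 𝕂 m M := fun j => ρ.pull hU hUx (k j) (hk j)
  let g : SmoothFunctions 𝕂 m M :=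
    constFn (f y) + ∑ j, (X j - constFn (coordCLM j (φ y))) * K j
  have ev_sum : ∀ (z : M) (s : Fin m → SmoothFunctions 𝕂 m M), (∑ j, s j) z = ∑ j, s j z :=
    fun z s => map_sum (AddMonoidHom.mk' (fun f : SmoothFunctions 𝕂 m M => f z) fun _ _ => rfl) s _
  have hfg : ∀ᶠ z in 𝓝 y, f z = g z := by
    have hc : ContinuousAt φ y := continuousAt_extChartAt' (hUx hyU)
    filter_upwards [hy, hc.eventually hhf, hU.mem_nhds hyU] with z hz1 hz2 hzU
    rw [Function.comp_apply, φ.left_inv (hUx hzU), hexp] at hz2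
    rw [← hz2]
    change _ = f y + (∑ j, (X j - constFn (coordCLM j (φ y))) * K j : SmoothFunctions 𝕂 m M) z
    rw [ev_sum]
    congr 1
    refine Finset.sum_congr rfl fun j _ => ?_
    change _ = (ρ z • (coordCLM j (φ z) : 𝕂) - coordCLM j (φ y)) * ρ z • k j (φ z)
    rw [hz1, one_smul, one_smul]
  rw [derivation_congr D hfg, map_add, derivation_constFn, zero_add, map_sum, ev_sum]
  refine Finset.sum_congr rfl fun j _ => ?_
  rw [D.leibniz, map_sub, derivation_constFn, sub_zero]
  change (ρ y • (coordCLM j (φ y) : 𝕂) - coordCLM j (φ y)) * D (K j) y +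
    ρ y • k j (φ y) * D (X j) y = _
  rw [hy.self_of_nhds, one_smul, one_smul, sub_self, zero_mul, zero_add, mul_comm]
  congr 1
  rw [partialDeriv_apply, hy.self_of_nhds, one_smul, ← hφ, ← hhf.fderiv_eq, ← hG0]

/-- Here `ρ` has to be `1` near the points with `τ ≠ 0`, not merely at them, because the cut-off
coordinates are differentiated. -/
theorem isFrame_derivation [T2Space M] (ρ : CutOff m U) (hU : IsOpen U)
    (hUx : U ⊆ (extChartAt (𝓡 m) x).source) {τ : SmoothFunctions 𝕂 m M}
    (hτ : ∀ y, τ y ≠ 0 → ∀ᶠ z in 𝓝 y, ρ z = 1) :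
    IsFrame τ (fun j => ρ.partialDeriv hU hUx (EuclideanSpace.single j 1))
      (fun j => { toFun := fun D => D (ρ.pull hU hUx (coordCLM j) (contDiff_coordCLM j))
                  map_add' := fun _ _ => rfl
                  map_smul' := fun _ _ => rfl }) where
  span D := by
    ext f y
    rw [Derivation.smul_apply, Derivation.smul_apply]
    change τ y * D f y = τ y * _
    by_cases hy : τ y = 0
    · rw [hy, zero_mul, zero_mul]
    congr 1
    refine (ρ.derivation_apply hU hUx (hτ y hy) D f).trans ?_
    let ev : Derivation ℝ (SmoothFunctions 𝕂 m M) (SmoothFunctions 𝕂 m M) →+ 𝕂 :=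
      AddMonoidHom.mk' (fun D => D f y) fun _ _ => rfl
    exact (map_sum ev (fun j => D (ρ.pull hU hUx (coordCLM j) (contDiff_coordCLM j)) •
      ρ.partialDeriv hU hUx (EuclideanSpace.single j 1)) Finset.univ).symm
  dual i j := by
    ext y
    change τ y * ρ.partialDeriv hU hUx (EuclideanSpace.single j 1)
      (ρ.pull hU hUx (coordCLM i) (contDiff_coordCLM i)) y = _
    by_cases hy : τ y = 0
    · rw [hy, zero_mul]; split_ifs
      · exact hy.symm
      · rfl
    rw [partialDeriv_pull _ _ _ _ _ _ (hτ y hy), ContinuousLinearMap.fderiv, coordCLM_apply]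
    by_cases hij : i = j
    · subst hij; simp
    · rw [if_neg hij]; simp [hij]

end CutOff
end VectorFields

theorem IsFrame.isLineFrame {R : Type*} [CommRing R] [Algebra ℝ R] {N : Type*} [AddCommGroup N]
    [Module R N] {r : R} {e : Fin 1 → N} {ε : Fin 1 → Module.Dual R N} (h : IsFrame r e ε) :
    IsLineFrame r (e 0) (ε 0) where
  span x := by rw [h.span]; simp
  dual := by rw [h.dual]; simp

/-! ### Separation and gluing for smooth functions and sections. -/

section Localization
open Topology Bundle
variable {𝕂 : Type*} [RCLike 𝕂] {m : ℕ}
  {M : Type*} [TopologicalSpace M] [ChartedSpace (EuclideanSpace ℝ (Fin m)) M]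
  {τ : M → SmoothFunctions 𝕂 m M} (hτ : ∀ x, ∀ᶠ y in 𝓝 x, τ x y = 1)

include hτ in
theorem sq_apply_eq_one {x y : M} (h : τ x y = 1) : (τ x ^ 2) y = 1 := by
  rw [pow_two]; change τ x y * τ x y = 1; rw [h, one_mul]

include hτ in
theorem separates_smoothFunctions : Separates (fun x => τ x ^ 2) (SmoothFunctions 𝕂 m M) :=
  fun f hf => by
    ext x
    have h : (τ x ^ 2) x * f x = 0 := DFunLike.congr_fun (hf x) x
    rwa [sq_apply_eq_one hτ (hτ x).self_of_nhds, one_mul] at h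

variable {F : Type*} [NormedAddCommGroup F] [NormedSpace ℝ F] [NormedSpace 𝕂 F]
  [IsScalarTower ℝ 𝕂 F]
  {A : M → Type*} [TopologicalSpace (TotalSpace F A)]
  [∀ x, TopologicalSpace (A x)] [∀ x, AddCommGroup (A x)] [∀ x, Module ℝ (A x)]
  [∀ x, Module 𝕂 (A x)] [FiberBundle F A] [VectorBundle ℝ F A] [VectorBundle 𝕂 F A]

include hτ in
theorem separates_sections : Separates (fun x => τ x ^ 2) Cₛ^∞⟮𝓡 m; F, A⟯ := fun s hs => by
  ext x
  have h : (τ x ^ 2) x • s x = 0 := DFunLike.congr_fun (hs x) x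
  rwa [sq_apply_eq_one hτ (hτ x).self_of_nhds, one_smul] at h

-- The glued section is `y ↦ a y y`. Compatibility makes `a x` its multiple by `τ x ^ 2`, so near
-- `x` it coincides with the smooth section `a x`.
include hτ in
theorem glues_sections : Glues (fun x => τ x ^ 2) Cₛ^∞⟮𝓡 m; F, A⟯ := fun a ha => by
  have h : ∀ x y, (τ x ^ 2) y • a y y = a x y := fun x y => by
    have h1 : (τ x ^ 2) y • a y y = (τ y ^ 2) y • a x y := DFunLike.congr_fun (ha x y) y
    rwa [sq_apply_eq_one hτ (hτ y).self_of_nhds, one_smul] at h1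
  refine ⟨⟨fun y => a y y, fun x => ?_⟩, fun x => ?_⟩
  · refine ((a x).contMDiff x).congr_of_eventuallyEq ?_
    filter_upwards [hτ x] with y hy
    rw [← h x y, sq_apply_eq_one hτ hy, one_smul]
  · ext y
    exact h x y

end Localization

end DiracGen
end

/-! ### The theorem, from local trivializations and charts. -/

theorem mainTheorem8 {𝕂 : Type*} [RCLike 𝕂] {m : ℕ}
    {M : Type*} [TopologicalSpace M] [ChartedSpace (EuclideanSpace ℝ (Fin m)) M]
    [IsManifold (𝓡 m) ∞ M] [T2Space M] [SecondCountableTopology M]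
    {F : Type*} [NormedAddCommGroup F] [NormedSpace ℝ F] [NormedSpace 𝕂 F]
    [IsScalarTower ℝ 𝕂 F] [FiniteDimensional 𝕂 F]
    {A : M → Type*} [TopologicalSpace (Bundle.TotalSpace F A)]
    [∀ x, TopologicalSpace (A x)] [∀ x, AddCommGroup (A x)] [∀ x, Module ℝ (A x)]
    [∀ x, Module 𝕂 (A x)] [FiberBundle F A] [VectorBundle ℝ F A] [VectorBundle 𝕂 F A]
    [ContMDiffVectorBundle ∞ F A (𝓡 m)]
    {L : M → Type*} [TopologicalSpace (Bundle.TotalSpace 𝕂 L)]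
    [∀ x, TopologicalSpace (L x)] [∀ x, AddCommGroup (L x)] [∀ x, Module ℝ (L x)]
    [∀ x, Module 𝕂 (L x)] [FiberBundle 𝕂 L] [VectorBundle ℝ 𝕂 L] [VectorBundle 𝕂 𝕂 L]
    [ContMDiffVectorBundle ∞ 𝕂 L (𝓡 m)]
    (𝒜 : LieAlgebroid (SmoothFunctions 𝕂 m M) Cₛ^∞⟮𝓡 m; F, A⟯)
    (Λ : Bivector (SmoothFunctions 𝕂 m M) Cₛ^∞⟮𝓡 m; F, A⟯)
    (hΛ : ∀ X, bracketSection 𝒜.toSkewAlgebroid (schouten 𝒜.toSkewAlgebroid Λ Λ) X = 0)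
    (q : (Cₛ^∞⟮𝓡 m; 𝕂, L⟯ ⊗[SmoothFunctions 𝕂 m M] Cₛ^∞⟮𝓡 m; 𝕂, L⟯) ≃ₗ[SmoothFunctions 𝕂 m M]
      CanonicalLine (SmoothFunctions 𝕂 m M) Cₛ^∞⟮𝓡 m; F, A⟯ (Module.finrank 𝕂 F) m) :
    ∃ hs : Function.Bijective (starMap (R := SmoothFunctions 𝕂 m M) (Γ := Cₛ^∞⟮𝓡 m; F, A⟯)
        (N := Cₛ^∞⟮𝓡 m; 𝕂, L⟯) (Module.finrank 𝕂 F)),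
      ∃ E E', (∀ E₁, IsDualRootAction 𝒜.toSkewAlgebroid q E₁ ↔ E₁ = E) ∧
        (∀ E₁, IsRootAction (𝒜.dualOf Λ) q E₁ ↔ E₁ = E') ∧
        ∀ a, dirac 𝒜.toSkewAlgebroid (𝒜.dualOf Λ) hs E E'
          (dirac 𝒜.toSkewAlgebroid (𝒜.dualOf Λ) hs E E' a) = 0 := by
  let V : M → Set M := fun x => (trivializationAt F A x).baseSet ∩
    (trivializationAt 𝕂 L x).baseSet ∩ (extChartAt (𝓡 m) x).source
  have hV : ∀ x, IsOpen (V x) := fun x =>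
    ((trivializationAt F A x).open_baseSet.inter (trivializationAt 𝕂 L x).open_baseSet).inter
      (isOpen_extChartAt_source x)
  have hVx : ∀ x, V x ∈ nhds x := fun x => (hV x).mem_nhds
    ⟨⟨FiberBundle.mem_baseSet_trivializationAt' x, FiberBundle.mem_baseSet_trivializationAt' x⟩,
      mem_extChartAt_source x⟩
  choose ρ hρ using fun x => CutOff.exists_eventually_eq_one (m := m) (hVx x)
  -- A second layer of cut-offs, supported where `ρ x` is locally constant `1`: this gives `ρ x = 1`
  -- in a neighbourhood of every point at which `τ x` is nonzero.
  choose σ hσ using fun x => CutOff.exists_eventually_eq_one (m := m)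
    (eventually_eventually_nhds.mpr (hρ x))
  let τ : M → SmoothFunctions 𝕂 m M := fun x => (σ x).scalar
  have hτ : ∀ x, ∀ᶠ y in nhds x, τ x y = 1 := fun x => by
    filter_upwards [hσ x] with y hy
    rw [CutOff.scalar_apply, hy, RCLike.ofReal_one]
  have hρτ : ∀ x y, τ x y ≠ 0 → ∀ᶠ z in nhds y, ρ x z = 1 := fun x y hy => by
    by_contra h
    refine hy ?_
    rw [CutOff.scalar_apply, (σ x).apply_eq_zero h, RCLike.ofReal_zero]
  have hρτ' : ∀ x y, τ x y ≠ 0 → ρ x y = 1 := fun x y hy => (hρτ x y hy).self_of_nhds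
  exact exists_dirac
    (fun x => ((ρ x).isFrame (A := L) (trivializationAt 𝕂 L x) (hV x) (fun y hy => hy.1.2)
      (Module.Basis.singleton (Fin 1) 𝕂) (hρτ' x)).isLineFrame)
    (separates_smoothFunctions hτ) (separates_sections hτ) (glues_sections hτ) q
    (fun x => (ρ x).isFrame_derivation (hV x) (fun y hy => hy.2) (hρτ x))
    (fun x => (ρ x).isFrame (A := A) (trivializationAt F A x) (hV x) (fun y hy => hy.1.1)
      (Module.finBasis 𝕂 F) (hρτ' x)) 𝒜 Λ hΛ
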